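/- Let $0<\alpha<1$, $0<\beta<2$, $N\ge 1$, $p>1$, $\lambda,\gamma\in\mathbb C$ with $\mathrm{Re}(\gamma\lambda)>0$, and for $\varepsilon>0$ consider the problem $$i^\alpha\,{}^cD^\alpha_{0|t}u-(-\Delta)^{\beta/2}u=\lambda|u|^p\ \text{ in }(0,T)\times\mathbb R^N,\qquad u(0,\cdot)=\varepsilon u_0, \tag{1}$$ where $i^\alpha=e^{i\pi\alpha/2}$, ${}^cD^\alpha_{0|t}u=\partial_t I^{1-\alpha}_{0|t}[u-u(0)]$ is the Caputo derivative, $I^\sigma_{0|t}g(t)=\frac1{\Gamma(\sigma)}\int_0^t(t-s)^{\sigma-1}g(s)\,ds$, and $(-\Delta)^{\sigma}v(x)=\frac{4^\sigma\Gamma(N/2+\sigma)}{\pi^{N/2}|\Gamma(-\sigma)|}\,\mathrm{p.v.}\!\int_{\mathbb R^N}\frac{v(x)-v(y)}{|x-y|^{N+2\sigma}}dy$ for $0<\sigma<1$. Let $X(T)=C([0,T),L^2(\mathbb R^N))\cap C^1([0,T),H^{-\beta/2}(\mathbb R^N))\cap L^\infty((0,T),L^p(\mathbb R^N))$. A distributional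 solution $u\in X(T)$ of (1) is one with $u(0)=\varepsilon u_0$ for which the equation holds in $\mathcal D'((0,T)\times\mathbb R^N)$. Put $\phi(x)=(1+|x|^2)^{-(N+\beta)/2}$, $A_0=\int_{\mathbb R^N}\phi\,dx$, $C_{1/2}=(p-1)p^{-\frac p{p-1}}2^{\frac1{p-1}}$. For a constant $K>0$ with $|(-\Delta)^{\beta/2}\phi|\le K\phi$ on $\mathbb R^N$ put $$C=\Big(2\,C_{1/2}\,(\mathrm{Re}\,\gamma\lambda)^{-\frac p{p-1}}|\gamma|^{\frac{p^2}{p-1}}A_0^{p}K^{\frac p{p-1}}\Big)^{1/p},\qquad D=\tfrac12\,\mathrm{Re}(\gamma\lambda)\,|\gamma|^{-p}A_0^{-(p-1)},$$ and for $R>0$ put $M_R(0)=\mathrm{Re}\big(i^\alpha\gamma\int_{\mathbb R^N}\varepsilon u_0(x)\phi(x/R)\,dx\big)$. If $g_R:=M_R(0)-C R^{N-\beta/(p-1)}>0$, let $T_b$ be the maximal existence time of the positive continuous solution $g$ of ${}^cD^\alpha_{0|t}g=D R^{-N(p-1)}g^p$, $g(0)=g_R$. Assume that $u_0\in H^s(\mathbb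 R^N)$, $s\ge0$, satisfies, for almost every $x$, $$\mathrm{Re}(i^\alpha\gamma u_0(x))\ge\begin{cases}|x|^{-k},&|x|\le1,\\0,&|x|>1,\end{cases}\qquad\text{where } k<\min\Big\{\frac N2-s,\frac{\beta}{p-1}\Big\}.$$ Then $\kappa_0:=\frac1{p-1}-\frac k\beta>0$, constants $K$ as above exist, and for each of them there is a constant $\varepsilon_3>0$ such that for every $\varepsilon\ge\varepsilon_3$ there is an $R>0$ with $g_R>0$ for which $T_b$ is finite, $$\left(\frac{R^{N(p-1)}\Gamma(1+\alpha)}{G(p)\,D\,g_R^{\,p-1}}\right)^{1/\alpha}\le T_b\le\left(\frac{R^{N(p-1)}\Gamma(1+\alpha)}{(p-1)\,D\,g_R^{\,p-1}}\right)^{1/\alpha},\qquad G(p)=\min\Big(2^p,\frac{p^p}{(p-1)^{p-1}}\Big),$$ there is no distributional solution $u\in X(T)$ of (1) for any $T>T_b$, and $$T_b\le B_2\,\varepsilon^{-\frac1{\alpha\kappa_0}},\qquad B_2=(p-1)^{-\frac1\alpha}D^{-\frac1\alpha}\Gamma(1+\alpha)^{\frac1\alpha}2^{\frac1{\alpha\kappa_0}}C^{\frac{k(p-1)}{\alpha\beta\kappa_0}}I_2^{-\frac1{\alpha\kappa_0}},\qquad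 I_2=2^{-N-\beta}\,\frac{\omega_N}{N-k},$$ where $\omega_N$ is the surface area of the unit sphere of $\mathbb R^N$. -/

import Mathlib

open MeasureTheory Set Filter Topology
open scoped ENNReal ContDiff SchwartzMap

noncomputable section

namespace FracNLS

/-- `ℝ^N` with the Euclidean norm. -/
abbrev Sp (N : ℕ) : Type := EuclideanSpace ℝ (Fin N)

/-- `L²(ℝ^N; ℂ)`. -/
abbrev L2 (N : ℕ) : Type := Lp (α := Sp N) ℂ 2

/-- The left-sided Riemann-Liouville fractional integral of order `σ`,
`(1 / Γ(σ)) ∫_0^t (t - s)^(σ - 1) g(s) ds`, for functions with values in a Banach space. -/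
def rlIntegral {V : Type*} [NormedAddCommGroup V] [NormedSpace ℝ V]
    (σ : ℝ) (g : ℝ → V) (t : ℝ) : V :=
  (Real.Gamma σ)⁻¹ • ∫ s in (0 : ℝ)..t, (t - s) ^ (σ - 1) • g s

/-- The fractional Laplacian `(-Δ)^σ`, `0 < σ < 1`, as the principal value
`c ∫ (v(x) - v(y)) / |x - y|^(N + 2σ) dy`, with `c = 4^σ Γ(N/2 + σ) / (π^(N/2) |Γ(-σ)|)`. -/
def fracLap {N : ℕ} (σ : ℝ) (v : Sp N → ℝ) (x : Sp N) : ℝ :=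
  ((4 : ℝ) ^ σ * Real.Gamma ((N : ℝ) / 2 + σ)
      / (Real.pi ^ ((N : ℝ) / 2) * |Real.Gamma (-σ)|)) *
    limUnder (𝓝[>] (0 : ℝ))
      (fun r => ∫ y in {y : Sp N | r < ‖x - y‖}, (v x - v y) / ‖x - y‖ ^ ((N : ℝ) + 2 * σ))

/-- Real-valued test functions on `(0,T) × ℝ^N`. -/
structure IsTest {N : ℕ} (T : ℝ) (ψ : ℝ × Sp N → ℝ) : Prop where
  smooth : ContDiff ℝ ∞ ψ
  compact : HasCompactSupport ψ
  support : tsupport ψ ⊆ Ioo (0 : ℝ) T ×ˢ univ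

/-- `u ∈ C([0,T), L²) ∩ C¹([0,T), H^(-β/2)) ∩ L^∞((0,T), L^p)`. The space `H^(-β/2)` is the space
of tempered distributions whose Bessel potential of order `-β/2` is in `L²`, normed by the
`L²`-norm of that potential. -/
structure MemX {N : ℕ} (β p T : ℝ) (u : ℝ → L2 N) : Prop where
  cont : ContinuousOn u (Ico 0 T)
  contDiff : ∃ v : ℝ → L2 N,
    (∀ t ∈ Ico (0 : ℝ) T,
      TemperedDistribution.besselPotential (Sp N) ℂ (-β / 2) (u t : 𝓢'(Sp N, ℂ))
        = (v t : 𝓢'(Sp N, ℂ))) ∧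
    ContDiffOn ℝ 1 v (Ico 0 T)
  bounded : ∃ M : ℝ, ∀ᵐ t ∂(volume.restrict (Ioo 0 T)),
    eLpNorm (u t) (ENNReal.ofReal p) volume ≤ ENNReal.ofReal M

/-- `u` solves `i^α D^α u - (-Δ)^(β/2) u = λ |u|^p` in the sense of distributions on
`(0,T) × ℝ^N`, with `u(0) = ε u₀`. Here `D^α u = ∂_t I^(1-α) (u - u(0))` is the Caputo derivative,
with the outer `∂_t` in the sense of distributions. -/
structure IsDistribSolution {N : ℕ} (α β p : ℝ) (lam : ℂ) (ε : ℝ) (u₀ : L2 N) (T : ℝ)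
    (u : ℝ → L2 N) : Prop where
  initial : u 0 = (ε : ℂ) • u₀
  eqn : ∀ ψ : ℝ × Sp N → ℝ, IsTest T ψ →
    Complex.I ^ (α : ℂ) *
        (-∫ t in Ioo (0 : ℝ) T, ∫ x, (rlIntegral (1 - α) (fun τ => u τ - u 0) t) x *
          ((deriv (fun τ => ψ (τ, x)) t : ℝ) : ℂ))
      - ∫ t in Ioo (0 : ℝ) T, ∫ x, (u t) x * ((fracLap (β / 2) (fun y => ψ (t, y)) x : ℝ) : ℂ)
      = lam * ∫ t in Ioo (0 : ℝ) T, ∫ x, ((‖(u t) x‖ ^ p * ψ (t, x) : ℝ) : ℂ)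

/-- `g ∈ C([0,τ), (0,∞))` solves the Caputo problem `D^α g = B g^p`, `g(0) = g₀`, on `[0,τ)`. -/
structure IsFODESolution (α p B g₀ τ : ℝ) (g : ℝ → ℝ) : Prop where
  cont : ContinuousOn g (Ico 0 τ)
  pos : ∀ t ∈ Ico (0 : ℝ) τ, 0 < g t
  initial : g 0 = g₀
  eqn : ∀ t ∈ Ioo (0 : ℝ) τ,
    HasDerivAt (rlIntegral (1 - α) (fun s => g s - g 0)) (B * g t ^ p) t

/-- `Tb` is the (finite) maximal existence time of the problem `D^α g = B g^p`, `g(0) = g₀`. -/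
def IsBlowupTime (α p B g₀ Tb : ℝ) : Prop :=
  IsLUB {τ : ℝ | 0 < τ ∧ ∃ g : ℝ → ℝ, IsFODESolution α p B g₀ τ g} Tb

/-- `φ(x) = ⟨x⟩^(-N-β)`, where `⟨x⟩ = (1 + |x|²)^(1/2)`. -/
def phi (N : ℕ) (β : ℝ) (x : Sp N) : ℝ := (1 + ‖x‖ ^ 2) ^ (-((N : ℝ) + β) / 2)

/-- `A₀ = ∫ φ`. -/
def A0 (N : ℕ) (β : ℝ) : ℝ := ∫ x, phi N β x

/-- `K` is an admissible constant in `|(-Δ)^(β/2) φ| ≤ K φ` (the constant `C_{N,N+β}`). -/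
def IsFracLapBound (N : ℕ) (β K : ℝ) : Prop :=
  0 < K ∧ ∀ x : Sp N, |fracLap (β / 2) (phi N β) x| ≤ K * phi N β x

/-- `C_{1/2} = (p - 1) p^(-p/(p-1)) 2^(1/(p-1))`. -/
def cHalf (p : ℝ) : ℝ := (p - 1) * p ^ (-p / (p - 1)) * (2 : ℝ) ^ (1 / (p - 1))

/-- The constant `C_{N,p,β,λ,γ}`, for the constant `K` in `|(-Δ)^(β/2) φ| ≤ K φ`. -/
def cC (N : ℕ) (p β : ℝ) (lam γ : ℂ) (K : ℝ) : ℝ :=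
  (2 * cHalf p * (γ * lam).re ^ (-p / (p - 1)) * ‖γ‖ ^ (p ^ 2 / (p - 1)) * A0 N β ^ p
    * K ^ (p / (p - 1))) ^ (1 / p)

/-- The constant `D_{N,p,β,λ,γ}`. -/
def cD (N : ℕ) (p β : ℝ) (lam γ : ℂ) : ℝ :=
  2⁻¹ * (γ * lam).re * ‖γ‖ ^ (-p) * A0 N β ^ (-(p - 1))

/-- `M_R(0) = Re (i^α γ ∫ f φ(x/R) dx)` for the initial value `f`. -/
def initMass {N : ℕ} (α β : ℝ) (γ : ℂ) (f : L2 N) (R : ℝ) : ℝ :=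
  (Complex.I ^ (α : ℂ) * γ * ∫ x, f x * ((phi N β (R⁻¹ • x) : ℝ) : ℂ)).re

/-- `G(p) = min(2^p, p^p / (p-1)^(p-1))`. -/
def gG (p : ℝ) : ℝ := min ((2 : ℝ) ^ p) (p ^ p / (p - 1) ^ (p - 1))

/-- `κ₀ = 1/(p-1) - k/β`. -/
def kappa0 (p β k : ℝ) : ℝ := 1 / (p - 1) - k / β

/-- The surface area of the unit sphere of `ℝ^N`. -/
def omega (N : ℕ) : ℝ := N * (volume (Metric.ball (0 : Sp N) 1)).toReal

/-- `I₂ = 2^(-N-β) ω_N / (N - k)`. -/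
def I2 (N : ℕ) (β k : ℝ) : ℝ := (2 : ℝ) ^ (-(N : ℝ) - β) * omega N * ((N : ℝ) - k)⁻¹

/-- The constant `B₂`. -/
def B2 (N : ℕ) (α p β : ℝ) (lam γ : ℂ) (k K : ℝ) : ℝ :=
  (p - 1) ^ (-1 / α) * cD N p β lam γ ^ (-1 / α) * Real.Gamma (1 + α) ^ (1 / α)
    * (2 : ℝ) ^ (1 / (α * kappa0 p β k))
    * cC N p β lam γ K ^ (k * (p - 1) / (α * β * kappa0 p β k))
    * I2 N β k ^ (-1 / (α * kappa0 p β k))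

end FracNLS

end

open FracNLS

noncomputable section

namespace FracNLS

/-! Testing the equation with `φ(x/R)` reduces it to a scalar fractional differential inequality.
Let `M(t) = Re(i^α γ ∫ u(t) φ(x/R) dx)`. After multiplication by `γ`, the real part says that the
Caputo derivative of `M` is `Re(γ ∫ u (-Δ)^(β/2)[φ(·/R)]) + Re(γλ) ∫ |u|^p φ(·/R)`. Since
`|(-Δ)^(β/2) φ| ≤ K φ`, the first term is at most `|γ| K R^(-β) ∫ |u| φ(·/R)` in modulus. Young's
inequality absorbs it into one half of the second term, and Jensen's inequality bounds the other
half below by a multiple of `|M|^p`. The outcome is `D^α M ≥ B (|M|^p - c^p)` with `B = D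
R^(-N(p-1))` and `c = C R^(N-β/(p-1))` (`le_massRhs`, `young_constant_eq`). If `M(0) > c`, then `M`
stays above `c`, and superadditivity of the `p`-th power makes `M - c` a supersolution of `D^α g = B
g^p` (`isSupersolution_sub_const`).

For the scalar problem, monotone iteration below a supersolution produces a nondecreasing solution
on the same interval, so no supersolution outlives `T_b` (`exists_blowupTime`). For nondecreasing
solutions the kernel `(t-s)^(α-1)` may be replaced by the smaller contribution of `s^(α-1)`. This
leaves a separable ordinary differential inequality and the upper bound for `T_b`
(`rpow_le_of_monotone_solution`). Constant supersolutions give the lower bound.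

Two points need care. The weight is not compactly supported, so it is approximated by cutoffs whose
fractional Laplacians are dominated by one multiple of `φ` (`exists_isPhiBounded`,
`tendsto_fracLap`). The Caputo derivative exists only in the sense of distributions, so the
inequality for `M` comes from a du Bois-Reymond argument followed by inversion of Abel's operator
(`eq_primitive_of_weak_deriv`, `rlIntegral_le_of_primitive`).

For the initial values at hand, `M_R(0) > ε I₂ R^(N-k)` when `R ≤ 1` (`initMass_ge`). The scale with
`ε I₂ R^(N-k) = 2 C R^(N-β/(p-1))` is at most `1` for large `ε` because `k < β/(p-1)`. There `g_R`
exceeds `C R^(N-β/(p-1))`, and inserting this in the upper bound for `T_b` gives the power of `ε`.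
-/

/-! ### Fractional integrals of bounded functions -/

/-- `f` is measurable and essentially bounded by `M` on `(0,t)`. -/
structure BddOn (f : ℝ → ℝ) (t M : ℝ) : Prop where
  meas : AEStronglyMeasurable f (volume.restrict (Ioc 0 t))
  bound : ∀ᵐ s ∂(volume.restrict (Ioc 0 t)), ‖f s‖ ≤ M

theorem BddOn.mono {f : ℝ → ℝ} {t t' M : ℝ} (h : BddOn f t M) (ht : t' ≤ t) : BddOn f t' M :=
  ⟨h.meas.mono_set (Ioc_subset_Ioc_right ht),
    ae_restrict_of_ae_restrict_of_subset (Ioc_subset_Ioc_right ht) h.bound⟩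

theorem BddOn.integrableOn {f : ℝ → ℝ} {t M : ℝ} (h : BddOn f t M) :
    IntegrableOn f (Ioc 0 t) :=
  IntegrableOn.of_bound (by simp) h.meas M h.bound

theorem BddOn.intervalIntegrable {f : ℝ → ℝ} {t M : ℝ} (h : BddOn f t M) (ht : 0 ≤ t) :
    IntervalIntegrable f volume 0 t :=
  (intervalIntegrable_iff_integrableOn_Ioc_of_le ht).2 h.integrableOn

theorem BddOn.nonneg {f : ℝ → ℝ} {t M : ℝ} (h : BddOn f t M) (ht : 0 < t) : 0 ≤ M := by
  have : (volume.restrict (Ioc 0 t)) ≠ 0 := by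
    simp [Measure.restrict_eq_zero, ht]
  have : (ae (volume.restrict (Ioc 0 t))).NeBot := ae_neBot.2 this
  obtain ⟨s, hs⟩ := h.bound.exists
  exact (norm_nonneg _).trans hs

theorem ContinuousOn.bddOn {f : ℝ → ℝ} {T t : ℝ} (hf : ContinuousOn f (Ico 0 T)) (ht : t < T) :
    ∃ M, BddOn f t M := by
  have hc : ContinuousOn f (Icc 0 t) := hf.mono (fun x hx => ⟨hx.1, hx.2.trans_lt ht⟩)
  obtain ⟨M, hM⟩ := isCompact_Icc.exists_bound_of_continuousOn hc
  refine ⟨M, (hc.mono Ioc_subset_Icc_self).aestronglyMeasurable measurableSet_Ioc, ?_⟩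
  filter_upwards [ae_restrict_mem measurableSet_Ioc] with s hs using hM s (Ioc_subset_Icc_self hs)

theorem intervalIntegrable_kernel {σ : ℝ} (hσ : 0 < σ) (t a b : ℝ) :
    IntervalIntegrable (fun s => (t - s) ^ (σ - 1)) volume a b := by
  have := (intervalIntegral.intervalIntegrable_rpow' (a := t - a) (b := t - b)
    (r := σ - 1) (by linarith)).comp_sub_left t
  simpa using this

theorem integral_kernel {σ : ℝ} (hσ : 0 < σ) (t a b : ℝ) :
    ∫ s in a..b, (t - s) ^ (σ - 1) = ((t - a) ^ σ - (t - b) ^ σ) / σ := by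
  rw [intervalIntegral.integral_comp_sub_left (fun x => x ^ (σ - 1)) t,
    integral_rpow (Or.inl (by linarith))]
  simp

theorem BddOn.kernel_mul {f : ℝ → ℝ} {t M σ : ℝ} (h : BddOn f t M) (hσ : 0 < σ) (ht : 0 ≤ t)
    (r : ℝ) : IntervalIntegrable (fun s => (r - s) ^ (σ - 1) * f s) volume 0 t := by
  rw [intervalIntegrable_iff_integrableOn_Ioc_of_le ht]
  have h1 := (intervalIntegrable_iff_integrableOn_Ioc_of_le ht).1
    (intervalIntegrable_kernel hσ r 0 t)
  exact h1.mul_bdd h.meas h.bound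

theorem rlIntegral_eq (σ : ℝ) (g : ℝ → ℝ) (t : ℝ) :
    rlIntegral σ g t = (Real.Gamma σ)⁻¹ * ∫ s in (0 : ℝ)..t, (t - s) ^ (σ - 1) * g s := by
  simp [rlIntegral]

theorem rlIntegral_one (g : ℝ → ℝ) (t : ℝ) :
    rlIntegral 1 g t = ∫ s in (0 : ℝ)..t, g s := by
  simp [rlIntegral]

theorem rlIntegral_zero_right {V : Type*} [NormedAddCommGroup V] [NormedSpace ℝ V]
    (σ : ℝ) (g : ℝ → V) : rlIntegral σ g 0 = 0 := by
  simp [rlIntegral]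

theorem rlIntegral_const {σ : ℝ} (hσ : 0 < σ) (c t : ℝ) :
    rlIntegral σ (fun _ => c) t = c * (t ^ σ / Real.Gamma (1 + σ)) := by
  rw [rlIntegral_eq, intervalIntegral.integral_mul_const, integral_kernel hσ, add_comm 1 σ,
    Real.Gamma_add_one hσ.ne']
  have := (Real.Gamma_pos_of_pos hσ).ne'
  simp [Real.zero_rpow hσ.ne']
  field_simp

theorem rlIntegral_congr {σ : ℝ} {f g : ℝ → ℝ} {t : ℝ} (ht : 0 ≤ t)
    (h : ∀ s ∈ Ioc 0 t, f s = g s) : rlIntegral σ f t = rlIntegral σ g t := by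
  rw [rlIntegral_eq, rlIntegral_eq]
  congr 1
  refine intervalIntegral.integral_congr_ae (Eventually.of_forall fun s hs => ?_)
  rw [uIoc_of_le ht] at hs
  rw [h s hs]

theorem rlIntegral_mono_ae {σ : ℝ} (hσ : 0 < σ) {f g : ℝ → ℝ} {t M M' : ℝ} (ht : 0 ≤ t)
    (hf : BddOn f t M) (hg : BddOn g t M')
    (h : ∀ᵐ s ∂(volume.restrict (Ioc 0 t)), f s ≤ g s) :
    rlIntegral σ f t ≤ rlIntegral σ g t := by
  rw [rlIntegral_eq, rlIntegral_eq]
  refine mul_le_mul_of_nonneg_left ?_ (inv_nonneg.2 (Real.Gamma_pos_of_pos hσ).le)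
  refine intervalIntegral.integral_mono_ae_restrict ht (hf.kernel_mul hσ ht t)
    (hg.kernel_mul hσ ht t) ?_
  rw [← restrict_Ioc_eq_restrict_Icc]
  filter_upwards [h, ae_restrict_mem measurableSet_Ioc] with s hs hs'
  exact mul_le_mul_of_nonneg_left hs (Real.rpow_nonneg (by linarith [hs'.2]) _)

theorem rlIntegral_nonneg {σ : ℝ} (hσ : 0 < σ) {f : ℝ → ℝ} {t : ℝ} (ht : 0 ≤ t)
    (h : ∀ s ∈ Ioc 0 t, 0 ≤ f s) : 0 ≤ rlIntegral σ f t := by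
  rw [rlIntegral_eq]
  refine mul_nonneg (inv_nonneg.2 (Real.Gamma_pos_of_pos hσ).le) ?_
  rw [intervalIntegral.integral_of_le ht]
  refine setIntegral_nonneg measurableSet_Ioc fun s hs => ?_
  exact mul_nonneg (Real.rpow_nonneg (by linarith [hs.2]) _) (h s hs)

/-- Split the integral up to `b` at `a`. Because `σ ≤ 1`, the difference of the two kernels on
`(0,a)` has one sign, so both pieces are bounded by explicit integrals of kernels. Continuity of
fractional integrals of merely bounded functions rests on this estimate. -/
theorem abs_rlIntegral_sub_le {σ : ℝ} (hσ : 0 < σ) (hσ1 : σ ≤ 1) {f : ℝ → ℝ} {a b M : ℝ}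
    (ha : 0 ≤ a) (hab : a ≤ b) (hf : BddOn f b M) :
    |rlIntegral σ f b - rlIntegral σ f a|
      ≤ 2 * M / Real.Gamma (1 + σ) * (b - a) ^ σ := by
  rcases hab.eq_or_lt with rfl | hab'
  · simp [Real.zero_rpow hσ.ne']
  have hb : 0 < b := ha.trans_lt hab'
  have hM := hf.nonneg hb
  have hΓ := Real.Gamma_pos_of_pos hσ
  have i1 := hf.kernel_mul hσ hb.le b
  have i2 := (hf.mono hab).kernel_mul hσ ha a
  have i1a : IntervalIntegrable (fun s => (b - s) ^ (σ - 1) * f s) volume 0 a :=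
    (hf.mono hab).kernel_mul hσ ha b
  have i1b : IntervalIntegrable (fun s => (b - s) ^ (σ - 1) * f s) volume a b :=
    i1a.symm.trans i1
  have key : rlIntegral σ f b - rlIntegral σ f a = (Real.Gamma σ)⁻¹ *
      ((∫ s in (0 : ℝ)..a, ((b - s) ^ (σ - 1) - (a - s) ^ (σ - 1)) * f s)
        + ∫ s in a..b, (b - s) ^ (σ - 1) * f s) := by
    rw [rlIntegral_eq, rlIntegral_eq, ← intervalIntegral.integral_add_adjacent_intervals i1a i1b,
      ← mul_sub]
    simp_rw [sub_mul]
    rw [intervalIntegral.integral_sub i1a i2]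
    ring
  have e1 : |∫ s in (0 : ℝ)..a, ((b - s) ^ (σ - 1) - (a - s) ^ (σ - 1)) * f s|
      ≤ M * ∫ s in (0 : ℝ)..a, ((a - s) ^ (σ - 1) - (b - s) ^ (σ - 1)) := by
    rw [← intervalIntegral.integral_const_mul, ← Real.norm_eq_abs]
    refine intervalIntegral.norm_integral_le_of_norm_le ha ?_
      (((intervalIntegrable_kernel hσ a 0 a).sub (intervalIntegrable_kernel hσ b 0 a)).const_mul M)
    -- At `s = a` the kernel takes the default value of a power of `0`, and the comparison of
    -- kernels may fail there.
    have hn : ∀ᵐ s ∂(volume : Measure ℝ), s ≠ a := by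
      simp [ae_iff, measure_singleton]
    filter_upwards [(ae_restrict_iff' measurableSet_Ioc).1 (hf.mono hab).bound, hn] with s hs hne hs'
    have hsa : s < a := lt_of_le_of_ne hs'.2 hne
    have : (b - s) ^ (σ - 1) ≤ (a - s) ^ (σ - 1) :=
      Real.rpow_le_rpow_of_nonpos (by linarith) (by linarith) (by linarith)
    rw [norm_mul, Real.norm_eq_abs, abs_of_nonpos (by linarith), mul_comm, neg_sub]
    exact mul_le_mul_of_nonneg_right (hs hs') (by linarith)
  have e2 : |∫ s in a..b, (b - s) ^ (σ - 1) * f s| ≤ M * ∫ s in a..b, (b - s) ^ (σ - 1) := by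
    rw [← intervalIntegral.integral_const_mul, ← Real.norm_eq_abs]
    refine intervalIntegral.norm_integral_le_of_norm_le hab ?_
      ((intervalIntegrable_kernel hσ b a b).const_mul M)
    filter_upwards [(ae_restrict_iff' measurableSet_Ioc).1 hf.bound] with s hs hs'
    rw [norm_mul, Real.norm_eq_abs, abs_of_nonneg (Real.rpow_nonneg (by linarith [hs'.2]) _),
      mul_comm]
    exact mul_le_mul_of_nonneg_right (hs ⟨ha.trans_lt hs'.1, hs'.2⟩)
      (Real.rpow_nonneg (by linarith [hs'.2]) _)
  rw [intervalIntegral.integral_sub (intervalIntegrable_kernel hσ a 0 a)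
    (intervalIntegrable_kernel hσ b 0 a), integral_kernel hσ, integral_kernel hσ] at e1
  rw [integral_kernel hσ] at e2
  have hpow : a ^ σ ≤ b ^ σ := Real.rpow_le_rpow ha hab hσ.le
  rw [key, abs_mul, abs_of_pos (inv_pos.2 hΓ), add_comm 1 σ, Real.Gamma_add_one hσ.ne']
  have e3 := (abs_add_le (∫ s in (0 : ℝ)..a, ((b - s) ^ (σ - 1) - (a - s) ^ (σ - 1)) * f s)
    (∫ s in a..b, (b - s) ^ (σ - 1) * f s)).trans (add_le_add e1 e2)
  simp only [sub_self, sub_zero, Real.zero_rpow hσ.ne'] at e3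
  calc _ ≤ (Real.Gamma σ)⁻¹ * (2 * M * (b - a) ^ σ / σ) := by
        refine mul_le_mul_of_nonneg_left (e3.trans ?_) (inv_pos.2 hΓ).le
        rw [← sub_nonneg]
        have : 2 * M * (b - a) ^ σ / σ - (M * (a ^ σ / σ - (b ^ σ - (b - a) ^ σ) / σ)
          + M * ((b - a) ^ σ / σ)) = M * (b ^ σ - a ^ σ) / σ := by ring
        rw [this]
        exact div_nonneg (mul_nonneg hM (by linarith)) hσ.le
    _ = _ := by field_simp

theorem continuousOn_rlIntegral {σ : ℝ} (hσ : 0 < σ) (hσ1 : σ ≤ 1) {f : ℝ → ℝ} {T : ℝ}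
    (hf : ∀ t < T, ∃ M, BddOn f t M) : ContinuousOn (rlIntegral σ f) (Ico 0 T) := by
  intro t ht
  obtain ⟨b, hb1, hb2⟩ := exists_between ht.2
  obtain ⟨M, hM⟩ := hf b hb2
  have hlim : Tendsto (fun r => 2 * M / Real.Gamma (1 + σ) * |r - t| ^ σ) (𝓝[Ico 0 T] t) (𝓝 0) := by
    have : ContinuousAt (fun r => 2 * M / Real.Gamma (1 + σ) * |r - t| ^ σ) t := by
      refine continuousAt_const.mul (ContinuousAt.rpow_const (by fun_prop) (Or.inr hσ.le))
    have h2 := this.tendsto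
    simp only [sub_self, abs_zero, Real.zero_rpow hσ.ne', mul_zero] at h2
    exact h2.mono_left nhdsWithin_le_nhds
  rw [ContinuousWithinAt, tendsto_iff_norm_sub_tendsto_zero]
  refine squeeze_zero' (Eventually.of_forall fun _ => norm_nonneg _) ?_ hlim
  filter_upwards [self_mem_nhdsWithin, mem_nhdsWithin_of_mem_nhds (Iio_mem_nhds hb1)] with r hr hr'
  rcases le_total t r with h | h
  · rw [abs_of_nonneg (sub_nonneg.2 h)]
    exact abs_rlIntegral_sub_le hσ hσ1 ht.1 h (hM.mono (le_of_lt hr'))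
  · rw [abs_sub_comm, abs_of_nonneg (sub_nonneg.2 h), norm_sub_rev]
    exact abs_rlIntegral_sub_le hσ hσ1 hr.1 h (hM.mono hb1.le)

/-! ### The Beta integral and the semigroup property. -/

theorem integral_kernel_mul_kernel {a b : ℝ} (ha : 0 < a) (hb : 0 < b) {s t : ℝ} (hst : s < t) :
    ∫ r in s..t, (t - r) ^ (a - 1) * (r - s) ^ (b - 1)
      = Real.Gamma a * Real.Gamma b / Real.Gamma (a + b) * (t - s) ^ (a + b - 1) := by
  have h1 : ∫ r in s..t, (t - r) ^ (a - 1) * (r - s) ^ (b - 1)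
      = ∫ x in (0 : ℝ)..(t - s), x ^ (b - 1) * (t - s - x) ^ (a - 1) := by
    have := intervalIntegral.integral_comp_sub_right (a := s) (b := t)
      (fun x => x ^ (b - 1) * (t - s - x) ^ (a - 1)) s
    simp only [sub_self, sub_sub_sub_cancel_right] at this
    rw [← this]
    congr 1; ext r; ring
  have hts : 0 < t - s := sub_pos.2 hst
  have h2 := Complex.betaIntegral_scaled (b : ℂ) (a : ℂ) hts
  have h3 := Complex.Gamma_mul_Gamma_eq_betaIntegral (s := (b : ℂ)) (t := (a : ℂ))
    (by simpa using hb) (by simpa using ha)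
  have hG : Complex.Gamma ((b : ℂ) + a) = ((Real.Gamma (a + b) : ℝ) : ℂ) := by
    rw [add_comm, ← Complex.ofReal_add, Complex.Gamma_ofReal]
  rw [hG, Complex.Gamma_ofReal, Complex.Gamma_ofReal] at h3
  have hne : ((Real.Gamma (a + b) : ℝ) : ℂ) ≠ 0 := by
    exact_mod_cast (Real.Gamma_pos_of_pos (add_pos ha hb)).ne'
  have h4 : Complex.betaIntegral b a
      = ((Real.Gamma a * Real.Gamma b / Real.Gamma (a + b) : ℝ) : ℂ) := by
    push_cast
    rw [eq_div_iff hne, mul_comm, ← h3, mul_comm]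
  rw [h4] at h2
  rw [h1]
  have h5 : ((∫ x in (0 : ℝ)..(t - s), x ^ (b - 1) * (t - s - x) ^ (a - 1) : ℝ) : ℂ)
      = ∫ x in (0 : ℝ)..(t - s), (x : ℂ) ^ ((b : ℂ) - 1) * (((t - s : ℝ) : ℂ) - x) ^ ((a : ℂ) - 1) := by
    rw [← intervalIntegral.integral_ofReal]
    refine intervalIntegral.integral_congr fun x hx => ?_
    rw [uIcc_of_le hts.le] at hx
    push_cast [Complex.ofReal_cpow hx.1, Complex.ofReal_cpow (sub_nonneg.2 hx.2)]
    rfl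
  have h6 : ((t - s : ℝ) : ℂ) ^ ((b : ℂ) + a - 1) = (((t - s) ^ (a + b - 1) : ℝ) : ℂ) := by
    rw [Complex.ofReal_cpow hts.le]
    push_cast
    ring_nf
  rw [h2, h6] at h5
  have := h5
  rw [← Complex.ofReal_mul] at this
  rw [Complex.ofReal_injective this]
  ring

/-- A non-integrable function has integral `0` by convention, while the Beta integral is positive.
-/
theorem intervalIntegrable_kernel_mul_kernel {a b : ℝ} (ha : 0 < a) (hb : 0 < b) {s t : ℝ}
    (hst : s < t) :
    IntervalIntegrable (fun r => (t - r) ^ (a - 1) * (r - s) ^ (b - 1)) volume s t := by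
  refine intervalIntegral.intervalIntegrable_of_integral_ne_zero ?_
  rw [integral_kernel_mul_kernel ha hb hst]
  have := Real.Gamma_pos_of_pos ha
  have := Real.Gamma_pos_of_pos hb
  have := Real.Gamma_pos_of_pos (add_pos ha hb)
  have := Real.rpow_pos_of_pos (sub_pos.2 hst) (a + b - 1)
  positivity

/-- The kernel of the iterated fractional integral. -/
def iterKernel (a b t : ℝ) (q : ℝ × ℝ) : ℝ :=
  {q : ℝ × ℝ | q.2 < q.1}.indicator (fun q => (t - q.1) ^ (a - 1) * (q.1 - q.2) ^ (b - 1)) q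

theorem measurable_iterKernel (a b t : ℝ) : Measurable (iterKernel a b t) := by
  unfold iterKernel
  refine Measurable.indicator ?_ (measurableSet_lt measurable_snd measurable_fst)
  fun_prop

theorem iterKernel_fst {a b s t : ℝ} (hs : 0 < s) (c : ℝ) (r : ℝ) :
    (Ioc 0 t).indicator (fun r => iterKernel a b t (r, s) * c) r
      = (Ioc s t).indicator (fun r => (t - r) ^ (a - 1) * (r - s) ^ (b - 1) * c) r := by
  by_cases h : s < r
  · have : r ∈ Ioc 0 t ↔ r ∈ Ioc s t := by simp [h, hs.trans h]
    by_cases h' : r ∈ Ioc s t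
    · rw [indicator_of_mem h', indicator_of_mem (this.2 h'), iterKernel, indicator_of_mem]
      exact h
    · rw [indicator_of_notMem h', indicator_of_notMem (fun h2 => h' (this.1 h2))]
  · have h' : r ∉ Ioc s t := fun h' => h h'.1
    rw [indicator_of_notMem h']
    have : iterKernel a b t (r, s) = 0 := by
      rw [iterKernel, indicator_of_notMem]; exact h
    simp [indicator, this]

theorem iterKernel_nonneg {a b t r s : ℝ} (h : r ≤ t) : 0 ≤ iterKernel a b t (r, s) := by
  unfold iterKernel
  by_cases h' : s < r
  · rw [indicator_of_mem (show (r, s) ∈ {q : ℝ × ℝ | q.2 < q.1} from h')]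
    exact mul_nonneg (Real.rpow_nonneg (sub_nonneg.2 h) _)
      (Real.rpow_nonneg (sub_nonneg.2 h'.le) _)
  · rw [indicator_of_notMem (show (r, s) ∉ {q : ℝ × ℝ | q.2 < q.1} from h')]

theorem integral_iterKernel_fst {a b : ℝ} (ha : 0 < a) (hb : 0 < b) {s t : ℝ} (hs : 0 < s)
    (hst : s < t) (c : ℝ) :
    ∫ r in Ioc 0 t, iterKernel a b t (r, s) * c
      = Real.Gamma a * Real.Gamma b / Real.Gamma (a + b) * (t - s) ^ (a + b - 1) * c := by
  rw [← integral_indicator measurableSet_Ioc]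
  simp_rw [funext (iterKernel_fst (a := a) (b := b) (t := t) hs c)]
  rw [integral_indicator measurableSet_Ioc, integral_mul_const,
    ← intervalIntegral.integral_of_le hst.le, integral_kernel_mul_kernel ha hb hst]

/-- Tonelli: the kernel is nonnegative for `r ≤ t`, and its integral in `r` is the Beta integral.
What remains is a kernel of order `a + b` against the bounded function `|f|`. -/
theorem integrable_iterKernel {a b : ℝ} (ha : 0 < a) (hb : 0 < b) {f : ℝ → ℝ} {t M : ℝ}
    (ht : 0 ≤ t) (hf : BddOn f t M) :
    Integrable (fun q : ℝ × ℝ => iterKernel a b t q * f q.2)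
      ((volume.restrict (Ioc 0 t)).prod (volume.restrict (Ioc 0 t))) := by
  have hΓ : 0 < Real.Gamma a * Real.Gamma b / Real.Gamma (a + b) :=
    div_pos (mul_pos (Real.Gamma_pos_of_pos ha) (Real.Gamma_pos_of_pos hb))
      (Real.Gamma_pos_of_pos (add_pos ha hb))
  have hne : ∀ᵐ s ∂(volume.restrict (Ioc 0 t)), s ∈ Ioc 0 t ∧ s ≠ t := by
    filter_upwards [ae_restrict_mem measurableSet_Ioc,
      ae_restrict_of_ae (show ∀ᵐ s ∂(volume : Measure ℝ), s ≠ t by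
        simp [ae_iff, measure_singleton])] with s h1 h2 using ⟨h1, h2⟩
  refine (integrable_prod_iff'
    ((measurable_iterKernel a b t).aestronglyMeasurable.mul hf.meas.comp_snd)).2 ⟨?_, ?_⟩
  · filter_upwards [hne] with s hs
    change IntegrableOn (fun r => iterKernel a b t (r, s) * f s) (Ioc 0 t) volume
    rw [← integrable_indicator_iff measurableSet_Ioc]
    simp_rw [funext (iterKernel_fst (a := a) (b := b) (t := t) hs.1.1 (f s))]
    rw [integrable_indicator_iff measurableSet_Ioc]
    exact ((intervalIntegrable_iff_integrableOn_Ioc_of_le hs.1.2).1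
      (intervalIntegrable_kernel_mul_kernel ha hb (lt_of_le_of_ne hs.1.2 hs.2))).mul_const _
  · have h1 : IntegrableOn (fun s => Real.Gamma a * Real.Gamma b / Real.Gamma (a + b) *
        ((t - s) ^ (a + b - 1) * |f s|)) (Ioc 0 t) := by
      have hf' : BddOn (fun s => |f s|) t M := ⟨hf.meas.norm, by simpa using hf.bound⟩
      exact ((intervalIntegrable_iff_integrableOn_Ioc_of_le ht).1
        (hf'.kernel_mul (add_pos ha hb) ht t)).const_mul _
    refine h1.congr ?_
    filter_upwards [hne] with s hs
    have h2 : ∫ r in Ioc 0 t, ‖iterKernel a b t (r, s) * f s‖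
        = ∫ r in Ioc 0 t, iterKernel a b t (r, s) * |f s| := by
      refine setIntegral_congr_fun measurableSet_Ioc fun r hr => ?_
      simp only [norm_mul, Real.norm_eq_abs]
      rw [abs_of_nonneg (iterKernel_nonneg hr.2)]
    refine Eq.trans ?_ h2.symm
    rw [integral_iterKernel_fst ha hb hs.1.1 (lt_of_le_of_ne hs.1.2 hs.2), mul_assoc]

theorem integral_iterKernel_snd {a b r t : ℝ} (hr : r ∈ Ioc 0 t) (f : ℝ → ℝ) :
    ∫ s in Ioc 0 t, iterKernel a b t (r, s) * f s
      = (t - r) ^ (a - 1) * ∫ s in (0 : ℝ)..r, (r - s) ^ (b - 1) * f s := by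
  rw [intervalIntegral.integral_of_le hr.1.le, integral_Ioc_eq_integral_Ioo (x := (0 : ℝ)) (y := r),
    ← integral_const_mul, ← integral_indicator measurableSet_Ioc,
    ← integral_indicator measurableSet_Ioo]
  congr 1
  ext s
  by_cases h : s ∈ Ioo 0 r
  · rw [indicator_of_mem h, indicator_of_mem (show s ∈ Ioc 0 t from ⟨h.1, h.2.le.trans hr.2⟩),
      iterKernel, indicator_of_mem (show (r, s) ∈ {q : ℝ × ℝ | q.2 < q.1} from h.2)]
    ring
  · rw [indicator_of_notMem h]
    by_cases h' : s ∈ Ioc 0 t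
    · rw [indicator_of_mem h', iterKernel, indicator_of_notMem, zero_mul]
      exact fun h2 => h ⟨h'.1, h2⟩
    · rw [indicator_of_notMem h']

theorem rlIntegral_rlIntegral_aux {a b : ℝ} {f : ℝ → ℝ} {t : ℝ} (ht : 0 ≤ t) :
    rlIntegral a (rlIntegral b f) t = (Real.Gamma a)⁻¹ * ((Real.Gamma b)⁻¹ *
      ∫ r in Ioc 0 t, ∫ s in Ioc 0 t, iterKernel a b t (r, s) * f s) := by
  rw [rlIntegral_eq, intervalIntegral.integral_of_le ht, ← integral_const_mul (Real.Gamma b)⁻¹]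
  congr 1
  refine setIntegral_congr_fun measurableSet_Ioc fun r hr => ?_
  rw [integral_iterKernel_snd hr, rlIntegral_eq]
  ring

/-- The semigroup property of the fractional integrals. -/
theorem rlIntegral_rlIntegral {a b : ℝ} (ha : 0 < a) (hb : 0 < b) {f : ℝ → ℝ} {t M : ℝ}
    (ht : 0 ≤ t) (hf : BddOn f t M) :
    rlIntegral a (rlIntegral b f) t = rlIntegral (a + b) f t := by
  rw [rlIntegral_rlIntegral_aux ht, integral_integral_swap (integrable_iterKernel ha hb ht hf),
    rlIntegral_eq, intervalIntegral.integral_of_le ht]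
  have : ∫ s in Ioc 0 t, ∫ r in Ioc 0 t, iterKernel a b t (r, s) * f s
      = ∫ s in Ioc 0 t, Real.Gamma a * Real.Gamma b / Real.Gamma (a + b) *
        ((t - s) ^ (a + b - 1) * f s) := by
    rw [integral_Ioc_eq_integral_Ioo, integral_Ioc_eq_integral_Ioo]
    refine setIntegral_congr_fun measurableSet_Ioo fun s hs => ?_
    rw [integral_iterKernel_fst ha hb hs.1 hs.2, mul_assoc]
  rw [this, integral_const_mul]
  have := (Real.Gamma_pos_of_pos ha).ne'
  have := (Real.Gamma_pos_of_pos hb).ne'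
  have := (Real.Gamma_pos_of_pos (add_pos ha hb)).ne'
  field_simp

/-- A fractional integral of a bounded function is integrable. -/
theorem intervalIntegrable_rlIntegral {b : ℝ} (hb : 0 < b) {f : ℝ → ℝ} {t M : ℝ}
    (ht : 0 ≤ t) (hf : BddOn f t M) : IntervalIntegrable (rlIntegral b f) volume 0 t := by
  rw [intervalIntegrable_iff_integrableOn_Ioc_of_le ht]
  -- With outer order `1` the outer kernel is identically `1`, so the marginal given by Fubini is
  -- the inner fractional integral up to `Γ(b)`.
  have h := (integrable_iterKernel one_pos hb ht hf).integral_prod_left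
  refine (h.const_mul (Real.Gamma b)⁻¹).congr ?_
  filter_upwards [ae_restrict_mem measurableSet_Ioc] with r hr
  rw [rlIntegral_eq, integral_iterKernel_snd hr]
  simp

/-- Inversion of Abel's operator, in integrated form. -/
theorem integral_eq_integral_rlIntegral {α : ℝ} (hα : 0 < α) (hα1 : α < 1) {h F : ℝ → ℝ} {T : ℝ}
    (hh : ∀ t < T, ∃ M, BddOn h t M) (hF : ∀ t < T, ∃ M, BddOn F t M)
    (heq : ∀ t ∈ Ico 0 T, rlIntegral (1 - α) h t = ∫ s in (0 : ℝ)..t, F s) {t : ℝ}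
    (ht : t ∈ Ico 0 T) :
    ∫ s in (0 : ℝ)..t, h s = ∫ s in (0 : ℝ)..t, rlIntegral α F s := by
  obtain ⟨M, hM⟩ := hh t ht.2
  obtain ⟨M', hM'⟩ := hF t ht.2
  -- Applying `I^α` to the hypothesis gives `I^1 h` on the left and `I^α I^1 F = I^1 I^α F` on the
  -- right.
  have e1 := rlIntegral_rlIntegral hα (sub_pos.2 hα1) ht.1 hM
  have e2 := rlIntegral_rlIntegral hα one_pos ht.1 hM'
  have e3 := rlIntegral_rlIntegral one_pos hα ht.1 hM'
  rw [add_sub_cancel, rlIntegral_one] at e1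
  rw [rlIntegral_one, add_comm, ← e2] at e3
  rw [← e1, e3]
  refine rlIntegral_congr ht.1 fun s hs => ?_
  rw [heq s ⟨hs.1.le, hs.2.trans_lt ht.2⟩, rlIntegral_one]

/-- A continuous function whose primitive is nondecreasing is nonnegative. -/
theorem nonneg_of_integral_nonneg {w : ℝ → ℝ} {T : ℝ} (hw : ContinuousOn w (Ico 0 T))
    (h : ∀ a ∈ Ico 0 T, ∀ b ∈ Ico 0 T, a ≤ b → 0 ≤ ∫ s in a..b, w s) :
    ∀ t ∈ Ico 0 T, 0 ≤ w t := by
  intro t ht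
  by_contra! hneg
  have hev : ∀ᶠ s in 𝓝[Ico 0 T] t, w s < w t / 2 :=
    (hw t ht).eventually (gt_mem_nhds (by linarith))
  obtain ⟨δ, hδ, hball⟩ := Metric.mem_nhdsWithin_iff.1 hev
  set b := min ((t + T) / 2) (t + δ / 2) with hb
  have htb : t < b := lt_min (by linarith [ht.2]) (by linarith)
  have hbT : b < T := (min_le_left _ _).trans_lt (by linarith [ht.2])
  have hbδ : b ≤ t + δ / 2 := min_le_right _ _
  have h1 := h t ht b ⟨ht.1.trans htb.le, hbT⟩ htb.le
  have h2 : ∫ s in t..b, w s ≤ ∫ s in t..b, w t / 2 := by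
    refine intervalIntegral.integral_mono_on htb.le ?_ intervalIntegrable_const fun s hs => ?_
    · refine ContinuousOn.intervalIntegrable_of_Icc htb.le (hw.mono fun s hs => ?_)
      exact ⟨ht.1.trans hs.1, hs.2.trans_lt hbT⟩
    · refine le_of_lt (hball ⟨?_, ht.1.trans hs.1, hs.2.trans_lt hbT⟩)
      rw [Metric.mem_ball, Real.dist_eq, abs_lt]
      constructor <;> linarith [hs.1, hs.2]
  rw [intervalIntegral.integral_const, smul_eq_mul] at h2
  nlinarith

/-! ### The fractional differential equation `D^α g = B g^p` -/

/-- Monotonicity supplies both measurability and a bound, so the Picard iterates and their limit can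
be integrated before any continuity is known. -/
theorem MonotoneOn.bddOn {f : ℝ → ℝ} {T t : ℝ} (hf : MonotoneOn f (Ico 0 T))
    (h0 : ∀ s ∈ Ico 0 T, 0 ≤ f s) (ht : t < T) : BddOn f t (f t) := by
  have hsub : ∀ s ∈ Ioc 0 t, s ∈ Ico 0 T := fun s hs => ⟨hs.1.le, hs.2.trans_lt ht⟩
  refine ⟨(aemeasurable_restrict_of_monotoneOn measurableSet_Ioc
    (hf.mono hsub)).aestronglyMeasurable, ?_⟩
  filter_upwards [ae_restrict_mem measurableSet_Ioc] with s hs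
  rw [Real.norm_eq_abs, abs_of_nonneg (h0 s (hsub s hs))]
  exact hf (hsub s hs) ⟨hs.1.le.trans hs.2, ht⟩ hs.2

/-- Reflection moves `t` from the singular kernel to the function, which makes monotonicity in `t`
visible. -/
theorem rlIntegral_eq_reflect (σ : ℝ) (f : ℝ → ℝ) (t : ℝ) :
    rlIntegral σ f t = (Real.Gamma σ)⁻¹ * ∫ r in (0 : ℝ)..t, r ^ (σ - 1) * f (t - r) := by
  rw [rlIntegral_eq]
  have := intervalIntegral.integral_comp_sub_left (a := 0) (b := t)
    (fun r => r ^ (σ - 1) * f (t - r)) t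
  simp only [sub_sub_cancel, sub_self, sub_zero] at this
  rw [this]

theorem BddOn.reflect_mul {f : ℝ → ℝ} {t M σ : ℝ} (h : BddOn f t M) (hσ : 0 < σ) (ht : 0 ≤ t) :
    IntervalIntegrable (fun r => r ^ (σ - 1) * f (t - r)) volume 0 t := by
  have := ((h.kernel_mul hσ ht t).comp_sub_left t).symm
  simpa using this

theorem BddOn.rpow_mul {f : ℝ → ℝ} {t M σ : ℝ} (h : BddOn f t M) (hσ : 0 < σ) (ht : 0 ≤ t) :
    IntervalIntegrable (fun s => s ^ (σ - 1) * f s) volume 0 t := by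
  rw [intervalIntegrable_iff_integrableOn_Ioc_of_le ht]
  have h1 := (intervalIntegrable_iff_integrableOn_Ioc_of_le ht).1
    (intervalIntegral.intervalIntegrable_rpow' (a := 0) (b := t) (r := σ - 1) (by linarith))
  exact h1.mul_bdd h.meas h.bound

theorem MonotoneOn.rlIntegral {σ : ℝ} (hσ : 0 < σ) {f : ℝ → ℝ} {T : ℝ}
    (hf : MonotoneOn f (Ico 0 T)) (h0 : ∀ s ∈ Ico 0 T, 0 ≤ f s) :
    MonotoneOn (rlIntegral σ f) (Ico 0 T) := by
  intro a ha b hb hab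
  rw [rlIntegral_eq_reflect, rlIntegral_eq_reflect]
  refine mul_le_mul_of_nonneg_left ?_ (inv_nonneg.2 (Real.Gamma_pos_of_pos hσ).le)
  have ib := (MonotoneOn.bddOn hf h0 hb.2).reflect_mul hσ hb.1
  have ia := (MonotoneOn.bddOn hf h0 ha.2).reflect_mul hσ ha.1
  have i1 : IntervalIntegrable (fun r => r ^ (σ - 1) * f (b - r)) volume 0 a :=
    ib.mono_set (by rw [uIcc_of_le ha.1, uIcc_of_le hb.1]; exact Icc_subset_Icc_right hab)
  calc ∫ r in (0 : ℝ)..a, r ^ (σ - 1) * f (a - r)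
      ≤ ∫ r in (0 : ℝ)..a, r ^ (σ - 1) * f (b - r) := by
        refine intervalIntegral.integral_mono_on ha.1 ia i1 fun r hr => ?_
        refine mul_le_mul_of_nonneg_left (hf ?_ ?_ (by linarith)) (Real.rpow_nonneg hr.1 _)
        · exact ⟨sub_nonneg.2 hr.2, by linarith [hr.1, ha.2]⟩
        · exact ⟨by linarith [hr.2], by linarith [hr.1, hb.2]⟩
    _ ≤ ∫ r in (0 : ℝ)..b, r ^ (σ - 1) * f (b - r) := by
        refine intervalIntegral.integral_mono_interval le_rfl ha.1 hab ?_ ib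
        filter_upwards [ae_restrict_mem measurableSet_Ioc] with r hr
        exact mul_nonneg (Real.rpow_nonneg hr.1.le _)
          (h0 _ ⟨by linarith [hr.2], by linarith [hr.1, hb.2]⟩)

/-- Among the rearrangements of the kernel, the decreasing one gives the smallest integral
against a nondecreasing function. -/
theorem integral_rpow_mul_le {σ : ℝ} (hσ : 0 < σ) (hσ1 : σ ≤ 1) {f : ℝ → ℝ} {T t : ℝ}
    (hf : MonotoneOn f (Ico 0 T)) (h0 : ∀ s ∈ Ico 0 T, 0 ≤ f s) (ht : t ∈ Ico 0 T) :
    (Real.Gamma σ)⁻¹ * ∫ s in (0 : ℝ)..t, s ^ (σ - 1) * f s ≤ rlIntegral σ f t := by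
  have hb := MonotoneOn.bddOn hf h0 ht.2
  have i1 := hb.kernel_mul hσ ht.1 t
  have i2 := hb.reflect_mul hσ ht.1
  have i3 := hb.rpow_mul hσ ht.1
  have i4 : IntervalIntegrable (fun s => (t - s) ^ (σ - 1) * f (t - s)) volume 0 t := by
    simpa using (i3.comp_sub_left t).symm
  have e4 : ∫ s in (0 : ℝ)..t, (t - s) ^ (σ - 1) * f (t - s)
      = ∫ s in (0 : ℝ)..t, s ^ (σ - 1) * f s := by
    simpa using intervalIntegral.integral_comp_sub_left (a := 0) (b := t)
      (fun s => s ^ (σ - 1) * f s) t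
  have e2 : ∫ s in (0 : ℝ)..t, s ^ (σ - 1) * f (t - s)
      = ∫ s in (0 : ℝ)..t, (t - s) ^ (σ - 1) * f s := by
    have := intervalIntegral.integral_comp_sub_left (a := 0) (b := t)
      (fun r => r ^ (σ - 1) * f (t - r)) t
    simp only [sub_sub_cancel, sub_self, sub_zero] at this
    rw [this]
  -- Chebyshev's argument: the integrand is `((t-s)^(σ-1) - s^(σ-1)) (f s - f (t-s))`, whose factors
  -- have the same sign. By reflection its integral is twice the difference of the two sides.
  have key : 0 ≤ ∫ s in (0 : ℝ)..t, (((t - s) ^ (σ - 1) * f s + s ^ (σ - 1) * f (t - s))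
      - (s ^ (σ - 1) * f s + (t - s) ^ (σ - 1) * f (t - s))) := by
    rw [intervalIntegral.integral_of_le ht.1, integral_Ioc_eq_integral_Ioo]
    refine setIntegral_nonneg measurableSet_Ioo fun s hs => ?_
    have m1 : s ∈ Ico 0 T := ⟨hs.1.le, hs.2.trans ht.2⟩
    have m2 : t - s ∈ Ico 0 T := ⟨by linarith [hs.2], by linarith [hs.1, ht.2]⟩
    have hexp : σ - 1 ≤ 0 := by linarith
    have : 0 ≤ ((t - s) ^ (σ - 1) - s ^ (σ - 1)) * (f s - f (t - s)) := by
      rcases le_total s (t - s) with h | h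
      · exact mul_nonneg_of_nonpos_of_nonpos
          (sub_nonpos.2 (Real.rpow_le_rpow_of_nonpos hs.1 h hexp))
          (sub_nonpos.2 (hf m1 m2 h))
      · exact mul_nonneg (sub_nonneg.2 (Real.rpow_le_rpow_of_nonpos (sub_pos.2 hs.2) h hexp))
          (sub_nonneg.2 (hf m2 m1 h))
    linarith
  rw [intervalIntegral.integral_sub (i1.add i2) (i3.add i4), intervalIntegral.integral_add i1 i2,
    intervalIntegral.integral_add i3 i4, e2, e4] at key
  rw [rlIntegral_eq]
  exact mul_le_mul_of_nonneg_left (by linarith) (inv_nonneg.2 (Real.Gamma_pos_of_pos hσ).le)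

/-- `w` is a nonnegative continuous supersolution of the Volterra equation
`g = g₀ + I^α (B g^p)` on `[0,τ)`. -/
structure IsSupersolution (α p B g₀ τ : ℝ) (w : ℝ → ℝ) : Prop where
  cont : ContinuousOn w (Ico 0 τ)
  nonneg : ∀ t ∈ Ico (0 : ℝ) τ, 0 ≤ w t
  le : ∀ t ∈ Ico (0 : ℝ) τ, g₀ + rlIntegral α (fun s => B * w s ^ p) t ≤ w t

/-- The Picard iterates of the Volterra equation `g = g₀ + I^α (B g^p)`. -/
def picard (α p B g₀ : ℝ) : ℕ → ℝ → ℝ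
  | 0 => fun _ => g₀
  | n + 1 => fun t => g₀ + rlIntegral α (fun s => B * picard α p B g₀ n s ^ p) t

/-! ### Monotone iteration below a supersolution. -/

section Picard

variable {α p B g₀ τ : ℝ} {w : ℝ → ℝ}

theorem MonotoneOn.mul_rpow (hp : 0 ≤ p) (hB : 0 ≤ B) {f : ℝ → ℝ} {S : Set ℝ}
    (hf : MonotoneOn f S) (h0 : ∀ s ∈ S, 0 ≤ f s) : MonotoneOn (fun s => B * f s ^ p) S :=
  fun a ha _ hb hab =>
    mul_le_mul_of_nonneg_left (Real.rpow_le_rpow (h0 a ha) (hf ha hb hab) hp) hB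

theorem ContinuousOn.mul_rpow (hp : 0 ≤ p) {f : ℝ → ℝ} {S : Set ℝ}
    (hf : ContinuousOn f S) : ContinuousOn (fun s => B * f s ^ p) S :=
  continuousOn_const.mul (hf.rpow_const fun _ _ => Or.inr hp)

/-- The three properties are carried through one induction: the lower bound keeps the base of the
power nonnegative, monotonicity gives integrability, and the upper bound by `w` will give
convergence. -/
theorem picard_spec (hα : 0 < α) (hp : 0 ≤ p) (hB : 0 ≤ B) (hg : 0 < g₀)
    (hw : IsSupersolution α p B g₀ τ w) (n : ℕ) :
    MonotoneOn (picard α p B g₀ n) (Ico 0 τ) ∧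
      ∀ t ∈ Ico 0 τ, g₀ ≤ picard α p B g₀ n t ∧ picard α p B g₀ n t ≤ w t := by
  induction n with
  | zero =>
    refine ⟨fun _ _ _ _ _ => le_rfl, fun t ht => ⟨le_rfl, le_trans ?_ (hw.le t ht)⟩⟩
    have := rlIntegral_nonneg hα (f := fun s => B * w s ^ p) ht.1 fun s hs =>
      mul_nonneg hB (Real.rpow_nonneg (hw.nonneg s ⟨hs.1.le, hs.2.trans_lt ht.2⟩) _)
    simpa [picard] using this
  | succ n ih =>
    obtain ⟨ihm, ihb⟩ := ih
    have h0 : ∀ s ∈ Ico 0 τ, 0 ≤ picard α p B g₀ n s := fun s hs => hg.le.trans (ihb s hs).1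
    have hm := MonotoneOn.mul_rpow hp hB ihm h0
    have hn : ∀ s ∈ Ico 0 τ, 0 ≤ B * picard α p B g₀ n s ^ p := fun s hs =>
      mul_nonneg hB (Real.rpow_nonneg (h0 s hs) _)
    refine ⟨fun a ha b hb hab => ?_, fun t ht => ⟨?_, le_trans ?_ (hw.le t ht)⟩⟩
    · exact add_le_add le_rfl (MonotoneOn.rlIntegral hα hm hn ha hb hab)
    · exact le_add_of_nonneg_right (rlIntegral_nonneg hα ht.1 fun s hs =>
        hn s ⟨hs.1.le, hs.2.trans_lt ht.2⟩)
    · obtain ⟨M, hM⟩ := ContinuousOn.bddOn (ContinuousOn.mul_rpow (B := B) hp hw.cont) ht.2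
      refine add_le_add le_rfl (rlIntegral_mono_ae hα ht.1 (MonotoneOn.bddOn hm hn ht.2) hM ?_)
      filter_upwards [ae_restrict_mem measurableSet_Ioc] with s hs
      have hs' : s ∈ Ico 0 τ := ⟨hs.1.le, hs.2.trans_lt ht.2⟩
      exact mul_le_mul_of_nonneg_left (Real.rpow_le_rpow (h0 s hs') (ihb s hs').2 hp) hB

theorem picard_le_succ (hα : 0 < α) (hp : 0 ≤ p) (hB : 0 ≤ B) (hg : 0 < g₀)
    (hw : IsSupersolution α p B g₀ τ w) (n : ℕ) {t : ℝ} (ht : t ∈ Ico 0 τ) :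
    picard α p B g₀ n t ≤ picard α p B g₀ (n + 1) t := by
  induction n generalizing t with
  | zero => exact ((picard_spec hα hp hB hg hw 1).2 t ht).1
  | succ n ih =>
    have h0 : ∀ m, ∀ s ∈ Ico 0 τ, 0 ≤ picard α p B g₀ m s := fun m s hs =>
      hg.le.trans ((picard_spec hα hp hB hg hw m).2 s hs).1
    have hb : ∀ m, BddOn (fun s => B * picard α p B g₀ m s ^ p) t _ := fun m =>
      MonotoneOn.bddOn (MonotoneOn.mul_rpow hp hB (picard_spec hα hp hB hg hw m).1 (h0 m))
        (fun s hs => mul_nonneg hB (Real.rpow_nonneg (h0 m s hs) _)) ht.2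
    refine add_le_add le_rfl (rlIntegral_mono_ae hα ht.1 (hb n) (hb (n + 1)) ?_)
    filter_upwards [ae_restrict_mem measurableSet_Ioc] with s hs
    have hs' : s ∈ Ico 0 τ := ⟨hs.1.le, hs.2.trans_lt ht.2⟩
    exact mul_le_mul_of_nonneg_left (Real.rpow_le_rpow (h0 n s hs') (ih hs') hp) hB

/-- Below a supersolution there is a nondecreasing solution. -/
theorem IsSupersolution.exists_solution (hα : 0 < α) (hα1 : α ≤ 1) (hp : 0 ≤ p) (hB : 0 ≤ B)
    (hg : 0 < g₀) (hw : IsSupersolution α p B g₀ τ w) :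
    ∃ g : ℝ → ℝ, MonotoneOn g (Ico 0 τ) ∧ ContinuousOn g (Ico 0 τ) ∧
      (∀ t ∈ Ico 0 τ, g₀ ≤ g t) ∧
      ∀ t ∈ Ico 0 τ, g t = g₀ + rlIntegral α (fun s => B * g s ^ p) t := by
  have spec := picard_spec hα hp hB hg hw
  set g : ℝ → ℝ := fun t => ⨆ n, picard α p B g₀ n t with hgdef
  have hlim : ∀ t ∈ Ico 0 τ, Tendsto (fun n => picard α p B g₀ n t) atTop (𝓝 (g t)) :=
    fun t ht => tendsto_atTop_ciSup
      (monotone_nat_of_le_succ fun n => picard_le_succ hα hp hB hg hw n ht)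
      ⟨w t, by rintro _ ⟨n, rfl⟩; exact ((spec n).2 t ht).2⟩
  have hmono : MonotoneOn g (Ico 0 τ) := fun a ha b hb hab =>
    le_of_tendsto_of_tendsto' (hlim a ha) (hlim b hb) fun n => (spec n).1 ha hb hab
  have hge : ∀ t ∈ Ico 0 τ, g₀ ≤ g t := fun t ht =>
    ge_of_tendsto' (hlim t ht) fun n => ((spec n).2 t ht).1
  have hm := MonotoneOn.mul_rpow hp hB hmono fun t ht => hg.le.trans (hge t ht)
  have hn : ∀ s ∈ Ico 0 τ, 0 ≤ B * g s ^ p := fun s hs =>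
    mul_nonneg hB (Real.rpow_nonneg (hg.le.trans (hge s hs)) _)
  have heq : ∀ t ∈ Ico 0 τ, g t = g₀ + rlIntegral α (fun s => B * g s ^ p) t := by
    intro t ht
    refine tendsto_nhds_unique ((tendsto_add_atTop_iff_nat 1).2 (hlim t ht)) ?_
    refine tendsto_const_nhds.add ?_
    simp_rw [rlIntegral_eq]
    refine Tendsto.const_mul _ ?_
    obtain ⟨M, hM⟩ := ContinuousOn.bddOn (ContinuousOn.mul_rpow (B := B) hp hw.cont) ht.2
    -- The supersolution `w` dominates all iterates, so the limit passes inside the singular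
    -- integral.
    refine intervalIntegral.tendsto_integral_filter_of_dominated_convergence
      (fun s => (t - s) ^ (α - 1) * (B * w s ^ p)) (Eventually.of_forall fun n => ?_)
      (Eventually.of_forall fun n => Eventually.of_forall fun s hs => ?_)
      (hM.kernel_mul hα ht.1 t) (Eventually.of_forall fun s hs => ?_)
    · have := MonotoneOn.bddOn (MonotoneOn.mul_rpow hp hB (spec n).1 fun t ht =>
        hg.le.trans ((spec n).2 t ht).1) (fun s hs => mul_nonneg hB
          (Real.rpow_nonneg (hg.le.trans ((spec n).2 s hs).1) _)) ht.2
      exact (this.kernel_mul hα ht.1 t).aestronglyMeasurable_restrict_uIoc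
    · rw [uIoc_of_le ht.1] at hs
      have hs' : s ∈ Ico 0 τ := ⟨hs.1.le, hs.2.trans_lt ht.2⟩
      have h1 := (spec n).2 s hs'
      have h2 : 0 ≤ (t - s) ^ (α - 1) := Real.rpow_nonneg (by linarith [hs.2]) _
      have h3 : 0 ≤ picard α p B g₀ n s ^ p := Real.rpow_nonneg (hg.le.trans h1.1) _
      rw [Real.norm_eq_abs, abs_of_nonneg (by positivity)]
      have := Real.rpow_le_rpow (hg.le.trans h1.1) h1.2 hp
      gcongr
    · rw [uIoc_of_le ht.1] at hs
      have hs' : s ∈ Ico 0 τ := ⟨hs.1.le, hs.2.trans_lt ht.2⟩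
      exact ((((hlim s hs').rpow_const (Or.inr hp)).const_mul B).const_mul _)
  refine ⟨g, hmono, ?_, hge, heq⟩
  -- Continuity is not inherited from the pointwise limit; it follows from the integral equation,
  -- whose right-hand side is a fractional integral of a locally bounded function.
  exact (continuousOn_const.add (continuousOn_rlIntegral hα hα1 fun t ht =>
    ⟨_, MonotoneOn.bddOn hm hn ht⟩)).congr heq

theorem hasDerivAt_integral_of_continuousOn {f : ℝ → ℝ} {T t : ℝ} (hf : ContinuousOn f (Ico 0 T))
    (ht : t ∈ Ioo 0 T) : HasDerivAt (fun r => ∫ s in (0 : ℝ)..r, f s) (f t) t := by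
  refine intervalIntegral.integral_hasDerivAt_right ?_ ?_ ?_
  · refine (hf.mono ?_).intervalIntegrable
    rw [uIcc_of_le ht.1.le]
    exact fun s hs => ⟨hs.1, hs.2.trans_lt ht.2⟩
  · exact ContinuousOn.stronglyMeasurableAtFilter isOpen_Ioo
      (hf.mono Ioo_subset_Ico_self) t ht
  · exact hf.continuousAt (Ico_mem_nhds ht.1 ht.2)

/-- A positive continuous solution of the Volterra equation solves the Caputo problem. -/
theorem isFODESolution_of_eq (hα : 0 < α) (hα1 : α < 1) (hp : 0 ≤ p) (hg : 0 < g₀) {g : ℝ → ℝ}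
    (hτ : 0 < τ) (hc : ContinuousOn g (Ico 0 τ)) (hge : ∀ t ∈ Ico 0 τ, g₀ ≤ g t)
    (heq : ∀ t ∈ Ico 0 τ, g t = g₀ + rlIntegral α (fun s => B * g s ^ p) t) :
    IsFODESolution α p B g₀ τ g := by
  have h0 : g 0 = g₀ := by
    rw [heq 0 ⟨le_rfl, hτ⟩, rlIntegral_zero_right, add_zero]
  have hcF : ContinuousOn (fun s => B * g s ^ p) (Ico 0 τ) := ContinuousOn.mul_rpow hp hc
  refine ⟨hc, fun t ht => hg.trans_le (hge t ht), h0, fun t ht => ?_⟩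
  refine (hasDerivAt_integral_of_continuousOn hcF ht).congr_of_eventuallyEq ?_
  filter_upwards [Ioo_mem_nhds ht.1 ht.2] with r hr
  obtain ⟨M, hM⟩ := ContinuousOn.bddOn hcF hr.2
  -- `I^(1-α) I^α = I^1` turns `I^(1-α) (g - g₀)` into the primitive of `B g^p`.
  have := rlIntegral_rlIntegral (sub_pos.2 hα1) hα hr.1.le hM
  rw [sub_add_cancel, rlIntegral_one] at this
  rw [← this]
  refine rlIntegral_congr hr.1.le fun s hs => ?_
  rw [heq s ⟨hs.1.le, hs.2.trans_lt hr.2⟩, h0]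
  ring

/-- If `I^(1-α) h` is the primitive of `F` and `F ≥ f`, then `h ≥ I^α f`. -/
theorem rlIntegral_le_of_primitive (hα : 0 < α) (hα1 : α < 1) {h F f : ℝ → ℝ} {T : ℝ}
    (hh : ContinuousOn h (Ico 0 T)) (hF : ∀ t < T, ∃ M, BddOn F t M)
    (hf : ContinuousOn f (Ico 0 T))
    (hle : ∀ t < T, ∀ᵐ s ∂(volume.restrict (Ioc 0 t)), f s ≤ F s)
    (heq : ∀ t ∈ Ico 0 T, rlIntegral (1 - α) h t = ∫ s in (0 : ℝ)..t, F s) :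
    ∀ t ∈ Ico 0 T, rlIntegral α f t ≤ h t := by
  have hcf : ContinuousOn (rlIntegral α f) (Ico 0 T) :=
    continuousOn_rlIntegral hα hα1.le fun t ht => ContinuousOn.bddOn hf ht
  suffices H : ∀ t ∈ Ico 0 T, 0 ≤ h t - rlIntegral α f t from
    fun t ht => sub_nonneg.1 (H t ht)
  refine nonneg_of_integral_nonneg (hh.sub hcf) fun a ha b hb hab => ?_
  have ii : ∀ {k : ℝ → ℝ}, ContinuousOn k (Ico 0 T) → ∀ c ∈ Ico 0 T,
      IntervalIntegrable k volume 0 c := fun hk c hc =>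
    (hk.mono (fun s hs => ⟨hs.1, hs.2.trans_lt hc.2⟩)).intervalIntegrable_of_Icc hc.1
  have iF : ∀ c ∈ Ico 0 T, IntervalIntegrable (rlIntegral α F) volume 0 c := fun c hc => by
    obtain ⟨M, hM⟩ := hF c hc.2
    exact intervalIntegrable_rlIntegral hα hc.1 hM
  have iab : ∀ {k : ℝ → ℝ}, (∀ c ∈ Ico 0 T, IntervalIntegrable k volume 0 c) →
      IntervalIntegrable k volume a b := fun hk => (hk a ha).symm.trans (hk b hb)
  -- Abel inversion in integrated form shows that `h - I^α f` has nonnegative integral over every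
  -- `[a,b]`; its continuity then yields the pointwise claim.
  have key : ∀ c ∈ Ico 0 T, ∫ s in (0 : ℝ)..c, h s = ∫ s in (0 : ℝ)..c, rlIntegral α F s :=
    fun c hc => integral_eq_integral_rlIntegral hα hα1 (fun t ht => ContinuousOn.bddOn hh ht) hF
      heq hc
  rw [intervalIntegral.integral_sub (iab (ii hh)) (iab (ii hcf)), sub_nonneg,
    ← intervalIntegral.integral_interval_sub_left (ii hh b hb) (ii hh a ha), key b hb, key a ha,
    intervalIntegral.integral_interval_sub_left (iF b hb) (iF a ha)]
  refine intervalIntegral.integral_mono_on hab (iab (ii hcf)) (iab iF) fun s hs => ?_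
  have hs' : s < T := hs.2.trans_lt hb.2
  obtain ⟨M, hM⟩ := ContinuousOn.bddOn hf hs'
  obtain ⟨M', hM'⟩ := hF s hs'
  exact rlIntegral_mono_ae hα (ha.1.trans hs.1) hM hM' (hle s hs')

/-- Integrating the equation from `0`, where `I^(1-α)` vanishes, puts it in the form required for
Abel inversion. The inequality suffices, since all later arguments work with supersolutions. -/
theorem IsFODESolution.isSupersolution (hα : 0 < α) (hα1 : α < 1) (hp : 0 ≤ p)
    {g : ℝ → ℝ} (h : IsFODESolution α p B g₀ τ g) : IsSupersolution α p B g₀ τ g := by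
  refine ⟨h.cont, fun t ht => (h.pos t ht).le, fun t ht => ?_⟩
  have hcF : ContinuousOn (fun s => B * g s ^ p) (Ico 0 τ) := ContinuousOn.mul_rpow hp h.cont
  have hcg : ContinuousOn (fun s => g s - g 0) (Ico 0 τ) := h.cont.sub continuousOn_const
  have := rlIntegral_le_of_primitive hα hα1 hcg (fun t ht => ContinuousOn.bddOn hcF ht) hcF
    (fun _ _ => Eventually.of_forall fun _ => le_rfl) (fun t ht => ?_) t ht
  · rw [h.initial] at this
    linarith
  · have hH : ContinuousOn (rlIntegral (1 - α) fun s => g s - g 0) (Icc 0 t) :=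
      (continuousOn_rlIntegral (sub_pos.2 hα1) (by linarith) fun t ht =>
        ContinuousOn.bddOn hcg ht).mono fun s hs => ⟨hs.1, hs.2.trans_lt ht.2⟩
    have := intervalIntegral.integral_eq_sub_of_hasDeriv_right_of_le ht.1 hH
      (fun s hs => (h.eqn s ⟨hs.1, hs.2.trans ht.2⟩).hasDerivWithinAt)
      ((hcF.mono (fun s hs => ⟨hs.1, hs.2.trans_lt ht.2⟩)).intervalIntegrable_of_Icc ht.1)
    rw [this, rlIntegral_zero_right, sub_zero]

end Picard

/-! ### Lifespan of the scalar problem: upper and lower bounds. -/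

section BlowUp

variable {α p B g₀ τ : ℝ}

/-- A nondecreasing solution blows up in finite time. -/
theorem rpow_le_of_monotone_solution (hα : 0 < α) (hα1 : α ≤ 1) (hp : 1 < p) (hB : 0 < B)
    (hg : 0 < g₀) {g : ℝ → ℝ} (hm : MonotoneOn g (Ico 0 τ)) (hc : ContinuousOn g (Ico 0 τ))
    (hge : ∀ t ∈ Ico 0 τ, g₀ ≤ g t)
    (heq : ∀ t ∈ Ico 0 τ, g t = g₀ + rlIntegral α (fun s => B * g s ^ p) t) {t : ℝ}
    (ht : t ∈ Ico 0 τ) :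
    t ^ α ≤ Real.Gamma (1 + α) / ((p - 1) * B * g₀ ^ (p - 1)) := by
  have hΓ := Real.Gamma_pos_of_pos hα
  have hp0 : 0 ≤ p := by linarith
  set F : ℝ → ℝ := fun s => B * g s ^ p with hF
  have hFm : MonotoneOn F (Ico 0 τ) :=
    MonotoneOn.mul_rpow hp0 hB.le hm fun t ht => hg.le.trans (hge t ht)
  have hF0 : ∀ s ∈ Ico 0 τ, 0 ≤ F s := fun s hs =>
    mul_nonneg hB.le (Real.rpow_nonneg (hg.le.trans (hge s hs)) _)
  have hFc : ContinuousOn F (Ico 0 τ) := ContinuousOn.mul_rpow hp0 hc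
  -- The rearranged kernel no longer depends on `t`, so this minorant of `g` is differentiable and
  -- satisfies `h' ≥ B s^(α-1) h^p / Γ(α)`.
  set h : ℝ → ℝ := fun t => g₀ + (Real.Gamma α)⁻¹ * ∫ s in (0 : ℝ)..t, s ^ (α - 1) * F s with hh
  have hle : ∀ s ∈ Ico 0 τ, h s ≤ g s := fun s hs => by
    rw [heq s hs]
    exact add_le_add le_rfl (integral_rpow_mul_le hα hα1 hFm hF0 hs)
  have hii : IntervalIntegrable (fun s => s ^ (α - 1) * F s) volume 0 t :=
    (MonotoneOn.bddOn hFm hF0 ht.2).rpow_mul hα ht.1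
  have hhc : ContinuousOn h (Icc 0 t) := by
    have := intervalIntegral.continuousOn_primitive_interval' hii left_mem_uIcc
    rw [uIcc_of_le ht.1] at this
    exact continuousOn_const.add (continuousOn_const.mul this)
  have hh0 : ∀ s ∈ Icc 0 t, g₀ ≤ h s := fun s hs => by
    refine le_add_of_nonneg_right (mul_nonneg (inv_pos.2 hΓ).le ?_)
    rw [intervalIntegral.integral_of_le hs.1]
    refine setIntegral_nonneg measurableSet_Ioc fun r hr => ?_
    exact mul_nonneg (Real.rpow_nonneg hr.1.le _)
      (hF0 r ⟨hr.1.le, (hr.2.trans hs.2).trans_lt ht.2⟩)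
  have hd : ∀ s ∈ Ioo 0 t, HasDerivAt h ((Real.Gamma α)⁻¹ * (s ^ (α - 1) * F s)) s := by
    intro s hs
    refine (HasDerivAt.const_mul _ ?_).const_add _
    have hco : ContinuousOn (fun s => s ^ (α - 1) * F s) (Ioo 0 τ) :=
      (continuousOn_id.rpow_const fun x hx => Or.inl hx.1.ne').mul
        (hFc.mono Ioo_subset_Ico_self)
    have hsτ : s ∈ Ioo 0 τ := ⟨hs.1, hs.2.trans ht.2⟩
    refine intervalIntegral.integral_hasDerivAt_right ?_
      (hco.stronglyMeasurableAtFilter isOpen_Ioo s hsτ) (hco.continuousAt (Ioo_mem_nhds hsτ.1 hsτ.2))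
    exact (MonotoneOn.bddOn hFm hF0 hsτ.2).rpow_mul hα hs.1.le
  -- Separation of variables: the inequality for `h'` says exactly that `ψ` is nondecreasing.
  -- Comparing the values at `0` and `t` and dropping `h(t)^(1-p) > 0` bounds `t^α`.
  set ψ : ℝ → ℝ := fun s => -(h s ^ (1 - p)) - (p - 1) * B * ((Real.Gamma α)⁻¹ * (s ^ α / α)) with hψ
  have hψd : ∀ s ∈ Ioo 0 t, HasDerivAt ψ (-((Real.Gamma α)⁻¹ * (s ^ (α - 1) * F s) * (1 - p) *
      h s ^ (1 - p - 1)) - (p - 1) * B * ((Real.Gamma α)⁻¹ * (α * s ^ (α - 1) / α))) s := by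
    intro s hs
    have hpos : 0 < h s := hg.trans_le (hh0 s (Ioo_subset_Icc_self hs))
    exact ((hd s hs).rpow_const (Or.inl hpos.ne')).neg.sub
      ((((Real.hasDerivAt_rpow_const (Or.inl hs.1.ne')).div_const α).const_mul _).const_mul _)
  have hψm : MonotoneOn ψ (Icc 0 t) := by
    refine monotoneOn_of_deriv_nonneg (convex_Icc 0 t) ?_ ?_ ?_
    · refine (hhc.rpow_const fun s hs => Or.inl (hg.trans_le (hh0 s hs)).ne').neg.sub ?_
      exact continuousOn_const.mul (continuousOn_const.mul
        ((continuousOn_id.rpow_const fun _ _ => Or.inr hα.le).div_const _))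
    · rw [interior_Icc]
      exact fun s hs => (hψd s hs).differentiableAt.differentiableWithinAt
    · rw [interior_Icc]
      intro s hs
      rw [(hψd s hs).deriv]
      have hpos : 0 < h s := hg.trans_le (hh0 s (Ioo_subset_Icc_self hs))
      have h1 : h s ^ p ≤ g s ^ p :=
        Real.rpow_le_rpow hpos.le (hle s ⟨hs.1.le, hs.2.trans ht.2⟩) hp0
      have h2 : h s ^ (1 - p - 1) * h s ^ p = 1 := by
        rw [← Real.rpow_add hpos]; simp
      have h3 : 0 < h s ^ (1 - p - 1) := Real.rpow_pos_of_pos hpos _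
      have h4 : 1 ≤ h s ^ (1 - p - 1) * g s ^ p :=
        h2.symm.le.trans (mul_le_mul_of_nonneg_left h1 h3.le)
      have h5 : 0 < s ^ (α - 1) := Real.rpow_pos_of_pos hs.1 _
      have e : -((Real.Gamma α)⁻¹ * (s ^ (α - 1) * F s) * (1 - p) *
        h s ^ (1 - p - 1)) - (p - 1) * B * ((Real.Gamma α)⁻¹ * (α * s ^ (α - 1) / α))
        = (p - 1) * B * (Real.Gamma α)⁻¹ * s ^ (α - 1) * (h s ^ (1 - p - 1) * g s ^ p - 1) := by
        rw [hF]; field_simp; ring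
      rw [e]
      have : 0 < p - 1 := by linarith
      exact mul_nonneg (by positivity) (by linarith)
  have hfin := hψm (left_mem_Icc.2 ht.1) (right_mem_Icc.2 ht.1) ht.1
  have hlast : 0 < h t ^ (1 - p) :=
    Real.rpow_pos_of_pos (hg.trans_le (hh0 t (right_mem_Icc.2 ht.1))) _
  simp only [hψ, hh, intervalIntegral.integral_same, mul_zero, add_zero, Real.zero_rpow hα.ne',
    zero_div, sub_zero] at hfin hlast
  have hgp : g₀ ^ (1 - p) * g₀ ^ (p - 1) = 1 := by
    rw [← Real.rpow_add hg]; simp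
  have hgpos : 0 < g₀ ^ (p - 1) := Real.rpow_pos_of_pos hg _
  have hp1 : 0 < p - 1 := by linarith
  rw [le_div_iff₀ (by positivity), add_comm 1 α, Real.Gamma_add_one hα.ne']
  have h6 : (p - 1) * B * ((Real.Gamma α)⁻¹ * (t ^ α / α)) ≤ g₀ ^ (1 - p) := by linarith
  have h7 := mul_le_mul_of_nonneg_right h6 hgpos.le
  rw [hgp] at h7
  calc t ^ α * ((p - 1) * B * g₀ ^ (p - 1))
      = ((p - 1) * B * ((Real.Gamma α)⁻¹ * (t ^ α / α)) * g₀ ^ (p - 1)) * (α * Real.Gamma α) := by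
        field_simp
    _ ≤ 1 * (α * Real.Gamma α) := by gcongr
    _ = _ := one_mul _

/-- The supersolution itself need not be monotone, but the solution constructed below it is, and it
lives on the same interval. -/
theorem IsSupersolution.le_time (hα : 0 < α) (hα1 : α ≤ 1) (hp : 1 < p) (hB : 0 < B)
    (hg : 0 < g₀) {w : ℝ → ℝ} (hw : IsSupersolution α p B g₀ τ w) :
    τ ≤ (Real.Gamma (1 + α) / ((p - 1) * B * g₀ ^ (p - 1))) ^ (1 / α) := by
  obtain ⟨g, hm, hc, hge, heq⟩ := hw.exists_solution hα hα1 (by linarith) hB.le hg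
  set X := Real.Gamma (1 + α) / ((p - 1) * B * g₀ ^ (p - 1)) with hX
  have hX0 : 0 < X := by
    have : 0 < p - 1 := by linarith
    have := Real.Gamma_pos_of_pos (show 0 < 1 + α by linarith)
    have : 0 < g₀ ^ (p - 1) := Real.rpow_pos_of_pos hg _
    positivity
  by_contra! hlt
  obtain ⟨t, ht1, ht2⟩ := exists_between hlt
  have h0 : 0 < X ^ (1 / α) := Real.rpow_pos_of_pos hX0 _
  have := rpow_le_of_monotone_solution hα hα1 hp hB hg hm hc hge heq ⟨h0.le.trans ht1.le, ht2⟩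
  have h2 := Real.rpow_lt_rpow h0.le ht1 hα
  rw [← Real.rpow_mul hX0.le, one_div_mul_cancel hα.ne', Real.rpow_one] at h2
  linarith

/-- A constant `m` is a supersolution as long as `g₀ + B m^p t^α / Γ(1+α) ≤ m`. -/
theorem isSupersolution_const (hα : 0 < α) (hB : 0 < B) {m Y : ℝ} (hm : 0 < m)
    (hY : 0 ≤ Y) (h : g₀ + B * m ^ p * (Y / Real.Gamma (1 + α)) ≤ m) :
    IsSupersolution α p B g₀ (Y ^ (1 / α)) fun _ => m := by
  refine ⟨continuousOn_const, fun _ _ => hm.le, fun t ht => ?_⟩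
  rw [rlIntegral_const hα]
  refine le_trans ?_ h
  have hΓ := Real.Gamma_pos_of_pos (show 0 < 1 + α by linarith)
  have h2 := Real.rpow_le_rpow ht.1 ht.2.le hα.le
  rw [← Real.rpow_mul hY, one_div_mul_cancel hα.ne', Real.rpow_one] at h2
  have : 0 < m ^ p := Real.rpow_pos_of_pos hm _
  gcongr

theorem gG_pos (hp : 1 < p) : 0 < gG p :=
  lt_min (Real.rpow_pos_of_pos two_pos _) (div_pos (Real.rpow_pos_of_pos (by linarith) _)
    (Real.rpow_pos_of_pos (by linarith) _))

/-- The constant `c g₀` with `c > 1` works up to the time given by the factor `c^p / (c - 1)` in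
place of `G(p)`. The choice `c = 2` gives `2^p`, and `c = p/(p-1)`, which minimises this factor,
gives the other entry of the minimum. -/
theorem exists_const_supersolution (hα : 0 < α) (hp : 1 < p) (hB : 0 < B) (hg : 0 < g₀) :
    ∃ m : ℝ, IsSupersolution α p B g₀
      ((Real.Gamma (1 + α) / (gG p * B * g₀ ^ (p - 1))) ^ (1 / α)) fun _ => m := by
  have hΓ := Real.Gamma_pos_of_pos (show 0 < 1 + α by linarith)
  have hG := gG_pos hp
  have hgp : 0 < g₀ ^ (p - 1) := Real.rpow_pos_of_pos hg _
  have hsplit : g₀ ^ p = g₀ ^ (p - 1) * g₀ := by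
    rw [← Real.rpow_add_one hg.ne']; simp
  have hp1 : 0 < p - 1 := by linarith
  have key : ∀ c : ℝ, 0 < c → gG p * (c - 1) = c ^ p → IsSupersolution α p B g₀
      ((Real.Gamma (1 + α) / (gG p * B * g₀ ^ (p - 1))) ^ (1 / α)) fun _ => c * g₀ := by
    intro c hc hcG
    refine isSupersolution_const hα hB (mul_pos hc hg) (by positivity) (le_of_eq ?_)
    rw [Real.mul_rpow hc.le hg.le, ← hcG, hsplit]
    field_simp
    ring
  rcases min_cases ((2 : ℝ) ^ p) (p ^ p / (p - 1) ^ (p - 1)) with h | h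
  · exact ⟨_, key 2 two_pos (by rw [gG, h.1]; ring)⟩
  · refine ⟨_, key (p / (p - 1)) (by positivity) ?_⟩
    rw [gG, h.1, Real.div_rpow (by linarith) hp1.le]
    have : (p - 1) ^ p = (p - 1) ^ (p - 1) * (p - 1) := by
      rw [← Real.rpow_add_one hp1.ne']; simp
    rw [this]
    have : 0 < (p - 1) ^ (p - 1) := Real.rpow_pos_of_pos hp1 _
    field_simp
    ring

/-- Existence and bounds of the blow-up time, which no supersolution survives. -/
theorem exists_blowupTime (hα : 0 < α) (hα1 : α < 1) (hp : 1 < p) (hB : 0 < B) (hg : 0 < g₀) :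
    ∃ Tb : ℝ, IsBlowupTime α p B g₀ Tb ∧
      (Real.Gamma (1 + α) / (gG p * B * g₀ ^ (p - 1))) ^ (1 / α) ≤ Tb ∧
      Tb ≤ (Real.Gamma (1 + α) / ((p - 1) * B * g₀ ^ (p - 1))) ^ (1 / α) ∧
      ∀ T w, Tb < T → ¬ IsSupersolution α p B g₀ T w := by
  have hp0 : 0 ≤ p := by linarith
  -- Every supersolution puts its interval of existence into the set whose supremum is `T_b`. This
  -- gives the lower bound and rules out supersolutions beyond `T_b`.
  have hmem : ∀ T w, 0 < T → IsSupersolution α p B g₀ T w →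
      ∃ g : ℝ → ℝ, IsFODESolution α p B g₀ T g := fun T w hT hw => by
    obtain ⟨g, hm, hc, hge, heq⟩ := hw.exists_solution hα hα1.le hp0 hB.le hg
    exact ⟨g, isFODESolution_of_eq hα hα1 hp0 hg hT hc hge heq⟩
  set S := {τ : ℝ | 0 < τ ∧ ∃ g : ℝ → ℝ, IsFODESolution α p B g₀ τ g} with hS
  have hub : ∀ τ ∈ S, τ ≤ (Real.Gamma (1 + α) / ((p - 1) * B * g₀ ^ (p - 1))) ^ (1 / α) := by
    rintro τ ⟨_, g, hgs⟩
    exact (hgs.isSupersolution hα hα1 hp0).le_time hα hα1.le hp hB hg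
  have hpos : 0 < (Real.Gamma (1 + α) / (gG p * B * g₀ ^ (p - 1))) ^ (1 / α) := by
    have := Real.Gamma_pos_of_pos (show 0 < 1 + α by linarith)
    have := gG_pos hp
    have : 0 < g₀ ^ (p - 1) := Real.rpow_pos_of_pos hg _
    positivity
  have hlow : (Real.Gamma (1 + α) / (gG p * B * g₀ ^ (p - 1))) ^ (1 / α) ∈ S := by
    obtain ⟨m, hm⟩ := exists_const_supersolution hα hp hB hg
    exact ⟨hpos, hmem _ _ hpos hm⟩
  have hlub := isLUB_csSup ⟨_, hlow⟩ ⟨_, hub⟩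
  refine ⟨sSup S, hlub, hlub.1 hlow, hlub.2 hub, fun T w hT hw => ?_⟩
  have hT0 : 0 < T := hpos.trans_le ((hlub.1 hlow).trans hT.le)
  exact absurd (hlub.1 ⟨hT0, hmem T w hT0 hw⟩) (not_le.2 hT)

end BlowUp

/-- A continuous function with `M ≥ M(0) + I^α (B (|M|^p - c^p))` and `M(0) > c ≥ 0` gives the
supersolution `M - c`. -/
theorem isSupersolution_sub_const {α p B c T : ℝ} (hα : 0 < α) (hp : 1 < p) (hB : 0 < B)
    (hc : 0 ≤ c) {M : ℝ → ℝ} (hM : ContinuousOn M (Ico 0 T)) (h0 : c < M 0)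
    (hle : ∀ t ∈ Ico 0 T, M 0 + rlIntegral α (fun s => B * (|M s| ^ p - c ^ p)) t ≤ M t) :
    IsSupersolution α p B (M 0 - c) T fun t => M t - c := by
  have hp0 : 0 ≤ p := by linarith
  -- Continuity argument: up to the first time `t` with `M t ≤ c` the integrand is nonnegative,
  -- hence `M t ≥ M 0 > c`, a contradiction.
  have hgt : ∀ t ∈ Ico 0 T, c < M t := by
    by_contra! hcon
    obtain ⟨t₁, ht₁, hMt⟩ := hcon
    have hcont : ContinuousOn M (Icc 0 t₁) := hM.mono fun s hs => ⟨hs.1, hs.2.trans_lt ht₁.2⟩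
    set S := Icc 0 t₁ ∩ M ⁻¹' Iic c with hS
    have hSc : IsClosed S := hcont.preimage_isClosed_of_isClosed isClosed_Icc isClosed_Iic
    have hne : S.Nonempty := ⟨t₁, right_mem_Icc.2 ht₁.1, hMt⟩
    have hbd : BddBelow S := ⟨0, fun s hs => hs.1.1⟩
    have hmem := hSc.csInf_mem hne hbd
    set t := sInf S with ht
    have htT : t ∈ Ico 0 T := ⟨hmem.1.1, hmem.1.2.trans_lt ht₁.2⟩
    have hcap : ∀ s ∈ Ioc 0 t, 0 ≤ B * (|M s| ^ p - c ^ p) := by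
      intro s hs
      have hcs : c ≤ M s := by
        rcases hs.2.lt_or_eq with h | h
        · by_contra! hlt
          exact absurd (csInf_le hbd (⟨⟨hs.1.le, h.le.trans hmem.1.2⟩, hlt.le⟩ : s ∈ S))
            (not_le.2 h)
        -- At the first time itself the inequality `c ≤ M t` is the limit from the left.
        · have ht0 : 0 < t := h ▸ hs.1
          have : (𝓝[Ioo 0 t] t).NeBot := right_nhdsWithin_Ioo_neBot ht0
          rw [h]
          refine ge_of_tendsto ((hM t htT).mono_left (nhdsWithin_mono _
            (show Ioo 0 t ⊆ Ico 0 T from fun r hr => ⟨hr.1.le, hr.2.trans htT.2⟩))) ?_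
          filter_upwards [self_mem_nhdsWithin] with r hr
          by_contra! hlt
          exact absurd (csInf_le hbd (⟨⟨hr.1.le, hr.2.le.trans hmem.1.2⟩, hlt.le⟩ : r ∈ S))
            (not_le.2 hr.2)
      exact mul_nonneg hB.le (sub_nonneg.2 (Real.rpow_le_rpow hc (hcs.trans (le_abs_self _)) hp0))
    have := rlIntegral_nonneg hα htT.1 hcap
    have h2 := hle t htT
    have h3 : M t ≤ c := hmem.2
    linarith
  refine ⟨hM.sub continuousOn_const, fun t ht => (sub_pos.2 (hgt t ht)).le, fun t ht => ?_⟩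
  have hc1 : ContinuousOn (fun s => B * (M s - c) ^ p) (Ico 0 T) :=
    ContinuousOn.mul_rpow hp0 (hM.sub continuousOn_const)
  have hc2 : ContinuousOn (fun s => B * (|M s| ^ p - c ^ p)) (Ico 0 T) :=
    continuousOn_const.mul ((hM.abs.rpow_const fun _ _ => Or.inr hp0).sub continuousOn_const)
  obtain ⟨K₁, hK₁⟩ := ContinuousOn.bddOn hc1 ht.2
  obtain ⟨K₂, hK₂⟩ := ContinuousOn.bddOn hc2 ht.2
  have hcmp : rlIntegral α (fun s => B * (M s - c) ^ p) t
      ≤ rlIntegral α (fun s => B * (|M s| ^ p - c ^ p)) t := by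
    refine rlIntegral_mono_ae hα ht.1 hK₁ hK₂ ?_
    filter_upwards [ae_restrict_mem measurableSet_Ioc] with s hs
    have hs' := hgt s ⟨hs.1.le, hs.2.trans_lt ht.2⟩
    -- Superadditivity, `c^p + (M - c)^p ≤ M^p`, is what makes the shift by `c` harmless.
    have h1 := Real.add_rpow_le_rpow_add hc (sub_pos.2 hs').le hp.le
    rw [add_sub_cancel] at h1
    rw [abs_of_pos (hc.trans_lt hs')]
    exact mul_le_mul_of_nonneg_left (by linarith) hB.le
  have := hle t ht
  linarith

/-! ### The weight `φ` -/

section Phi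

variable {N : ℕ} {β : ℝ}

theorem one_add_norm_sq_pos (x : Sp N) : 0 < 1 + ‖x‖ ^ 2 := by positivity

theorem phi_pos (x : Sp N) : 0 < phi N β x := Real.rpow_pos_of_pos (one_add_norm_sq_pos x) _

theorem phi_le_one (hβ : 0 < β) (x : Sp N) : phi N β x ≤ 1 :=
  Real.rpow_le_one_of_one_le_of_nonpos (by nlinarith [sq_nonneg ‖x‖])
    (by have : (0 : ℝ) ≤ N := N.cast_nonneg
        linarith)

theorem contDiff_phi : ContDiff ℝ ∞ (phi N β) :=
  (contDiff_const.add (contDiff_norm_sq ℝ)).rpow_const_of_ne fun x => (one_add_norm_sq_pos x).ne'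

theorem continuous_phi : Continuous (phi N β) := contDiff_phi.continuous

theorem phi_neg (x : Sp N) : phi N β (-x) = phi N β x := by simp [phi]

theorem integrable_phi (hβ : 0 < β) : Integrable (phi N β) := by
  have := integrable_rpow_neg_one_add_norm_sq (E := Sp N) (μ := volume) (r := N + β)
    (by simpa using hβ)
  exact this

theorem memLp_phi_two (hβ : 0 < β) : MemLp (phi N β) 2 := by
  rw [memLp_two_iff_integrable_sq continuous_phi.aestronglyMeasurable]
  refine (integrable_phi hβ).mono' (continuous_phi.pow 2).aestronglyMeasurable
    (Eventually.of_forall fun x => ?_)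
  have h1 := phi_le_one hβ x
  have h0 := phi_pos (β := β) x
  rw [Real.norm_eq_abs, abs_of_nonneg (sq_nonneg _)]
  nlinarith

theorem A0_pos (hβ : 0 < β) : 0 < A0 N β := by
  refine (integral_pos_iff_support_of_nonneg (fun x => (phi_pos x).le) (integrable_phi hβ)).2 ?_
  have : Function.support (phi N β) = univ := by
    ext x; simp [(phi_pos x).ne']
  rw [this]
  exact isOpen_univ.measure_pos _ univ_nonempty

theorem phi_le_of_le {c : ℝ} (hβ : 0 < β) (hc : 0 < c) {x y : Sp N}
    (h : 1 + ‖x‖ ^ 2 ≤ c * (1 + ‖y‖ ^ 2)) :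
    phi N β y ≤ c ^ (((N : ℝ) + β) / 2) * phi N β x := by
  have hN : (0 : ℝ) ≤ N := N.cast_nonneg
  have h1 := Real.rpow_le_rpow_of_nonpos (one_add_norm_sq_pos x) h
    (show -((N : ℝ) + β) / 2 ≤ 0 by linarith)
  rw [Real.mul_rpow hc.le (one_add_norm_sq_pos y).le, neg_div, Real.rpow_neg hc.le] at h1
  have hcp := Real.rpow_pos_of_pos hc (((N : ℝ) + β) / 2)
  rw [inv_mul_le_iff₀ hcp] at h1
  rw [phi, phi, neg_div]
  exact h1

/-- The longer of `a` and `b` has at least half the length of `a + b`, so the smaller of the two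
values of `φ` is controlled by `φ(a + b)`. This factors `φ(x)` out of the nonlocal part of the
fractional Laplacian. -/
theorem phi_mul_phi_le (hβ : 0 < β) (a b : Sp N) :
    phi N β a * phi N β b
      ≤ (4 : ℝ) ^ (((N : ℝ) + β) / 2) * phi N β (a + b) * (phi N β a + phi N β b) := by
  have h3 : ‖a + b‖ ≤ ‖a‖ + ‖b‖ := norm_add_le a b
  have ha := phi_pos (β := β) a
  have hb := phi_pos (β := β) b
  have hc : (0 : ℝ) < (4 : ℝ) ^ (((N : ℝ) + β) / 2) := by positivity
  have hab := phi_pos (β := β) (a + b)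
  have n1 := norm_nonneg a
  have n2 := norm_nonneg b
  have n3 := norm_nonneg (a + b)
  rcases le_total ‖a‖ ‖b‖ with h | h
  · have := phi_le_of_le hβ (c := 4) (by norm_num) (x := a + b) (y := b) (by nlinarith)
    nlinarith [mul_pos (mul_pos hc hab) hb]
  · have := phi_le_of_le hβ (c := 4) (by norm_num) (x := a + b) (y := a) (by nlinarith)
    nlinarith [mul_pos (mul_pos hc hab) ha]

/-- The decay of `φ` matches that of the kernel of `(-Δ)^(β/2)`, so away from the origin the kernel
is bounded by a multiple of `φ`. -/
theorem norm_rpow_neg_le (hβ : 0 < β) {r : ℝ} (hr : 0 < r) {z : Sp N} (hz : r < ‖z‖) :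
    ‖z‖ ^ (-((N : ℝ) + β)) ≤ (1 + (r ^ 2)⁻¹) ^ (((N : ℝ) + β) / 2) * phi N β z := by
  have hz0 : 0 < ‖z‖ := hr.trans hz
  have hN : (0 : ℝ) ≤ N := N.cast_nonneg
  have e : ‖z‖ ^ (-((N : ℝ) + β)) = (‖z‖ ^ 2) ^ (-((N : ℝ) + β) / 2) := by
    rw [← Real.rpow_natCast, ← Real.rpow_mul hz0.le]
    congr 1; push_cast; ring
  have hc : 0 < 1 + (r ^ 2)⁻¹ := by positivity
  have hle : 1 + ‖z‖ ^ 2 ≤ (1 + (r ^ 2)⁻¹) * ‖z‖ ^ 2 := by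
    have : 1 ≤ (r ^ 2)⁻¹ * ‖z‖ ^ 2 := by
      rw [inv_mul_eq_div, one_le_div (by positivity)]
      gcongr
    linarith
  have h1 := Real.rpow_le_rpow_of_nonpos (one_add_norm_sq_pos z) hle
    (show -((N : ℝ) + β) / 2 ≤ 0 by linarith)
  rw [Real.mul_rpow hc.le (by positivity), neg_div, Real.rpow_neg hc.le,
    inv_mul_le_iff₀ (Real.rpow_pos_of_pos hc _)] at h1
  rw [e, phi, neg_div]
  exact h1

end Phi

/-! ### Powers of the norm on balls -/

theorem nontrivial_Sp {N : ℕ} (hN : 1 ≤ N) : Nontrivial (Sp N) := by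
  have : Nonempty (Fin N) := ⟨⟨0, hN⟩⟩
  infer_instance

theorem radial_aux {N : ℕ} (hN : 1 ≤ N) {a R : ℝ} :
    EqOn (fun y : ℝ => y ^ (Module.finrank ℝ (Sp N) - 1) • (Iic R).indicator (fun r => r ^ a) y)
      ((Iic R).indicator fun r => r ^ ((N : ℝ) + a - 1)) (Ioi 0) := by
  intro y hy
  by_cases h : y ∈ Iic R
  · simp only [indicator_of_mem h, smul_eq_mul, finrank_euclideanSpace_fin]
    rw [← Real.rpow_natCast, ← Real.rpow_add hy]
    congr 1
    push_cast [hN]; ring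
  · simp [indicator_of_notMem h]

theorem closedBall_indicator_eq {N : ℕ} (a R : ℝ) :
    (Metric.closedBall (0 : Sp N) R).indicator (fun x => ‖x‖ ^ a)
      = fun x => (Iic R).indicator (fun r => r ^ a) ‖x‖ := by
  ext x
  simp [indicator]

theorem integrableOn_norm_rpow {N : ℕ} (hN : 1 ≤ N) {a R : ℝ} (ha : 0 < N + a) (hR : 0 ≤ R) :
    IntegrableOn (fun x : Sp N => ‖x‖ ^ a) (Metric.closedBall 0 R) := by
  have := nontrivial_Sp hN
  rw [← integrable_indicator_iff Metric.isClosed_closedBall.measurableSet,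
    closedBall_indicator_eq, integrable_fun_norm_addHaar,
    integrableOn_congr_fun (radial_aux hN) measurableSet_Ioi, IntegrableOn,
    integrable_indicator_iff measurableSet_Iic, IntegrableOn, Measure.restrict_restrict
      measurableSet_Iic, inter_comm, Ioi_inter_Iic, ← IntegrableOn,
    ← intervalIntegrable_iff_integrableOn_Ioc_of_le hR]
  exact intervalIntegral.intervalIntegrable_rpow' (by linarith)

theorem integral_norm_rpow {N : ℕ} (hN : 1 ≤ N) {a R : ℝ} (ha : 0 < N + a) (hR : 0 ≤ R) :
    ∫ x in Metric.closedBall (0 : Sp N) R, ‖x‖ ^ a = omega N * (R ^ (N + a) / (N + a)) := by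
  have := nontrivial_Sp hN
  rw [← integral_indicator Metric.isClosed_closedBall.measurableSet,
    closedBall_indicator_eq, integral_fun_norm_addHaar,
    setIntegral_congr_fun measurableSet_Ioi (radial_aux hN), 
    setIntegral_indicator measurableSet_Iic, Ioi_inter_Iic, ← intervalIntegral.integral_of_le hR,
    integral_rpow (Or.inl (by linarith)), omega]
  simp [Real.zero_rpow ha.ne', Measure.real]
  ring

/-! ### The fractional Laplacian of functions that decay like `φ` -/

/-- `v` and its second differences of step at most `1` are bounded by multiples of `φ`. -/
structure IsPhiBounded {N : ℕ} (β A : ℝ) (v : Sp N → ℝ) : Prop where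
  cont : Continuous v
  bound : ∀ x, |v x| ≤ A * phi N β x
  diff : ∀ x y, ‖y‖ ≤ 1 → |v (x + y) + v (x - y) - 2 * v x| ≤ A * ‖y‖ ^ 2 * phi N β x

/-- The absolutely convergent form of the singular integral. -/
def symmLap {N : ℕ} (β : ℝ) (v : Sp N → ℝ) (x : Sp N) : ℝ :=
  2⁻¹ * ∫ z, (2 * v x - v (x + z) - v (x - z)) / ‖z‖ ^ ((N : ℝ) + β)

/-- A majorant of the second difference quotients. -/
def majorant {N : ℕ} (β : ℝ) (x z : Sp N) : ℝ :=
  (Metric.closedBall (0 : Sp N) 1).indicator (fun z => ‖z‖ ^ (2 - ((N : ℝ) + β))) z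
    + (2 : ℝ) ^ (((N : ℝ) + β) / 2) * (2 * phi N β z
      + (4 : ℝ) ^ (((N : ℝ) + β) / 2) * (phi N β (x + z) + phi N β (x - z) + 2 * phi N β z))

/-- The integral of `majorant`. -/
def majorantMass (N : ℕ) (β : ℝ) : ℝ :=
  (∫ z in Metric.closedBall (0 : Sp N) 1, ‖z‖ ^ (2 - ((N : ℝ) + β)))
    + (2 : ℝ) ^ (((N : ℝ) + β) / 2) * (2 * A0 N β
      + (4 : ℝ) ^ (((N : ℝ) + β) / 2) * (A0 N β + A0 N β + 2 * A0 N β))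

section FracLap

variable {N : ℕ} {β A : ℝ}

/-- By translation invariance the integral does not depend on `x`. The power of the norm is
integrable near `0` because `β < 2`. -/
theorem majorant_integral (hN : 1 ≤ N) (hβ : 0 < β) (hβ2 : β < 2) (x : Sp N) :
    Integrable (majorant β x) ∧ ∫ z, majorant β x z = majorantMass N β := by
  have i1 : Integrable ((Metric.closedBall (0 : Sp N) 1).indicator
      (fun z => ‖z‖ ^ (2 - ((N : ℝ) + β)))) :=
    (integrable_indicator_iff Metric.isClosed_closedBall.measurableSet).2
      (integrableOn_norm_rpow hN (by linarith) zero_le_one)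
  have i2 := integrable_phi (N := N) hβ
  have i3 : Integrable fun z => phi N β (x + z) := i2.comp_add_left x
  have i4 : Integrable fun z => phi N β (x - z) := i2.comp_sub_left x
  have e3 : ∫ z, phi N β (x + z) = A0 N β := integral_add_left_eq_self _ x
  have e4 : ∫ z, phi N β (x - z) = A0 N β := integral_sub_left_eq_self _ _ x
  have i5 := (((i3.add i4).add (i2.const_mul 2)).const_mul ((4 : ℝ) ^ (((N : ℝ) + β) / 2)))
  have i6 := ((i2.const_mul 2).add i5).const_mul ((2 : ℝ) ^ (((N : ℝ) + β) / 2))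
  refine ⟨i1.add i6, ?_⟩
  refine (integral_add i1 i6).trans ?_
  rw [majorantMass, integral_indicator Metric.isClosed_closedBall.measurableSet]
  congr 1
  rw [integral_const_mul]
  congr 1
  refine (integral_add (i2.const_mul 2) i5).trans ?_
  rw [integral_const_mul, integral_const_mul]
  congr 2
  refine (integral_add (i3.add i4) (i2.const_mul 2)).trans ?_
  rw [integral_const_mul]
  congr 1
  exact (integral_add i3 i4).trans (by rw [e3, e4])

theorem IsPhiBounded.nonneg {v : Sp N → ℝ} (hv : IsPhiBounded β A v) : 0 ≤ A := by
  have := (abs_nonneg _).trans (hv.bound 0)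
  exact nonneg_of_mul_nonneg_left this (phi_pos _)

/-- For `|z| ≤ 1` the second difference supplies `|z|^2 φ(x)`. For `|z| > 1` the kernel is bounded
by a multiple of `φ(z)`, and the products `φ(x ± z) φ(z)` are bounded by `φ(x)` times integrable
functions of `z`. Thus `φ(x)` factors out in both regimes. -/
theorem IsPhiBounded.abs_quotient_le (hβ : 0 < β) {v : Sp N → ℝ}
    (hv : IsPhiBounded β A v) (x z : Sp N) :
    |(2 * v x - v (x + z) - v (x - z)) / ‖z‖ ^ ((N : ℝ) + β)|
      ≤ A * phi N β x * majorant β x z := by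
  have hA := hv.nonneg
  have hx := phi_pos (β := β) x
  have hz := phi_pos (β := β) z
  have hxz := phi_pos (β := β) (x + z)
  have hxz' := phi_pos (β := β) (x - z)
  have c2 : (0 : ℝ) < (2 : ℝ) ^ (((N : ℝ) + β) / 2) := by positivity
  have c4 : (0 : ℝ) < (4 : ℝ) ^ (((N : ℝ) + β) / 2) := by positivity
  rcases eq_or_ne z 0 with rfl | hz0
  · have : 2 * v x - v (x + 0) - v (x - 0) = 0 := by simp; ring
    rw [this, zero_div, abs_zero]
    refine mul_nonneg (mul_nonneg hA hx.le) (add_nonneg ?_ (by positivity))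
    exact indicator_nonneg (fun _ _ => Real.rpow_nonneg (norm_nonneg _) _) _
  have hzn : 0 < ‖z‖ := norm_pos_iff.2 hz0
  have hpow : 0 < ‖z‖ ^ ((N : ℝ) + β) := Real.rpow_pos_of_pos hzn _
  rw [abs_div, abs_of_pos hpow]
  by_cases h : ‖z‖ ≤ 1
  · have h1 := hv.diff x z h
    have h2 : |2 * v x - v (x + z) - v (x - z)| = |v (x + z) + v (x - z) - 2 * v x| := by
      rw [← abs_neg]; congr 1; ring
    rw [h2, majorant, indicator_of_mem (by simpa using h)]
    calc _ ≤ A * ‖z‖ ^ 2 * phi N β x / ‖z‖ ^ ((N : ℝ) + β) := by gcongr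
      _ = A * phi N β x * ‖z‖ ^ (2 - ((N : ℝ) + β)) := by
        rw [Real.rpow_sub hzn]
        norm_cast
        ring
      _ ≤ _ := by
        refine mul_le_mul_of_nonneg_left (le_add_of_nonneg_right (by positivity)) (by positivity)
  · rw [majorant, indicator_of_notMem (by simpa using h), zero_add]
    have hk := norm_rpow_neg_le hβ one_pos (not_le.1 h)
    norm_num at hk
    rw [← neg_add_rev, Real.rpow_neg hzn.le] at hk
    have b1 : |2 * v x - v (x + z) - v (x - z)|
        ≤ A * (2 * phi N β x + phi N β (x + z) + phi N β (x - z)) := by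
      have h0 := hv.bound x
      have h1 := hv.bound (x + z)
      have h2 := hv.bound (x - z)
      rw [abs_le] at *
      constructor <;> linarith [h0.1, h0.2, h1.1, h1.2, h2.1, h2.2]
    have p1 := phi_mul_phi_le hβ (x + z) (-z)
    have p2 := phi_mul_phi_le hβ (x - z) z
    rw [phi_neg, add_neg_cancel_right] at p1
    rw [sub_add_cancel] at p2
    rw [div_eq_mul_inv]
    calc _ ≤ A * (2 * phi N β x + phi N β (x + z) + phi N β (x - z)) *
          ((2 : ℝ) ^ (((N : ℝ) + β) / 2) * phi N β z) := by gcongr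
      _ = A * (2 : ℝ) ^ (((N : ℝ) + β) / 2) * (2 * (phi N β x * phi N β z)
          + phi N β (x + z) * phi N β z + phi N β (x - z) * phi N β z) := by ring
      _ ≤ A * (2 : ℝ) ^ (((N : ℝ) + β) / 2) * (2 * (phi N β x * phi N β z)
          + (4 : ℝ) ^ (((N : ℝ) + β) / 2) * phi N β x * (phi N β (x + z) + phi N β z)
          + (4 : ℝ) ^ (((N : ℝ) + β) / 2) * phi N β x * (phi N β (x - z) + phi N β z)) := by
        gcongr
      _ = _ := by ring

theorem measurable_quotient {v : Sp N → ℝ} (hv : Continuous v) :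
    Measurable fun q : Sp N × Sp N =>
      (2 * v q.1 - v (q.1 + q.2) - v (q.1 - q.2)) / ‖q.2‖ ^ ((N : ℝ) + β) := by
  refine Measurable.div (Continuous.measurable (by fun_prop)) ?_
  exact measurable_snd.norm.pow_const _

theorem IsPhiBounded.integrable_quotient (hN : 1 ≤ N) (hβ : 0 < β) (hβ2 : β < 2) {v : Sp N → ℝ}
    (hv : IsPhiBounded β A v) (x : Sp N) :
    Integrable fun z => (2 * v x - v (x + z) - v (x - z)) / ‖z‖ ^ ((N : ℝ) + β) := by
  refine ((majorant_integral hN hβ hβ2 x).1.const_mul (A * phi N β x)).mono'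
    ((measurable_quotient hv.cont).comp measurable_prodMk_left).aestronglyMeasurable
    (Eventually.of_forall fun z => hv.abs_quotient_le hβ x z)

theorem IsPhiBounded.abs_symmLap_le (hN : 1 ≤ N) (hβ : 0 < β) (hβ2 : β < 2) {v : Sp N → ℝ}
    (hv : IsPhiBounded β A v) (x : Sp N) :
    |symmLap β v x| ≤ 2⁻¹ * majorantMass N β * A * phi N β x := by
  rw [symmLap, abs_mul, abs_of_pos (by norm_num : (0 : ℝ) < 2⁻¹), mul_assoc, mul_assoc]
  refine mul_le_mul_of_nonneg_left ?_ (by norm_num)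
  obtain ⟨h1, h2⟩ := majorant_integral hN hβ hβ2 x
  rw [← Real.norm_eq_abs]
  refine (norm_integral_le_of_norm_le (h1.const_mul (A * phi N β x))
    (Eventually.of_forall fun z => hv.abs_quotient_le hβ x z)).trans_eq ?_
  rw [integral_const_mul, h2]
  ring

/-- The truncated integrals with `v(x - z)` and `v(x + z)` agree under `z ↦ -z`, and each converges
absolutely off the origin; their average contains the second difference. -/
theorem IsPhiBounded.truncated_eq (hβ : 0 < β) {v : Sp N → ℝ}
    (hv : IsPhiBounded β A v) (x : Sp N) {r : ℝ} (hr : 0 < r) :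
    ∫ y in {y : Sp N | r < ‖x - y‖}, (v x - v y) / ‖x - y‖ ^ ((N : ℝ) + β)
      = 2⁻¹ * ∫ z in {z : Sp N | r < ‖z‖},
        (2 * v x - v (x + z) - v (x - z)) / ‖z‖ ^ ((N : ℝ) + β) := by
  have hS : MeasurableSet {z : Sp N | r < ‖z‖} := measurableSet_lt measurable_const measurable_norm
  have hSx : MeasurableSet {y : Sp N | r < ‖x - y‖} :=
    measurableSet_lt measurable_const (by fun_prop)
  have e1 : ∫ y in {y : Sp N | r < ‖x - y‖}, (v x - v y) / ‖x - y‖ ^ ((N : ℝ) + β)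
      = ∫ z in {z : Sp N | r < ‖z‖}, (v x - v (x - z)) / ‖z‖ ^ ((N : ℝ) + β) := by
    rw [← integral_indicator hS, ← integral_indicator hSx, ← integral_sub_left_eq_self _ _ x]
    congr 1
    ext z
    by_cases h : r < ‖z‖ <;> simp [indicator, h]
  have e2 : ∫ z in {z : Sp N | r < ‖z‖}, (v x - v (x - z)) / ‖z‖ ^ ((N : ℝ) + β)
      = ∫ z in {z : Sp N | r < ‖z‖}, (v x - v (x + z)) / ‖z‖ ^ ((N : ℝ) + β) := by
    rw [← integral_indicator hS, ← integral_indicator hS, ← integral_neg_eq_self]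
    congr 1
    ext z
    by_cases h : r < ‖z‖ <;> simp [indicator, h]
  have ii : ∀ L : Sp N → Sp N, Continuous L → IntegrableOn
      (fun z => (v x - v (L z)) / ‖z‖ ^ ((N : ℝ) + β)) {z : Sp N | r < ‖z‖} := by
    intro L hL
    refine Integrable.mono' (((integrable_phi (N := N) hβ).const_mul
      (2 * A * (1 + (r ^ 2)⁻¹) ^ (((N : ℝ) + β) / 2))).integrableOn) ?_ ?_
    · refine (Measurable.div ?_ (measurable_norm.pow_const _)).aestronglyMeasurable
      exact (continuous_const.sub (hv.cont.comp hL)).measurable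
    · filter_upwards [ae_restrict_mem hS] with z hz
      have hz0 : 0 < ‖z‖ := hr.trans hz
      have hk := norm_rpow_neg_le hβ hr hz
      rw [Real.rpow_neg hz0.le] at hk
      have hA := hv.nonneg
      have h2 : |v x - v (L z)| ≤ 2 * A := by
        have b : ∀ y, |v y| ≤ A := fun y =>
          (hv.bound y).trans (mul_le_of_le_one_right hA (phi_le_one hβ y))
        have h0 := b x
        have h1 := b (L z)
        rw [abs_le] at *
        constructor <;> linarith [h0.1, h0.2, h1.1, h1.2]
      rw [Real.norm_eq_abs, abs_div, abs_of_pos (Real.rpow_pos_of_pos hz0 _), div_eq_mul_inv,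
        mul_assoc (2 * A)]
      exact mul_le_mul h2 hk (inv_nonneg.2 (Real.rpow_nonneg hz0.le _)) (by positivity)
  have e3 : ∫ z in {z : Sp N | r < ‖z‖},
      (2 * v x - v (x + z) - v (x - z)) / ‖z‖ ^ ((N : ℝ) + β)
      = (∫ z in {z : Sp N | r < ‖z‖}, (v x - v (x - z)) / ‖z‖ ^ ((N : ℝ) + β))
        + ∫ z in {z : Sp N | r < ‖z‖}, (v x - v (x + z)) / ‖z‖ ^ ((N : ℝ) + β) := by
    rw [← integral_add (ii _ (by fun_prop)) (ii _ (by fun_prop))]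
    congr 1
    ext z
    ring
  rw [e3, ← e2, e1]
  ring

theorem IsPhiBounded.tendsto_truncated (hN : 1 ≤ N) (hβ : 0 < β) (hβ2 : β < 2) {v : Sp N → ℝ}
    (hv : IsPhiBounded β A v) (x : Sp N) :
    Tendsto (fun r => ∫ y in {y : Sp N | r < ‖x - y‖}, (v x - v y) / ‖x - y‖ ^ ((N : ℝ) + β))
      (𝓝[>] (0 : ℝ)) (𝓝 (symmLap β v x)) := by
  have h1 : Tendsto (fun r => 2⁻¹ * ∫ z in {z : Sp N | r < ‖z‖},
      (2 * v x - v (x + z) - v (x - z)) / ‖z‖ ^ ((N : ℝ) + β)) (𝓝[>] (0 : ℝ))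
      (𝓝 (symmLap β v x)) := by
    refine Tendsto.const_mul _ ?_
    have hi := hv.integrable_quotient hN hβ hβ2 x
    have hS : ∀ r : ℝ, MeasurableSet {z : Sp N | r < ‖z‖} := fun r =>
      measurableSet_lt measurable_const measurable_norm
    simp only [← integral_indicator (hS _)]
    refine tendsto_integral_filter_of_dominated_convergence _
      (Eventually.of_forall fun r => (hi.indicator (hS r)).aestronglyMeasurable)
      (Eventually.of_forall fun r => Eventually.of_forall fun z => norm_indicator_le_norm_self _ _)
      hi.norm (Eventually.of_forall fun z => ?_)
    rcases eq_or_ne z 0 with rfl | hz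
    · have : 2 * v x - v (x + 0) - v (x - 0) = 0 := by simp; ring
      refine tendsto_const_nhds.congr fun r => ?_
      by_cases h : (0 : Sp N) ∈ {z : Sp N | r < ‖z‖}
      · rw [indicator_of_mem h]
      · rw [indicator_of_notMem h, this, zero_div]
    · refine tendsto_const_nhds.congr' ?_
      filter_upwards [mem_nhdsWithin_of_mem_nhds (Iio_mem_nhds (norm_pos_iff.2 hz))] with r hr
      rw [indicator_of_mem]
      exact hr
  refine h1.congr' ?_
  filter_upwards [self_mem_nhdsWithin] with r hr using (hv.truncated_eq hβ x hr).symm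

/-- The constant in front of the singular integral. -/
def fracConst (N : ℕ) (β : ℝ) : ℝ :=
  (4 : ℝ) ^ (β / 2) * Real.Gamma ((N : ℝ) / 2 + β / 2)
      / (Real.pi ^ ((N : ℝ) / 2) * |Real.Gamma (-(β / 2))|)

/-- The `limUnder` in the definition is meaningful only once convergence has been proved. -/
theorem fracLap_eq_of_tendsto {v : Sp N → ℝ} {x : Sp N} {l : ℝ}
    (h : Tendsto (fun r => ∫ y in {y : Sp N | r < ‖x - y‖}, (v x - v y) / ‖x - y‖ ^ ((N : ℝ) + β))
      (𝓝[>] (0 : ℝ)) (𝓝 l)) : fracLap (β / 2) v x = fracConst N β * l := by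
  rw [fracLap, fracConst, mul_div_cancel₀ β (two_ne_zero), h.limUnder_eq]

theorem IsPhiBounded.fracLap_eq (hN : 1 ≤ N) (hβ : 0 < β) (hβ2 : β < 2) {v : Sp N → ℝ}
    (hv : IsPhiBounded β A v) : fracLap (β / 2) v = fun x => fracConst N β * symmLap β v x :=
  funext fun x => fracLap_eq_of_tendsto (hv.tendsto_truncated hN hβ hβ2 x)

theorem IsPhiBounded.abs_fracLap_le (hN : 1 ≤ N) (hβ : 0 < β) (hβ2 : β < 2) {v : Sp N → ℝ}
    (hv : IsPhiBounded β A v) (x : Sp N) :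
    |fracLap (β / 2) v x| ≤ |fracConst N β| * (2⁻¹ * majorantMass N β * A) * phi N β x := by
  rw [hv.fracLap_eq hN hβ hβ2, abs_mul, mul_assoc]
  exact mul_le_mul_of_nonneg_left (hv.abs_symmLap_le hN hβ hβ2 x) (abs_nonneg _)

theorem IsPhiBounded.measurable_fracLap (hN : 1 ≤ N) (hβ : 0 < β) (hβ2 : β < 2) {v : Sp N → ℝ}
    (hv : IsPhiBounded β A v) : StronglyMeasurable (fracLap (β / 2) v) := by
  rw [hv.fracLap_eq hN hβ hβ2]
  exact ((measurable_quotient hv.cont).stronglyMeasurable.integral_prod_right'.const_mul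
    _).const_mul _

/-- Dominated convergence for the fractional Laplacian. -/
theorem tendsto_fracLap (hN : 1 ≤ N) (hβ : 0 < β) (hβ2 : β < 2) {v : Sp N → ℝ}
    {V : ℕ → Sp N → ℝ} (hv : IsPhiBounded β A v) (hV : ∀ n, IsPhiBounded β A (V n))
    (hlim : ∀ x, Tendsto (fun n => V n x) atTop (𝓝 (v x))) (x : Sp N) :
    Tendsto (fun n => fracLap (β / 2) (V n) x) atTop (𝓝 (fracLap (β / 2) v x)) := by
  simp_rw [fun n => (hV n).fracLap_eq hN hβ hβ2, hv.fracLap_eq hN hβ hβ2]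
  refine Tendsto.const_mul _ (Tendsto.const_mul _ ?_)
  refine tendsto_integral_of_dominated_convergence (fun z => A * phi N β x * majorant β x z)
    (fun n => ((hV n).integrable_quotient hN hβ hβ2 x).aestronglyMeasurable)
    ((majorant_integral hN hβ hβ2 x).1.const_mul _)
    (fun n => Eventually.of_forall fun z => (hV n).abs_quotient_le hβ x z)
    (Eventually.of_forall fun z => ?_)
  exact ((((hlim x).const_mul 2).sub (hlim _)).sub (hlim _)).div_const _

theorem IsPhiBounded.const_mul {v : Sp N → ℝ} (hv : IsPhiBounded β A v) (a : ℝ) :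
    IsPhiBounded β (|a| * A) fun x => a * v x := by
  refine ⟨continuous_const.mul hv.cont, fun x => ?_, fun x y hy => ?_⟩
  · rw [abs_mul, mul_assoc]
    exact mul_le_mul_of_nonneg_left (hv.bound x) (abs_nonneg _)
  · have : a * v (x + y) + a * v (x - y) - 2 * (a * v x)
        = a * (v (x + y) + v (x - y) - 2 * v x) := by ring
    rw [this, abs_mul, mul_assoc, mul_assoc, ← mul_assoc A]
    exact mul_le_mul_of_nonneg_left (hv.diff x y hy) (abs_nonneg _)

theorem IsPhiBounded.fracLap_const_mul (hN : 1 ≤ N) (hβ : 0 < β) (hβ2 : β < 2) {v : Sp N → ℝ}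
    (hv : IsPhiBounded β A v) (a : ℝ) (x : Sp N) :
    fracLap (β / 2) (fun x => a * v x) x = a * fracLap (β / 2) v x := by
  rw [(hv.const_mul a).fracLap_eq hN hβ hβ2, hv.fracLap_eq hN hβ hβ2]
  simp only [symmLap]
  have : ∀ z, (2 * (a * v x) - a * v (x + z) - a * v (x - z)) / ‖z‖ ^ ((N : ℝ) + β)
      = a * ((2 * v x - v (x + z) - v (x - z)) / ‖z‖ ^ ((N : ℝ) + β)) := fun z => by ring
  simp_rw [this, integral_const_mul]
  ring

/-- The scaling of the fractional Laplacian. -/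
theorem IsPhiBounded.fracLap_comp_smul (hN : 1 ≤ N) (hβ : 0 < β) (hβ2 : β < 2) {v : Sp N → ℝ}
    (hv : IsPhiBounded β A v) {R : ℝ} (hR : 0 < R) (x : Sp N) :
    fracLap (β / 2) (fun y => v (R⁻¹ • y)) x = R ^ (-β) * fracLap (β / 2) v (R⁻¹ • x) := by
  have hlim := hv.tendsto_truncated hN hβ hβ2 (R⁻¹ • x)
  have hr : Tendsto (fun r : ℝ => R⁻¹ * r) (𝓝[>] 0) (𝓝[>] 0) := by
    refine tendsto_nhdsWithin_iff.2 ⟨?_, ?_⟩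
    · have : Tendsto (fun r : ℝ => R⁻¹ * r) (𝓝 0) (𝓝 (R⁻¹ * 0)) := tendsto_id.const_mul _
      rw [mul_zero] at this
      exact this.mono_left nhdsWithin_le_nhds
    · filter_upwards [self_mem_nhdsWithin] with r hr using mul_pos (inv_pos.2 hR) hr
  rw [fracLap_eq_of_tendsto (l := R ^ (-β) * symmLap β v (R⁻¹ • x)),
    hv.fracLap_eq hN hβ hβ2]
  · ring
  refine ((hlim.comp hr).const_mul (R ^ (-β))).congr fun r => ?_
  have hS : MeasurableSet {y : Sp N | r < ‖x - y‖} :=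
    measurableSet_lt measurable_const (by fun_prop)
  have hS' : MeasurableSet {y : Sp N | R⁻¹ * r < ‖R⁻¹ • x - y‖} :=
    measurableSet_lt measurable_const (by fun_prop)
  have hcv := Measure.integral_comp_inv_smul_of_nonneg (volume : Measure (Sp N))
    ({y : Sp N | R⁻¹ * r < ‖R⁻¹ • x - y‖}.indicator fun y =>
      (v (R⁻¹ • x) - v y) / ‖R⁻¹ • x - y‖ ^ ((N : ℝ) + β)) hR.le
  rw [Function.comp_apply, ← integral_indicator hS, ← integral_indicator hS']
  rw [finrank_euclideanSpace_fin, smul_eq_mul] at hcv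
  have hRN : (0 : ℝ) < R ^ N := pow_pos hR N
  -- The change of variables contributes `R^N` and the kernel contributes `R^(-N-β)`; multiplying
  -- both sides by `R^N` reduces the claim to equality of the integrands.
  rw [← mul_right_inj' hRN.ne', mul_left_comm, ← hcv, ← integral_const_mul, ← integral_const_mul]
  congr 1
  ext y
  have hn : ‖R⁻¹ • x - R⁻¹ • y‖ = R⁻¹ * ‖x - y‖ := by
    rw [← smul_sub, norm_smul, Real.norm_eq_abs, abs_of_pos (inv_pos.2 hR)]
  by_cases h : r < ‖x - y‖
  · rw [indicator_of_mem (show y ∈ {y : Sp N | r < ‖x - y‖} from h), indicator_of_mem, hn,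
      Real.mul_rpow (inv_pos.2 hR).le (norm_nonneg _), Real.inv_rpow hR.le, Real.rpow_add hR,
      Real.rpow_natCast, Real.rpow_neg hR.le]
    · have : 0 < R ^ β := Real.rpow_pos_of_pos hR _
      field_simp
    · change R⁻¹ * r < ‖R⁻¹ • x - R⁻¹ • y‖
      rw [hn]
      exact mul_lt_mul_of_pos_left h (inv_pos.2 hR)
  · rw [indicator_of_notMem (show y ∉ {y : Sp N | r < ‖x - y‖} from h), indicator_of_notMem]
    · simp
    · change ¬ R⁻¹ * r < ‖R⁻¹ • x - R⁻¹ • y‖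
      rw [hn]
      exact fun h' => h (lt_of_mul_lt_mul_left h' (inv_pos.2 hR).le)

end FracLap

/-! ### Regularity of `φ` and of its cutoffs -/

/-- The symmetrised function `f(s) + f(-s)` has derivative `f'(s) - f'(-s)`, at most `2 D s` in
modulus on `[0,1]`; apply the mean value inequality twice. -/
theorem abs_second_difference_le {f f' f'' : ℝ → ℝ} {D : ℝ} (hf : ∀ s, HasDerivAt f (f' s) s)
    (hf' : ∀ s, HasDerivAt f' (f'' s) s) (hD : ∀ s, |s| ≤ 1 → |f'' s| ≤ D) :
    |f 1 + f (-1) - 2 * f 0| ≤ 2 * D := by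
  have h1 : ∀ s ∈ Icc (-1 : ℝ) 1, ∀ t ∈ Icc (-1 : ℝ) 1, |f' s - f' t| ≤ D * |s - t| :=
    fun s hs t ht => (convex_Icc (-1 : ℝ) 1).norm_image_sub_le_of_norm_hasDerivWithin_le
      (fun x _ => (hf' x).hasDerivWithinAt) (fun x hx => hD x (abs_le.2 hx)) ht hs
  have hD0 : 0 ≤ D := (abs_nonneg _).trans (hD 0 (by simp))
  have hg : ∀ s, HasDerivAt (fun s => f s + f (-s)) (f' s - f' (-s)) s := fun s => by
    have := (hf s).add ((hf (-s)).scomp s (hasDerivAt_neg s))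
    exact this.congr_deriv (by simp [sub_eq_add_neg])
  have h2 := (convex_Icc (0 : ℝ) 1).norm_image_sub_le_of_norm_hasDerivWithin_le
    (f := fun s => f s + f (-s)) (C := 2 * D)
    (fun x _ => (hg x).hasDerivWithinAt) (fun x hx => by
      refine (h1 x ⟨by linarith [hx.1], hx.2⟩ (-x) ⟨by linarith [hx.2], by linarith [hx.1]⟩).trans ?_
      rw [sub_neg_eq_add, abs_of_nonneg (by linarith [hx.1])]
      nlinarith [hx.2])
    (left_mem_Icc.2 zero_le_one) (right_mem_Icc.2 zero_le_one)
  simp only [neg_zero, sub_zero, norm_one, mul_one, Real.norm_eq_abs] at h2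
  convert h2 using 2
  ring

section PhiReg

variable {N : ℕ} {β : ℝ}

/-- Along `x + s y`, `φ` is a negative power `q^e` of a quadratic polynomial. Each derivative costs
a factor `‖y‖`, its growth in `x` being compensated by the lower power of `q`. Since `‖y‖ ≤ 1`,
`q(s)^e` is comparable with `φ(x)` for `|s| ≤ 1`. -/
theorem phi_differences (hβ : 0 < β) : ∃ c : ℝ, 0 ≤ c ∧ ∀ x y : Sp N, ‖y‖ ≤ 1 →
    |phi N β (x + y) - phi N β x| ≤ c * ‖y‖ * phi N β x ∧
    |phi N β (x + y) + phi N β (x - y) - 2 * phi N β x| ≤ c * ‖y‖ ^ 2 * phi N β x := by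
  set e : ℝ := -((N : ℝ) + β) / 2 with he
  have hN : (0 : ℝ) ≤ N := N.cast_nonneg
  have he0 : e ≤ 0 := by rw [he]; linarith
  set c3 : ℝ := (3 : ℝ) ^ (((N : ℝ) + β) / 2) with hc3
  have c3pos : 0 < c3 := by positivity
  refine ⟨2 * (4 * |e * (e - 1)| + 2 * |e|) * c3, by positivity, fun x y hy => ?_⟩
  set q : ℝ → ℝ := fun s => 1 + ‖x + s • y‖ ^ 2 with hq
  have hqpos : ∀ s, 1 ≤ q s := fun s => by simp [hq]
  have hqe : ∀ s, q s = 1 + ‖x‖ ^ 2 + s * (2 * inner ℝ x y) + s ^ 2 * ‖y‖ ^ 2 := fun s => by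
    simp only [hq]
    rw [norm_add_sq_real, real_inner_smul_right, norm_smul, mul_pow, Real.norm_eq_abs, sq_abs]
    ring
  have hqd : ∀ s, HasDerivAt q (2 * inner ℝ (x + s • y) y) s := fun s => by
    have h1 : HasDerivAt (fun s => 1 + ‖x‖ ^ 2 + s * (2 * inner ℝ x y) + s ^ 2 * ‖y‖ ^ 2)
        (1 * (2 * inner ℝ x y) + (2 * s ^ (2 - 1) * 1) * ‖y‖ ^ 2) s :=
      (((hasDerivAt_id s).mul_const _).const_add _).add (((hasDerivAt_id s).pow 2).mul_const _)
    rw [funext hqe]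
    convert h1 using 1
    rw [inner_add_left, real_inner_smul_left, real_inner_self_eq_norm_sq]
    ring
  have hqd2 : ∀ s, HasDerivAt (fun s : ℝ => 2 * inner ℝ (x + s • y) y) (2 * ‖y‖ ^ 2) s := fun s => by
    have h1 : HasDerivAt (fun s => 2 * (inner ℝ x y + s * ‖y‖ ^ 2)) (2 * (1 * ‖y‖ ^ 2)) s :=
      (((hasDerivAt_id s).mul_const _).const_add _).const_mul _
    rw [one_mul] at h1
    convert h1 using 2 with r
    rw [inner_add_left, real_inner_smul_left, real_inner_self_eq_norm_sq]
  set f : ℝ → ℝ := fun s => q s ^ e with hf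
  set f' : ℝ → ℝ := fun s => (2 * inner ℝ (x + s • y) y) * e * q s ^ (e - 1) with hf'
  set f'' : ℝ → ℝ := fun s => (2 * ‖y‖ ^ 2) * e * q s ^ (e - 1) +
    (2 * inner ℝ (x + s • y) y) * e *
      ((2 * inner ℝ (x + s • y) y) * (e - 1) * q s ^ (e - 1 - 1)) with hf''
  have hfd : ∀ s, HasDerivAt f (f' s) s := fun s =>
    (hqd s).rpow_const (Or.inl (zero_lt_one.trans_le (hqpos s)).ne')
  have hfd' : ∀ s, HasDerivAt f' (f'' s) s := fun s =>
    ((hqd2 s).mul_const e).mul ((hqd s).rpow_const (Or.inl (zero_lt_one.trans_le (hqpos s)).ne'))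
  have hq' : ∀ s : ℝ, |2 * inner ℝ (x + s • y) y| ≤ 2 * (‖x + s • y‖ * ‖y‖) := fun s => by
    rw [abs_mul, abs_two]
    gcongr
    exact abs_real_inner_le_norm _ _
  have hsq : ∀ s : ℝ, ‖x + s • y‖ ^ 2 ≤ q s := fun s => by simp [hq]
  have hsq1 : ∀ s : ℝ, ‖x + s • y‖ ≤ q s := fun s => by
    simp only [hq]
    nlinarith [sq_nonneg (‖x + s • y‖ - 1), norm_nonneg (x + s • y)]
  have hfle : ∀ s, |s| ≤ 1 → q s ^ e ≤ c3 * phi N β x := fun s hs => by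
    refine phi_le_of_le hβ (by norm_num : (0 : ℝ) < 3) ?_
    have : ‖x‖ ≤ ‖x + s • y‖ + 1 := by
      have h1 : ‖s • y‖ ≤ 1 := by
        rw [norm_smul, Real.norm_eq_abs]
        exact mul_le_one₀ hs (norm_nonneg _) hy
      have h2 := norm_sub_le (x + s • y) (s • y)
      rw [add_sub_cancel_right] at h2
      linarith
    nlinarith [sq_nonneg (‖x + s • y‖ - 1), norm_nonneg x, norm_nonneg (x + s • y)]
  have hpow : ∀ s, q s ^ (e - 1) = q s ^ e / q s := fun s =>
    Real.rpow_sub_one (zero_lt_one.trans_le (hqpos s)).ne' _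
  have hpow2 : ∀ s, q s ^ (e - 1 - 1) = q s ^ e / q s / q s := fun s => by
    rw [Real.rpow_sub_one (zero_lt_one.trans_le (hqpos s)).ne', hpow]
  have hqe0 : ∀ s, 0 < q s ^ e := fun s => Real.rpow_pos_of_pos (zero_lt_one.trans_le (hqpos s)) _
  have y0 := norm_nonneg y
  have hb1 : ∀ s, |s| ≤ 1 → |f' s| ≤ 2 * |e| * c3 * ‖y‖ * phi N β x := fun s hs => by
    have h0 := zero_lt_one.trans_le (hqpos s)
    have hX := hqe0 s
    simp only [hf', hpow]
    rw [abs_mul, abs_mul, abs_div (q s ^ e), abs_of_pos hX, abs_of_pos h0]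
    calc _ ≤ 2 * (q s * ‖y‖) * |e| * (q s ^ e / q s) := by
          gcongr
          exact (hq' s).trans (by gcongr; exact hsq1 s)
      _ = 2 * ‖y‖ * |e| * q s ^ e := by field_simp
      _ ≤ 2 * ‖y‖ * |e| * (c3 * phi N β x) := by gcongr; exact hfle s hs
      _ = _ := by ring
  have hb2 : ∀ s, |s| ≤ 1 →
      |f'' s| ≤ (4 * |e * (e - 1)| + 2 * |e|) * c3 * ‖y‖ ^ 2 * phi N β x := fun s hs => by
    have h0 := zero_lt_one.trans_le (hqpos s)
    have hX := hqe0 s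
    simp only [hf'', hpow, hpow2]
    have t1 : |(2 * ‖y‖ ^ 2) * e * (q s ^ e / q s)| ≤ 2 * |e| * ‖y‖ ^ 2 * q s ^ e := by
      rw [abs_mul, abs_mul, abs_div (q s ^ e), abs_of_pos hX, abs_of_pos h0,
        abs_of_nonneg (by positivity : 0 ≤ 2 * ‖y‖ ^ 2)]
      have : q s ^ e / q s ≤ q s ^ e := div_le_self hX.le (hqpos s)
      calc _ ≤ 2 * ‖y‖ ^ 2 * |e| * q s ^ e := by gcongr
        _ = _ := by ring
    have t2 : |(2 * inner ℝ (x + s • y) y) * e *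
        ((2 * inner ℝ (x + s • y) y) * (e - 1) * (q s ^ e / q s / q s))|
        ≤ 4 * |e * (e - 1)| * ‖y‖ ^ 2 * q s ^ e := by
      have e1 : (2 * inner ℝ (x + s • y) y) * e *
        ((2 * inner ℝ (x + s • y) y) * (e - 1) * (q s ^ e / q s / q s))
        = (2 * inner ℝ (x + s • y) y) ^ 2 * (e * (e - 1)) * (q s ^ e / q s / q s) := by ring
      rw [e1, abs_mul, abs_mul, abs_of_pos (by positivity : 0 < q s ^ e / q s / q s),
        abs_of_nonneg (sq_nonneg _)]
      have e2 : (2 * inner ℝ (x + s • y) y) ^ 2 ≤ 4 * (q s * ‖y‖ ^ 2) := by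
        rw [← sq_abs]
        calc _ ≤ (2 * (‖x + s • y‖ * ‖y‖)) ^ 2 := by gcongr; exact hq' s
          _ = 4 * (‖x + s • y‖ ^ 2 * ‖y‖ ^ 2) := by ring
          _ ≤ _ := by gcongr; exact hsq s
      calc _ ≤ 4 * (q s * ‖y‖ ^ 2) * |e * (e - 1)| * (q s ^ e / q s / q s) := by gcongr
        _ = 4 * |e * (e - 1)| * ‖y‖ ^ 2 * (q s ^ e / q s) := by field_simp
        _ ≤ _ := by
          gcongr
          exact div_le_self hX.le (hqpos s)
    refine (abs_add_le _ _).trans ((add_le_add t1 t2).trans ?_)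
    calc _ = (4 * |e * (e - 1)| + 2 * |e|) * ‖y‖ ^ 2 * q s ^ e := by ring
      _ ≤ (4 * |e * (e - 1)| + 2 * |e|) * ‖y‖ ^ 2 * (c3 * phi N β x) := by
        gcongr; exact hfle s hs
      _ = _ := by ring
  have hf0 : f 0 = phi N β x := by simp [hf, hq, phi, he]
  have hf1 : f 1 = phi N β (x + y) := by simp [hf, hq, phi, he]
  have hfm : f (-1) = phi N β (x - y) := by simp [hf, hq, phi, he, sub_eq_add_neg]
  have hφ := phi_pos (β := β) x
  rw [← hf0, ← hf1, ← hfm]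
  constructor
  · have := (convex_Icc (0 : ℝ) 1).norm_image_sub_le_of_norm_hasDerivWithin_le
      (fun r _ => (hfd r).hasDerivWithinAt) (fun r hr => hb1 r (by
        rw [abs_of_nonneg hr.1]; exact hr.2))
      (left_mem_Icc.2 zero_le_one) (right_mem_Icc.2 zero_le_one)
    simp only [sub_zero, norm_one, mul_one, Real.norm_eq_abs] at this
    refine this.trans ?_
    rw [hf0]
    gcongr
    have := abs_nonneg e
    have := abs_nonneg (e * (e - 1))
    linarith
  · refine (abs_second_difference_le hfd hfd' hb2).trans_eq ?_
    rw [hf0]; ring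

/-- The smooth cutoffs of `φ`. -/
def phiCut (N : ℕ) (β : ℝ) (n : ℕ) (x : Sp N) : ℝ :=
  (⟨1, 2, one_pos, one_lt_two⟩ : ContDiffBump (0 : Sp N)) (((n : ℝ) + 1)⁻¹ • x) * phi N β x

theorem contDiff_phiCut (n : ℕ) : ContDiff ℝ ∞ (phiCut N β n) :=
  ((ContDiffBump.contDiff _).comp (contDiff_const_smul _)).mul contDiff_phi

theorem hasCompactSupport_phiCut (n : ℕ) : HasCompactSupport (phiCut N β n) := by
  have hn : ((n : ℝ) + 1)⁻¹ ≠ 0 := by positivity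
  exact ((ContDiffBump.hasCompactSupport _).comp_smul hn).mul_right

theorem phiCut_nonneg (n : ℕ) (x : Sp N) : 0 ≤ phiCut N β n x :=
  mul_nonneg (ContDiffBump.nonneg _) (phi_pos x).le

theorem phiCut_le (n : ℕ) (x : Sp N) : phiCut N β n x ≤ phi N β x :=
  mul_le_of_le_one_left (phi_pos x).le (ContDiffBump.le_one _)

theorem tendsto_phiCut (x : Sp N) :
    Tendsto (fun n => phiCut N β n x) atTop (𝓝 (phi N β x)) := by
  refine tendsto_const_nhds.congr' ?_
  obtain ⟨m, hm⟩ := exists_nat_ge ‖x‖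
  filter_upwards [eventually_ge_atTop m] with n hn
  rw [phiCut, ContDiffBump.one_of_mem_closedBall, one_mul]
  rw [mem_closedBall_zero_iff, norm_smul, Real.norm_eq_abs, abs_of_pos (by positivity),
    inv_mul_le_iff₀ (by positivity)]
  have : (m : ℝ) ≤ n := by exact_mod_cast hn
  linarith

/-- Smooth functions with compact support have bounded first and second difference quotients. -/
theorem exists_difference_bounds {χ : Sp N → ℝ} (hχ : ContDiff ℝ ∞ χ) (hc : HasCompactSupport χ) :
    ∃ L : ℝ, 0 ≤ L ∧ ∀ x y : Sp N, |χ (x + y) - χ x| ≤ L * ‖y‖ ∧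
      |χ (x + y) + χ (x - y) - 2 * χ x| ≤ L * ‖y‖ ^ 2 := by
  obtain ⟨L₁, h1⟩ := hχ.lipschitzWith_of_hasCompactSupport hc (by simp)
  have hd : ContDiff ℝ 1 (fderiv ℝ χ) := hχ.fderiv_right (by norm_cast)
  obtain ⟨L₂, h2⟩ := hd.lipschitzWith_of_hasCompactSupport (hc.fderiv ℝ) (by simp)
  refine ⟨max L₁ (2 * L₂), le_max_of_le_left L₁.2, fun x y => ⟨?_, ?_⟩⟩
  · have := h1.dist_le_mul (x + y) x
    rw [Real.dist_eq, dist_eq_norm, add_sub_cancel_left] at this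
    exact this.trans (by gcongr; exact le_max_left _ _)
  · have hdiff : ∀ z, HasFDerivAt χ (fderiv ℝ χ z) z := fun z =>
      (hχ.differentiable (by simp) z).hasFDerivAt
    -- The gradients cancel at `z = 0`, so on the ball of radius `‖y‖` this derivative is at most `2
    -- L₂ ‖y‖`; a second mean value step gives `‖y‖^2`.
    have hg : ∀ z, HasFDerivAt (fun z => χ (x + z) + χ (x - z))
        (fderiv ℝ χ (x + z) - fderiv ℝ χ (x - z)) z := fun z => by
      have a1 := (hdiff (x + z)).comp z ((hasFDerivAt_id z).const_add x)
      have a2 := (hdiff (x - z)).comp z ((hasFDerivAt_id z).const_sub x)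
      refine (a1.add a2).congr_fderiv ?_
      ext w
      simp [sub_eq_add_neg]
    have := (convex_closedBall (0 : Sp N) ‖y‖).norm_image_sub_le_of_norm_hasFDerivWithin_le
      (C := 2 * L₂ * ‖y‖) (fun z _ => (hg z).hasFDerivWithinAt) (fun z hz => by
        have := h2.dist_le_mul (x + z) (x - z)
        rw [dist_eq_norm, dist_eq_norm] at this
        have e : x + z - (x - z) = (2 : ℝ) • z := by rw [two_smul]; abel
        rw [e, norm_smul, Real.norm_two] at this
        rw [mem_closedBall_zero_iff] at hz
        have hL : (0 : ℝ) ≤ L₂ := L₂.2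
        calc _ ≤ (L₂ : ℝ) * (2 * ‖z‖) := this
          _ ≤ L₂ * (2 * ‖y‖) := by gcongr
          _ = _ := by ring)
      (Metric.mem_closedBall_self (norm_nonneg y)) (show y ∈ Metric.closedBall (0 : Sp N) ‖y‖ by simp)
    simp only [sub_zero, add_zero, Real.norm_eq_abs] at this
    rw [← two_mul] at this
    refine this.trans ?_
    calc _ = 2 * L₂ * ‖y‖ ^ 2 := by ring
      _ ≤ _ := by gcongr; exact le_max_right _ _

/-- One constant serves all cutoffs because the dilation factor `1/(n+1)` is at most `1` and only
shrinks the increments of the bump function. -/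
theorem exists_isPhiBounded (hβ : 0 < β) :
    ∃ A : ℝ, IsPhiBounded β A (phi N β) ∧ ∀ n, IsPhiBounded β A (phiCut N β n) := by
  obtain ⟨c, hc, hphi⟩ := phi_differences (N := N) hβ
  set χ : ContDiffBump (0 : Sp N) := ⟨1, 2, one_pos, one_lt_two⟩ with hχ
  obtain ⟨L, hL, hbump⟩ := exists_difference_bounds (χ.contDiff (n := ⊤)) χ.hasCompactSupport
  refine ⟨1 + c + L + 2 * (L * c), ⟨continuous_phi, fun x => ?_, fun x y hy => ?_⟩,
    fun n => ⟨(contDiff_phiCut n).continuous, fun x => ?_, fun x y hy => ?_⟩⟩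
  · have := phi_pos (β := β) x
    rw [abs_of_pos this]
    refine le_mul_of_one_le_left this.le ?_
    have := mul_nonneg hL hc
    linarith
  · have := phi_pos (β := β) x
    refine ((hphi x y hy).2).trans ?_
    have := mul_nonneg hL hc
    gcongr
    linarith
  · have := phi_pos (β := β) x
    rw [abs_of_nonneg (phiCut_nonneg n x)]
    refine (phiCut_le n x).trans (le_mul_of_one_le_left this.le ?_)
    have := mul_nonneg hL hc
    linarith
  · set a : ℝ := ((n : ℝ) + 1)⁻¹ with ha
    have ha0 : 0 ≤ a := by positivity
    have ha1 : a ≤ 1 := inv_le_one_of_one_le₀ (by linarith [n.cast_nonneg (α := ℝ)])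
    have hay : ‖a • y‖ ≤ ‖y‖ := by
      rw [norm_smul, Real.norm_eq_abs, abs_of_nonneg ha0]
      exact mul_le_of_le_one_left (norm_nonneg _) ha1
    have hay2 : ‖a • (-y)‖ ≤ ‖y‖ := by rwa [smul_neg, norm_neg]
    have hφ := phi_pos (β := β) x
    have p1 := (hphi x y hy).1
    have p2 := (hphi x (-y) (by rwa [norm_neg])).1
    have p3 := (hphi x y hy).2
    have b1 := (hbump (a • x) (a • y)).1.trans (mul_le_mul_of_nonneg_left hay hL)
    have b2 := (hbump (a • x) (a • (-y))).1.trans (mul_le_mul_of_nonneg_left hay2 hL)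
    have b3 := (hbump (a • x) (a • y)).2.trans (mul_le_mul_of_nonneg_left
      (pow_le_pow_left₀ (norm_nonneg _) hay 2) hL)
    rw [← smul_add] at b1 b2 b3
    rw [← smul_sub] at b3
    rw [← sub_eq_add_neg] at b2 p2
    rw [norm_neg] at p2
    have b0 : |χ (a • x)| ≤ 1 := by
      rw [abs_of_nonneg χ.nonneg]; exact χ.le_one
    -- Discrete Leibniz rule: the two second differences plus products of first differences.
    have e : phiCut N β n (x + y) + phiCut N β n (x - y) - 2 * phiCut N β n x
        = χ (a • x) * (phi N β (x + y) + phi N β (x - y) - 2 * phi N β x)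
          + (χ (a • (x + y)) + χ (a • (x - y)) - 2 * χ (a • x)) * phi N β x
          + (χ (a • (x + y)) - χ (a • x)) * (phi N β (x + y) - phi N β x)
          + (χ (a • (x - y)) - χ (a • x)) * (phi N β (x - y) - phi N β x) := by
      simp only [phiCut]
      ring
    rw [e]
    refine (abs_add_le _ _).trans ((add_le_add_left ((abs_add_le _ _).trans
      (add_le_add_left (abs_add_le _ _) _)) _).trans ?_)
    simp only [abs_mul]
    rw [abs_of_pos hφ]
    have y0 := norm_nonneg y
    calc _ ≤ 1 * (c * ‖y‖ ^ 2 * phi N β x) + L * ‖y‖ ^ 2 * phi N β x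
          + L * ‖y‖ * (c * ‖y‖ * phi N β x) + L * ‖y‖ * (c * ‖y‖ * phi N β x) := by gcongr
      _ = (c + L + 2 * (L * c)) * ‖y‖ ^ 2 * phi N β x := by ring
      _ ≤ _ := by gcongr; linarith

/-- An admissible constant `K` exists. -/
theorem exists_isFracLapBound (hN : 1 ≤ N) (hβ : 0 < β) (hβ2 : β < 2) :
    ∃ K : ℝ, IsFracLapBound N β K := by
  obtain ⟨A, hA, -⟩ := exists_isPhiBounded (N := N) hβ
  refine ⟨max 1 (|fracConst N β| * (2⁻¹ * majorantMass N β * A)),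
    zero_lt_one.trans_le (le_max_left _ _), fun x => ?_⟩
  refine (hA.abs_fracLap_le hN hβ hβ2 x).trans ?_
  have := phi_pos (β := β) x
  gcongr
  exact le_max_right _ _

end PhiReg

/-! ### Weak derivatives in time -/

theorem exists_Icc_of_isCompact {S : Set ℝ} {T : ℝ} (hT : 0 < T) (hS : IsCompact S)
    (h : S ⊆ Ioo 0 T) : ∃ a b, 0 < a ∧ a ≤ b ∧ b < T ∧ S ⊆ Icc a b := by
  rcases S.eq_empty_or_nonempty with rfl | hne
  · exact ⟨T / 2, T / 2, by linarith, le_rfl, by linarith, empty_subset _⟩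
  · exact ⟨sInf S, sSup S, (h (hS.sInf_mem hne)).1,
      csInf_le hS.bddBelow (hS.sSup_mem hne), (h (hS.sSup_mem hne)).2,
      fun x hx => ⟨csInf_le hS.bddBelow hx, le_csSup hS.bddAbove hx⟩⟩

theorem integrable_mul_of_tsupport {E : Type*} [NormedAddCommGroup E] [NormedSpace ℝ E]
    {η : ℝ → ℝ} {g : ℝ → E} {T : ℝ} (hη : Continuous η)
    (hc : HasCompactSupport η) (hs : tsupport η ⊆ Ioo 0 T) (hg : ContinuousOn g (Ico 0 T)) :
    Integrable fun t => η t • g t := by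
  have h1 : tsupport (fun t => η t • g t) ⊆ Ioo 0 T := (tsupport_smul_subset_left η g).trans hs
  have h2 : Continuous fun t => η t • g t :=
    (hη.continuousOn.smul (hg.mono Ioo_subset_Ico_self)).continuous_of_tsupport_subset isOpen_Ioo h1
  exact h2.integrable_of_hasCompactSupport hc.smul_right

theorem setIntegral_eq_integral_of_tsupport {E : Type*} [NormedAddCommGroup E] [NormedSpace ℝ E]
    {η : ℝ → ℝ} {g : ℝ → E} {S : Set ℝ} (hs : tsupport η ⊆ S) :
    ∫ t in S, η t • g t = ∫ t, η t • g t :=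
  setIntegral_eq_integral_of_forall_compl_eq_zero fun t ht => by
    rw [image_eq_zero_of_notMem_tsupport (fun h => ht (hs h)), zero_smul]

theorem tsupport_deriv_subset' {η : ℝ → ℝ} : tsupport (deriv η) ⊆ tsupport η :=
  closure_minimal (support_deriv_subset) isClosed_closure

/-- Integration by parts against the primitive of a bounded function. -/
theorem integral_deriv_mul_primitive {F η : ℝ → ℝ} {T : ℝ} (hT : 0 < T)
    (hF : ∀ t < T, ∃ M, BddOn F t M) (hη : ContDiff ℝ ∞ η) (hc : HasCompactSupport η)
    (hs : tsupport η ⊆ Ioo 0 T) :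
    ∫ t in Ioo 0 T, deriv η t * ∫ s in (0 : ℝ)..t, F s = -∫ t in Ioo 0 T, η t * F t := by
  obtain ⟨a, b, ha, hab, hb, hsub⟩ := exists_Icc_of_isCompact hT hc hs
  obtain ⟨c, hbc, hcT⟩ := exists_between hb
  have hc0 : 0 ≤ c := by linarith
  obtain ⟨M, hM⟩ := hF c hcT
  have hFi := hM.intervalIntegrable hc0
  -- `F` is only bounded and measurable, so its primitive is differentiable almost everywhere;
  -- absolute continuity justifies the integration by parts.
  have hP : AbsolutelyContinuousOnInterval (fun t => ∫ s in (0 : ℝ)..t, F s) 0 c :=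
    hFi.absolutelyContinuousOnInterval_intervalIntegral left_mem_uIcc
  obtain ⟨L, hL⟩ := hη.lipschitzWith_of_hasCompactSupport hc (by simp)
  have hE : AbsolutelyContinuousOnInterval η 0 c :=
    (hL.lipschitzOnWith).absolutelyContinuousOnInterval
  have hzero : ∀ t, t ∉ Icc a b → η t = 0 := fun t ht =>
    image_eq_zero_of_notMem_tsupport fun h => ht (hsub h)
  have hzero' : ∀ t, t ∉ Icc a b → deriv η t = 0 := fun t ht =>
    image_eq_zero_of_notMem_tsupport fun h => ht (hsub (tsupport_deriv_subset' h))
  have key := hP.integral_mul_deriv_eq_deriv_mul hE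
  have e0 : ∫ x in (0 : ℝ)..c, deriv (fun t => ∫ s in (0 : ℝ)..t, F s) x * η x
      = ∫ x in (0 : ℝ)..c, η x * F x := by
    refine intervalIntegral.integral_congr_ae ?_
    filter_upwards [hFi.ae_hasDerivAt_integral] with x hx hx'
    rw [(hx (uIoc_subset_uIcc hx') 0 left_mem_uIcc).deriv, mul_comm]
  rw [e0, hzero c (fun h => by linarith [h.2]), hzero 0 (fun h => by linarith [h.1]), mul_zero,
    mul_zero, sub_zero, zero_sub, intervalIntegral.integral_of_le hc0,
    intervalIntegral.integral_of_le hc0] at key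
  have hIoc : Ioc 0 c ⊆ Ioo 0 T := fun x hx => ⟨hx.1, hx.2.trans_lt hcT⟩
  have hout : ∀ t ∈ Ioo 0 T \ Ioc 0 c, t ∉ Icc a b := fun t ht h =>
    ht.2 ⟨ht.1.1, h.2.trans hbc.le⟩
  rw [setIntegral_eq_of_subset_of_forall_sdiff_eq_zero measurableSet_Ioo hIoc
      (fun t ht => by rw [hzero' t (hout t ht), zero_mul]),
    setIntegral_eq_of_subset_of_forall_sdiff_eq_zero measurableSet_Ioo hIoc
      (fun t ht => by rw [hzero t (hout t ht), zero_mul]), ← key]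
  congr 1
  ext t
  ring

/-- The du Bois-Reymond lemma for continuous functions. -/
theorem exists_const_of_integral_deriv_mul_eq_zero {D : ℝ → ℝ} {T : ℝ} (hT : 0 < T)
    (hD : ContinuousOn D (Ico 0 T))
    (h : ∀ η : ℝ → ℝ, ContDiff ℝ ∞ η → HasCompactSupport η → tsupport η ⊆ Ioo 0 T →
      ∫ t, deriv η t • D t = 0) : ∀ t ∈ Ioo 0 T, D t = D 0 := by
  let f : ContDiffBump (T / 2) := ⟨T / 4, T / 3, by linarith, by linarith⟩
  set ρ : ℝ → ℝ := f.normed volume with hρ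
  have hρs : ContDiff ℝ ∞ ρ := f.contDiff_normed
  have hρc : HasCompactSupport ρ := f.hasCompactSupport_normed
  have hρt : tsupport ρ ⊆ Ioo 0 T := by
    rw [hρ, f.tsupport_normed_eq, Real.closedBall_eq_Icc]
    intro x hx
    constructor <;> simp only [f] at hx <;> linarith [hx.1, hx.2]
  have hρ1 : ∫ t, ρ t = 1 := f.integral_normed
  -- The constant is the mean of `D` against a bump of mass one. Subtracting the right multiple of
  -- the bump from any test function leaves integral zero, hence the derivative of a test function.
  set c : ℝ := ∫ t, ρ t • D t with hcdef
  have key : ∀ ψ : ℝ → ℝ, ContDiff ℝ ∞ ψ → HasCompactSupport ψ → tsupport ψ ⊆ Ioo 0 T →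
      ∫ t, ψ t • (D t - c) = 0 := by
    intro ψ hψ hψc hψt
    set I : ℝ := ∫ t, ψ t with hI
    set χ : ℝ → ℝ := fun t => ψ t - I * ρ t with hχ
    have hχs : ContDiff ℝ ∞ χ := hψ.sub (contDiff_const.mul hρs)
    obtain ⟨a, b, ha, hab, hb, hsub⟩ := exists_Icc_of_isCompact hT (hψc.isCompact.union hρc.isCompact)
      (union_subset hψt hρt)
    have hψi : Integrable ψ := hψ.continuous.integrable_of_hasCompactSupport hψc
    have hρi : Integrable ρ := hρs.continuous.integrable_of_hasCompactSupport hρc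
    have hzero : ∀ t, t ∉ Icc a b → χ t = 0 := fun t ht => by
      have h1 := image_eq_zero_of_notMem_tsupport fun h => ht (hsub (Or.inl h))
      have h2 := image_eq_zero_of_notMem_tsupport fun h => ht (hsub (Or.inr h))
      simp only [hχ, h1, h2, mul_zero, sub_zero]
    have hχ0 : ∫ t, χ t = 0 := by
      rw [hχ, integral_sub hψi (hρi.const_mul I), integral_const_mul, hρ1, mul_one, sub_self]
    set η : ℝ → ℝ := fun t => ∫ s in (0 : ℝ)..t, χ s with hη
    have hηd : ∀ t, HasDerivAt η (χ t) t := fun t =>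
      intervalIntegral.integral_hasDerivAt_right (hχs.continuous.intervalIntegrable _ _)
        (hχs.continuous.stronglyMeasurableAtFilter _ _) hχs.continuous.continuousAt
    have hηderiv : deriv η = χ := funext fun t => (hηd t).deriv
    have hηs : ContDiff ℝ ∞ η := contDiff_infty_iff_deriv.2
      ⟨fun t => (hηd t).differentiableAt, by rw [hηderiv]; exact hχs⟩
    have hηz : ∀ t, t ∉ Icc a b → η t = 0 := by
      intro t ht
      rcases lt_or_ge t a with hta | hta
      · refine intervalIntegral.integral_zero_ae (Eventually.of_forall fun s hs => hzero s ?_)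
        intro hs'
        rcases hs with ⟨h1, h2⟩
        have : max 0 t < a := max_lt ha hta
        linarith [hs'.1]
      · have htb : b < t := not_le.1 fun h => ht ⟨hta, h⟩
        have ht0 : 0 ≤ t := ha.le.trans hta
        rw [hη]
        simp only
        rw [intervalIntegral.integral_of_le ht0,
          setIntegral_eq_integral_of_forall_compl_eq_zero (fun s hs => hzero s ?_), hχ0]
        exact fun hs' => hs ⟨ha.trans_le hs'.1, hs'.2.trans htb.le⟩
    have hηsub : tsupport η ⊆ Icc a b := closure_minimal
      (fun t ht => by_contra fun h' => ht (hηz t h')) isClosed_Icc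
    have hηc : HasCompactSupport η := isCompact_Icc.of_isClosed_subset isClosed_closure hηsub
    have h0 := h η hηs hηc (hηsub.trans fun t ht => ⟨ha.trans_le ht.1, ht.2.trans_lt hb⟩)
    rw [hηderiv] at h0
    have i1 := integrable_mul_of_tsupport hψ.continuous hψc hψt hD
    have i2 := integrable_mul_of_tsupport hρs.continuous hρc hρt hD
    have e1 : (fun t => χ t • D t) = fun t => ψ t • D t - I * (ρ t • D t) := by
      ext t; simp only [hχ, smul_eq_mul]; ring
    rw [e1, integral_sub i1 (i2.const_mul I), integral_const_mul] at h0
    have e2 : (fun t => ψ t • (D t - c)) = fun t => ψ t • D t - ψ t * c := by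
      ext t; simp only [smul_eq_mul]; ring
    rw [e2, integral_sub i1 (hψi.mul_const c), integral_mul_const]
    exact h0
  have hDo : ContinuousOn D (Ioo 0 T) := hD.mono Ioo_subset_Ico_self
  have hae := isOpen_Ioo.ae_eq_zero_of_integral_contDiff_smul_eq_zero (f := fun t => D t - c)
    (U := Ioo 0 T) (μ := volume)
    ((hDo.sub continuousOn_const).locallyIntegrableOn measurableSet_Ioo) key
  have heq : EqOn (fun t => D t - c) (fun _ => 0) (Ioo 0 T) := by
    refine Measure.eqOn_open_of_ae_eq (μ := volume) ?_ isOpen_Ioo (hDo.sub continuousOn_const) continuousOn_const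
    exact (ae_restrict_iff' measurableSet_Ioo).2 hae
  have hD0 : D 0 = c := by
    have : (𝓝[Ioo 0 T] (0 : ℝ)).NeBot := left_nhdsWithin_Ioo_neBot hT
    have h1 : Tendsto D (𝓝[Ioo 0 T] 0) (𝓝 (D 0)) :=
      (hD 0 ⟨le_rfl, hT⟩).mono_left (nhdsWithin_mono _ Ioo_subset_Ico_self)
    refine tendsto_nhds_unique h1 (tendsto_const_nhds.congr' ?_)
    filter_upwards [self_mem_nhdsWithin] with t ht
    have := heq ht
    simp only at this
    linarith
  intro t ht
  have := heq ht
  simp only at this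
  linarith

/-- A continuous function with bounded weak derivative `F` is the primitive of `F`. -/
theorem eq_primitive_of_weak_deriv {H F : ℝ → ℝ} {T : ℝ} (hH : ContinuousOn H (Ico 0 T))
    (hH0 : H 0 = 0) (hF : ∀ t < T, ∃ M, BddOn F t M)
    (hweak : ∀ η : ℝ → ℝ, ContDiff ℝ ∞ η → HasCompactSupport η → tsupport η ⊆ Ioo 0 T →
      -∫ t in Ioo 0 T, deriv η t * H t = ∫ t in Ioo 0 T, η t * F t) :
    ∀ t ∈ Ico 0 T, H t = ∫ s in (0 : ℝ)..t, F s := by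
  intro t ht
  rcases ht.1.eq_or_lt with rfl | ht0
  · simp [hH0]
  have hT : 0 < T := ht0.trans ht.2
  have hP : ContinuousOn (fun t => ∫ s in (0 : ℝ)..t, F s) (Ico 0 T) := by
    simp_rw [← rlIntegral_one]
    exact continuousOn_rlIntegral one_pos le_rfl hF
  have := exists_const_of_integral_deriv_mul_eq_zero hT (hH.sub hP) (fun η hη hc hs => ?_) t
    ⟨ht0, ht.2⟩
  · simp only [Pi.sub_apply, hH0, intervalIntegral.integral_same, sub_zero] at this
    linarith
  · have hs' := tsupport_deriv_subset'.trans hs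
    have hdc : Continuous (deriv η) := hη.continuous_deriv (by simp)
    have i1 := integrable_mul_of_tsupport hdc hc.deriv hs' hH
    have i2 := integrable_mul_of_tsupport hdc hc.deriv hs' hP
    have e1 := hweak η hη hc hs
    have e2 := integral_deriv_mul_primitive hT hF hη hc hs
    have e3 := setIntegral_eq_integral_of_tsupport (g := H) hs'
    have e4 := setIntegral_eq_integral_of_tsupport (g := fun t => ∫ s in (0 : ℝ)..t, F s) hs'
    simp only [smul_eq_mul, Pi.sub_apply, mul_sub] at *
    rw [integral_sub i1 i2, ← e3, ← e4, e2]
    linarith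

/-! ### Pairings of `L²` functions with weights -/

section Pairing

variable {N : ℕ}

/-- The functional `f ↦ ∫ f w` on `L²`. -/
def pairing {w : Sp N → ℝ} (hw : MemLp w 2) : L2 N →L[ℂ] ℂ :=
  innerSL ℂ ((hw.ofReal (K := ℂ)).toLp)

/-- The inner product conjugates its first argument, which is the real weight, so no conjugate
survives. -/
theorem pairing_apply {w : Sp N → ℝ} (hw : MemLp w 2) (f : L2 N) :
    pairing hw f = ∫ x, f x * ((w x : ℝ) : ℂ) := by
  rw [pairing, innerSL_apply_apply, L2.inner_def]
  refine integral_congr_ae ?_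
  filter_upwards [(hw.ofReal (K := ℂ)).coeFn_toLp] with x hx
  rw [hx]
  simp

theorem integrable_mul_weight {w : Sp N → ℝ} (hw : MemLp w 2) (f : L2 N) :
    Integrable fun x => f x * ((w x : ℝ) : ℂ) :=
  (Lp.memLp f).integrable_mul (hw.ofReal (K := ℂ))

theorem integrable_norm_mul {w : Sp N → ℝ} (hw : MemLp w 2) (f : L2 N) :
    Integrable fun x => ‖f x‖ * w x :=
  (Lp.memLp f).norm.integrable_mul hw

theorem integral_norm_mul_le {w : Sp N → ℝ} (hw : MemLp w 2) (f : L2 N) :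
    ∫ x, ‖f x‖ * w x ≤ ‖f‖ * ‖hw.toLp w‖ := by
  have h1 := real_inner_le_norm ((Lp.memLp f).norm.toLp) (hw.toLp w)
  have h2 : ‖(Lp.memLp f).norm.toLp‖ = ‖f‖ := by
    rw [Lp.norm_toLp, eLpNorm_norm, Lp.norm_def]
  rw [h2, L2.inner_def] at h1
  refine le_of_eq_of_le (integral_congr_ae ?_) h1
  filter_upwards [(Lp.memLp f).norm.coeFn_toLp, hw.coeFn_toLp] with x hx hx'
  rw [hx, hx']
  simp [mul_comm]

theorem norm_pairing_le {v w : Sp N → ℝ} (hv : MemLp v 2) (hw : MemLp w 2) {C : ℝ}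
    (h : ∀ x, |v x| ≤ C * w x) (f : L2 N) :
    ‖pairing hv f‖ ≤ C * ∫ x, ‖f x‖ * w x := by
  rw [pairing_apply, ← integral_const_mul]
  refine norm_integral_le_of_norm_le ((integrable_norm_mul hw f).const_mul C)
    (Eventually.of_forall fun x => ?_)
  rw [norm_mul, Complex.norm_real, Real.norm_eq_abs]
  calc _ ≤ ‖f x‖ * (C * w x) := by gcongr; exact h x
    _ = _ := by ring

theorem tendsto_pairing {v w : Sp N → ℝ} {V : ℕ → Sp N → ℝ} (hv : MemLp v 2)
    (hV : ∀ n, MemLp (V n) 2) (hw : MemLp w 2) {C : ℝ} (h : ∀ n x, |V n x| ≤ C * w x)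
    (hlim : ∀ x, Tendsto (fun n => V n x) atTop (𝓝 (v x))) (f : L2 N) :
    Tendsto (fun n => pairing (hV n) f) atTop (𝓝 (pairing hv f)) := by
  simp_rw [pairing_apply]
  refine tendsto_integral_of_dominated_convergence (fun x => C * (‖f x‖ * w x))
    (fun n => (integrable_mul_weight (hV n) f).aestronglyMeasurable)
    ((integrable_norm_mul hw f).const_mul C) (fun n => Eventually.of_forall fun x => ?_)
    (Eventually.of_forall fun x => ?_)
  · rw [norm_mul, Complex.norm_real, Real.norm_eq_abs]
    calc _ ≤ ‖f x‖ * (C * w x) := by gcongr; exact h n x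
      _ = _ := by ring
  · exact ((Complex.continuous_ofReal.tendsto _).comp (hlim x)).const_mul _

theorem abs_rpow_sub_rpow_le {p m a b : ℝ} (hp : 1 ≤ p) (ha : a ∈ Icc 0 m) (hb : b ∈ Icc 0 m) :
    |a ^ p - b ^ p| ≤ p * m ^ (p - 1) * |a - b| := by
  refine (convex_Icc 0 m).norm_image_sub_le_of_norm_hasDerivWithin_le
    (f := fun x : ℝ => x ^ p) (f' := fun x => p * x ^ (p - 1))
    (fun x _ => (Real.hasDerivAt_rpow_const (Or.inr hp)).hasDerivWithinAt) (fun x hx => ?_) hb ha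
  have := Real.rpow_le_rpow hx.1 hx.2 (by linarith : 0 ≤ p - 1)
  rw [Real.norm_eq_abs, abs_of_nonneg (mul_nonneg (by linarith) (Real.rpow_nonneg hx.1 _))]
  exact mul_le_mul_of_nonneg_left this (by linarith)

theorem abs_min_rpow_sub_le {p m a b : ℝ} (hp : 1 ≤ p) (hm : 0 ≤ m) (ha : 0 ≤ a) (hb : 0 ≤ b) :
    |min a m ^ p - min b m ^ p| ≤ p * m ^ (p - 1) * |a - b| := by
  refine (abs_rpow_sub_rpow_le hp ⟨le_min ha hm, min_le_right _ _⟩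
    ⟨le_min hb hm, min_le_right _ _⟩).trans ?_
  have h1 := abs_min_sub_min_le_max a m b m
  rw [sub_self, abs_zero, max_eq_left (abs_nonneg _)] at h1
  have := Real.rpow_nonneg hm (p - 1)
  gcongr

theorem integrable_min_rpow_mul {p m : ℝ} (hp : 1 ≤ p) (hm : 0 ≤ m) {w : Sp N → ℝ}
    (hw : MemLp w 2) (f : L2 N) :
    Integrable fun x => min ‖f x‖ m ^ p * w x := by
  refine ((integrable_norm_mul hw f).norm.const_mul (p * m ^ (p - 1))).mono' ?_
    (Eventually.of_forall fun x => ?_)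
  · exact ((((Lp.aestronglyMeasurable f).norm.aemeasurable.min aemeasurable_const).pow_const
      p).aestronglyMeasurable).mul hw.1
  · have := abs_min_rpow_sub_le (b := 0) hp hm (norm_nonneg (f x)) le_rfl
    rw [min_eq_left hm, Real.zero_rpow (by linarith), sub_zero, sub_zero] at this
    rw [norm_mul, norm_mul, ← mul_assoc]
    exact mul_le_mul_of_nonneg_right this (norm_nonneg _)

theorem continuous_integral_min_rpow {p m : ℝ} (hp : 1 ≤ p) (hm : 0 ≤ m) {w : Sp N → ℝ}
    (hw : MemLp w 2) (hw0 : ∀ x, 0 ≤ w x) :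
    Continuous fun f : L2 N => ∫ x, min ‖f x‖ m ^ p * w x := by
  refine (LipschitzWith.of_dist_le_mul (K := Real.toNNReal (p * m ^ (p - 1) * ‖hw.toLp w‖))
    fun f g => ?_).continuous
  have hmp := Real.rpow_nonneg hm (p - 1)
  rw [Real.coe_toNNReal _ (by positivity), Real.dist_eq, dist_eq_norm,
    ← integral_sub (integrable_min_rpow_mul hp hm hw f) (integrable_min_rpow_mul hp hm hw g)]
  have h1 := integral_norm_mul_le hw (f - g)
  have hi := (integrable_norm_mul hw (f - g)).const_mul (p * m ^ (p - 1))
  calc _ ≤ ∫ x, p * m ^ (p - 1) * (‖(f - g) x‖ * w x) := by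
        rw [← Real.norm_eq_abs]
        refine norm_integral_le_of_norm_le hi ?_
        filter_upwards [Lp.coeFn_sub f g] with x hx
        rw [← sub_mul, norm_mul, Real.norm_eq_abs, Real.norm_eq_abs, abs_of_nonneg (hw0 x), hx,
          Pi.sub_apply, ← mul_assoc]
        refine mul_le_mul_of_nonneg_right ?_ (hw0 x)
        refine (abs_min_rpow_sub_le hp hm (norm_nonneg _) (norm_nonneg _)).trans ?_
        have := abs_norm_sub_norm_le (f x) (g x)
        gcongr
    _ = p * m ^ (p - 1) * ∫ x, ‖(f - g) x‖ * w x := integral_const_mul _ _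
    _ ≤ p * m ^ (p - 1) * (‖f - g‖ * ‖hw.toLp w‖) := by gcongr
    _ = _ := by ring

/-- Continuity in `L²` does not by itself control a `p`-th power. Truncating `|u|` at height `n`
gives a functional that is Lipschitz on `L²`, so the truncated integrals are continuous in time;
they converge to the integral for almost every `t`. -/
theorem aestronglyMeasurable_integral_rpow {p : ℝ} (hp : 1 ≤ p) {w : Sp N → ℝ}
    (hw : MemLp w 2) (hw0 : ∀ x, 0 ≤ w x) {u : ℝ → L2 N} {S : Set ℝ} (hS : MeasurableSet S)
    (hu : ContinuousOn u S)
    (hi : ∀ᵐ t ∂(volume.restrict S), Integrable fun x => ‖u t x‖ ^ p * w x) :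
    AEStronglyMeasurable (fun t => ∫ x, ‖u t x‖ ^ p * w x) (volume.restrict S) := by
  refine aestronglyMeasurable_of_tendsto_ae atTop
    (f := fun (n : ℕ) t => ∫ x, min ‖u t x‖ n ^ p * w x) (fun n => ?_) ?_
  · exact ((continuous_integral_min_rpow hp n.cast_nonneg hw hw0).comp_continuousOn
      hu).aestronglyMeasurable hS
  · filter_upwards [hi] with t ht
    refine tendsto_integral_of_dominated_convergence _
      (fun n => (integrable_min_rpow_mul hp n.cast_nonneg hw (u t)).aestronglyMeasurable)
      ht.norm (fun n => Eventually.of_forall fun x => ?_) (Eventually.of_forall fun x => ?_)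
    · rw [norm_mul, norm_mul]
      have h0 : 0 ≤ min ‖u t x‖ (n : ℝ) := le_min (norm_nonneg _) n.cast_nonneg
      have := Real.rpow_le_rpow h0 (min_le_left _ _) (by linarith : 0 ≤ p)
      rw [Real.norm_of_nonneg (Real.rpow_nonneg h0 _),
        Real.norm_of_nonneg (Real.rpow_nonneg (norm_nonneg (u t x)) _)]
      gcongr
    · refine tendsto_const_nhds.congr' ?_
      obtain ⟨m, hm⟩ := exists_nat_ge ‖u t x‖
      filter_upwards [eventually_ge_atTop m] with n hn
      rw [min_eq_left (hm.trans (by exact_mod_cast hn))]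

theorem integrable_norm_rpow_of_eLpNorm_le {p M : ℝ} (hp : 1 ≤ p) {f : L2 N}
    (h : eLpNorm f (ENNReal.ofReal p) volume ≤ ENNReal.ofReal M) :
    Integrable (fun x => ‖f x‖ ^ p) ∧ ∫ x, ‖f x‖ ^ p ≤ max M 0 ^ p := by
  have hp0 : 0 < p := by linarith
  have hne : ENNReal.ofReal p ≠ 0 := by simpa using hp0
  have hm : MemLp f (ENNReal.ofReal p) volume :=
    ⟨Lp.aestronglyMeasurable f, h.trans_lt ENNReal.ofReal_lt_top⟩
  have h1 := hm.integrable_norm_rpow hne ENNReal.ofReal_ne_top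
  have h2 := hm.eLpNorm_eq_integral_rpow_norm hne ENNReal.ofReal_ne_top
  rw [ENNReal.toReal_ofReal hp0.le] at h1 h2
  refine ⟨h1, ?_⟩
  have h0 : 0 ≤ ∫ x, ‖f x‖ ^ p := integral_nonneg fun x => Real.rpow_nonneg (norm_nonneg _) _
  rw [h2, ENNReal.ofReal_le_ofReal_iff'] at h
  have h3 : (∫ x, ‖f x‖ ^ p) ^ p⁻¹ ≤ max M 0 := by
    rcases h with h | h
    · exact h.trans (le_max_left _ _)
    · exact h.trans (le_max_right _ _)
  have h4 := Real.rpow_le_rpow (Real.rpow_nonneg h0 _) h3 hp0.le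
  rwa [← Real.rpow_mul h0, inv_mul_cancel₀ hp0.ne', Real.rpow_one] at h4

/-- Young's inequality with the optimal constant. -/
theorem young_absorb {p x y a : ℝ} (hp : 1 < p) (hx : 0 ≤ x) (hy : 0 < y) (ha : 0 ≤ a) :
    x * a ≤ y * a ^ p
      + (p - 1) * p ^ (-p / (p - 1)) * x ^ (p / (p - 1)) * y ^ (-(1 / (p - 1))) := by
  have hp0 : 0 < p := by linarith
  have hp1 : 0 < p - 1 := by linarith
  have hc : p.HolderConjugate (p / (p - 1)) := Real.HolderConjugate.conjExponent hp
  have hpy : 0 < p * y := by positivity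
  have hpow := Real.rpow_pos_of_pos hpy (1 / p)
  -- The factor `(p y)^(1/p)` is chosen so that the first term of Young's inequality is exactly `y
  -- a^p`.
  have h := Real.young_inequality_of_nonneg (a := (p * y) ^ (1 / p) * a)
    (b := x * ((p * y) ^ (1 / p))⁻¹) (by positivity) (by positivity) hc
  have e1 : (p * y) ^ (1 / p) * a * (x * ((p * y) ^ (1 / p))⁻¹) = x * a := by
    field_simp
  have e2 : ((p * y) ^ (1 / p) * a) ^ p / p = y * a ^ p := by
    rw [Real.mul_rpow hpow.le ha, ← Real.rpow_mul hpy.le, one_div_mul_cancel hp0.ne',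
      Real.rpow_one]
    field_simp
  have e3 : (x * ((p * y) ^ (1 / p))⁻¹) ^ (p / (p - 1)) / (p / (p - 1))
      = (p - 1) * p ^ (-p / (p - 1)) * x ^ (p / (p - 1)) * y ^ (-(1 / (p - 1))) := by
    rw [← Real.rpow_neg hpy.le, Real.mul_rpow hx (Real.rpow_nonneg hpy.le _), ← Real.rpow_mul hpy.le,
      Real.mul_rpow hp0.le hy.le]
    have a1 : -(1 / p) * (p / (p - 1)) = -(1 / (p - 1)) := by field_simp
    have a2 : -p / (p - 1) = -(1 / (p - 1)) - 1 := by field_simp; ring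
    rw [a1, a2, Real.rpow_sub_one hp0.ne']
    field_simp
  rw [e1, e2, e3] at h
  exact h

/-- Jensen's inequality for the weight `w`. -/
theorem rpow_integral_mul_le {p : ℝ} (hp : 1 < p) {w a : Sp N → ℝ} (hw0 : ∀ x, 0 ≤ w x)
    (ha : ∀ x, 0 ≤ a x) (hw : Integrable w) (hW : 0 < ∫ x, w x)
    (h1 : Integrable fun x => a x * w x) (hpi : Integrable fun x => a x ^ p * w x) :
    (∫ x, a x * w x) ^ p ≤ (∫ x, w x) ^ (p - 1) * ∫ x, a x ^ p * w x := by
  set W := ∫ x, w x with hWd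
  set I := ∫ x, a x * w x with hI
  have hI0 : 0 ≤ I := integral_nonneg fun x => mul_nonneg (ha x) (hw0 x)
  have hp1 := Real.rpow_pos_of_pos hW (p - 1)
  rcases hI0.eq_or_lt with h | hIpos
  · rw [← h, Real.zero_rpow (by linarith)]
    exact mul_nonneg hp1.le (integral_nonneg fun x =>
      mul_nonneg (Real.rpow_nonneg (ha x) _) (hw0 x))
  set m := I / W with hm
  have hm0 : 0 < m := div_pos hIpos hW
  have hmp : 0 < m ^ p := Real.rpow_pos_of_pos hm0 p
  -- The tangent line of `t^p` at the mean `m` lies below the graph, by Bernoulli's inequality;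
  -- integration against `w` gives Jensen's inequality.
  have hpt : ∀ x, m ^ p * (1 - p) * w x + m ^ p * p / m * (a x * w x) ≤ a x ^ p * w x := by
    intro x
    have hb := one_add_mul_self_le_rpow_one_add (s := a x / m - 1)
      (by have := div_nonneg (ha x) hm0.le; linarith) hp.le
    rw [add_sub_cancel, Real.div_rpow (ha x) hm0.le, le_div_iff₀ hmp] at hb
    have := mul_le_mul_of_nonneg_right hb (hw0 x)
    refine le_trans (le_of_eq ?_) this
    field_simp
    ring
  have hint := integral_mono ((hw.const_mul (m ^ p * (1 - p))).add (h1.const_mul (m ^ p * p / m)))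
    hpi hpt
  simp only [Pi.add_apply] at hint
  rw [integral_add (hw.const_mul _) (h1.const_mul _), integral_const_mul, integral_const_mul] at hint
  have e : m ^ p * (1 - p) * W + m ^ p * p / m * I = m ^ p * W := by
    have : I = m * W := by rw [hm]; field_simp
    rw [this]; field_simp; ring
  have e2 : I ^ p = W ^ (p - 1) * (m ^ p * W) := by
    rw [hm, Real.div_rpow hI0 hW.le, Real.rpow_sub_one hW.ne']
    have := Real.rpow_pos_of_pos hW p
    field_simp
  rw [e2]
  refine mul_le_mul_of_nonneg_left ?_ hp1.le
  linarith

end Pairing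

/-! ### The equation tested with the scaled weight -/

/-- The scaled weight `φ(x/R)`. -/
def weight (N : ℕ) (β R : ℝ) (x : Sp N) : ℝ := phi N β (R⁻¹ • x)

/-- The scaled cutoffs of `φ`. -/
def weightCut (N : ℕ) (β R : ℝ) (n : ℕ) (x : Sp N) : ℝ := phiCut N β n (R⁻¹ • x)

section Weight

variable {N : ℕ} {β R : ℝ}

theorem weight_pos (x : Sp N) : 0 < weight N β R x := phi_pos _

theorem weight_le_one (hβ : 0 < β) (x : Sp N) : weight N β R x ≤ 1 := phi_le_one hβ _

theorem continuous_weight : Continuous (weight N β R) :=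
  continuous_phi.comp (continuous_const_smul _)

theorem integrable_weight (hβ : 0 < β) (hR : 0 < R) : Integrable (weight N β R) :=
  (integrable_phi hβ).comp_smul (inv_pos.2 hR).ne'

theorem integral_weight (hR : 0 < R) : ∫ x, weight N β R x = R ^ (N : ℝ) * A0 N β := by
  have := Measure.integral_comp_inv_smul_of_nonneg (volume : Measure (Sp N)) (phi N β) hR.le
  rw [finrank_euclideanSpace_fin, smul_eq_mul] at this
  rw [Real.rpow_natCast]
  exact this

theorem memLp_weight (hβ : 0 < β) (hR : 0 < R) : MemLp (weight N β R) 2 := by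
  rw [memLp_two_iff_integrable_sq continuous_weight.aestronglyMeasurable]
  exact ((memLp_two_iff_integrable_sq continuous_phi.aestronglyMeasurable).1
    (memLp_phi_two hβ)).comp_smul (inv_pos.2 hR).ne'

theorem memLp_of_abs_le_weight (hβ : 0 < β) (hR : 0 < R) {v : Sp N → ℝ} {C : ℝ}
    (hv : AEStronglyMeasurable v) (h : ∀ x, |v x| ≤ C * weight N β R x) : MemLp v 2 :=
  (memLp_weight hβ hR).of_le_mul hv (Eventually.of_forall fun x => by
    rw [Real.norm_eq_abs, Real.norm_of_nonneg (weight_pos x).le]; exact h x)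

theorem weightCut_nonneg (n : ℕ) (x : Sp N) : 0 ≤ weightCut N β R n x := phiCut_nonneg _ _

theorem weightCut_le (n : ℕ) (x : Sp N) : weightCut N β R n x ≤ weight N β R x := phiCut_le _ _

theorem contDiff_weightCut (n : ℕ) : ContDiff ℝ ∞ (weightCut N β R n) :=
  (contDiff_phiCut n).comp (contDiff_const_smul _)

theorem hasCompactSupport_weightCut (hR : 0 < R) (n : ℕ) :
    HasCompactSupport (weightCut N β R n) :=
  (hasCompactSupport_phiCut n).comp_smul (inv_pos.2 hR).ne'

theorem abs_weightCut_le (n : ℕ) (x : Sp N) : |weightCut N β R n x| ≤ 1 * weight N β R x := by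
  rw [abs_of_nonneg (weightCut_nonneg n x), one_mul]
  exact weightCut_le n x

theorem memLp_weightCut (hβ : 0 < β) (hR : 0 < R) (n : ℕ) : MemLp (weightCut N β R n) 2 :=
  memLp_of_abs_le_weight hβ hR (contDiff_weightCut n).continuous.aestronglyMeasurable
    (abs_weightCut_le n)

theorem isTest_mul_weightCut (hR : 0 < R) {T : ℝ} {η : ℝ → ℝ} (hη : ContDiff ℝ ∞ η)
    (hc : HasCompactSupport η) (hs : tsupport η ⊆ Ioo 0 T) (n : ℕ) :
    IsTest T fun q : ℝ × Sp N => η q.1 * weightCut N β R n q.2 := by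
  have hsub : Function.support (fun q : ℝ × Sp N => η q.1 * weightCut N β R n q.2)
      ⊆ tsupport η ×ˢ tsupport (weightCut N β R n) := fun q hq =>
    ⟨subset_tsupport _ (left_ne_zero_of_mul hq), subset_tsupport _ (right_ne_zero_of_mul hq)⟩
  have hcomp := hc.isCompact.prod (hasCompactSupport_weightCut (N := N) (β := β) hR n).isCompact
  refine ⟨(hη.comp contDiff_fst).mul ((contDiff_weightCut n).comp contDiff_snd),
    HasCompactSupport.of_support_subset_isCompact hcomp hsub, ?_⟩
  refine (closure_minimal hsub hcomp.isClosed).trans ?_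
  exact prod_mono hs (subset_univ _)

theorem fracLap_mul_comp_smul (hN : 1 ≤ N) (hβ : 0 < β) (hβ2 : β < 2) {A : ℝ} {v : Sp N → ℝ}
    (hv : IsPhiBounded β A v) (hR : 0 < R) (a : ℝ) (x : Sp N) :
    fracLap (β / 2) (fun y => a * v (R⁻¹ • y)) x
      = a * (R ^ (-β) * fracLap (β / 2) v (R⁻¹ • x)) := by
  rw [(hv.const_mul a).fracLap_comp_smul hN hβ hβ2 hR, hv.fracLap_const_mul hN hβ hβ2]
  ring

/-- The fractional Laplacian of `v(x/R)`. -/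
def scaledLap (β R : ℝ) (v : Sp N → ℝ) (x : Sp N) : ℝ :=
  R ^ (-β) * fracLap (β / 2) v (R⁻¹ • x)

theorem abs_scaledLap_le (hR : 0 < R) {C : ℝ} {v : Sp N → ℝ}
    (h : ∀ x, |fracLap (β / 2) v x| ≤ C * phi N β x) (x : Sp N) :
    |scaledLap β R v x| ≤ R ^ (-β) * C * weight N β R x := by
  have hp := Real.rpow_pos_of_pos hR (-β)
  rw [scaledLap, abs_mul, abs_of_pos hp, mul_assoc]
  exact mul_le_mul_of_nonneg_left (h _) hp.le

theorem memLp_scaledLap (hN : 1 ≤ N) (hβ : 0 < β) (hβ2 : β < 2) (hR : 0 < R) {A : ℝ}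
    {v : Sp N → ℝ} (hv : IsPhiBounded β A v) : MemLp (scaledLap β R v) 2 := by
  refine memLp_of_abs_le_weight hβ hR ?_ (abs_scaledLap_le hR (hv.abs_fracLap_le hN hβ hβ2))
  exact (((hv.measurable_fracLap hN hβ hβ2).comp_measurable
    (measurable_const_smul _)).const_mul _).aestronglyMeasurable

end Weight

/-! ### Functionals of fractional integrals with values in `L²`. -/

section Functional

variable {N : ℕ} {σ T : ℝ} {u : ℝ → L2 N}

theorem intervalIntegrable_kernel_smul (hσ : 0 < σ) (hu : ContinuousOn u (Ico 0 T)) {t : ℝ}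
    (ht : t ∈ Ico 0 T) :
    IntervalIntegrable (fun s => (t - s) ^ (σ - 1) • (u s - u 0)) volume 0 t := by
  refine (intervalIntegrable_kernel hσ t 0 t).smul_continuousOn ?_
  rw [uIcc_of_le ht.1]
  exact (hu.mono fun s hs => ⟨hs.1, hs.2.trans_lt ht.2⟩).sub continuousOn_const

/-- Bounded functionals commute with fractional integrals. -/
theorem clm_rlIntegral (hσ : 0 < σ) (hu : ContinuousOn u (Ico 0 T)) (ℓ : L2 N →L[ℝ] ℝ) {t : ℝ}
    (ht : t ∈ Ico 0 T) :
    ℓ (rlIntegral σ (fun τ => u τ - u 0) t) = rlIntegral σ (fun τ => ℓ (u τ) - ℓ (u 0)) t := by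
  rw [rlIntegral, rlIntegral, map_smul,
    ← ℓ.intervalIntegral_comp_comm (intervalIntegrable_kernel_smul hσ hu ht)]
  simp

/-- Moving the functional inside leaves a scalar fractional integral, so its Hölder estimate
suffices. -/
theorem continuousOn_clm_rlIntegral (hσ : 0 < σ) (hσ1 : σ ≤ 1) (hu : ContinuousOn u (Ico 0 T))
    (ℓ : L2 N →L[ℝ] ℝ) :
    ContinuousOn (fun t => ℓ (rlIntegral σ (fun τ => u τ - u 0) t)) (Ico 0 T) := by
  refine (continuousOn_rlIntegral hσ hσ1 fun t ht => ContinuousOn.bddOn (T := T) ?_ ht).congr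
    fun t ht => clm_rlIntegral hσ hu ℓ ht
  exact (ℓ.continuous.comp_continuousOn hu).sub continuousOn_const

theorem continuousOn_complex_clm_rlIntegral (hσ : 0 < σ) (hσ1 : σ ≤ 1)
    (hu : ContinuousOn u (Ico 0 T)) (ℓ : L2 N →L[ℂ] ℂ) :
    ContinuousOn (fun t => ℓ (rlIntegral σ (fun τ => u τ - u 0) t)) (Ico 0 T) := by
  have h1 := continuousOn_clm_rlIntegral hσ hσ1 hu (Complex.reCLM.comp (ℓ.restrictScalars ℝ))
  have h2 := continuousOn_clm_rlIntegral hσ hσ1 hu (Complex.imCLM.comp (ℓ.restrictScalars ℝ))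
  refine ((Complex.continuous_ofReal.comp_continuousOn h1).add
    ((Complex.continuous_ofReal.comp_continuousOn h2).mul continuousOn_const)).congr fun t _ =>
      (Complex.re_add_im (ℓ (rlIntegral σ (fun τ => u τ - u 0) t))).symm

theorem norm_rlIntegral_le (hσ : 0 < σ) {t : ℝ}
    (ht : 0 ≤ t) :
    ‖rlIntegral σ (fun τ => u τ - u 0) t‖ ≤ rlIntegral σ (fun τ => ‖u τ - u 0‖) t := by
  have hΓ := Real.Gamma_pos_of_pos hσ
  rw [rlIntegral, norm_smul, Real.norm_of_nonneg (inv_pos.2 hΓ).le, rlIntegral_eq]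
  refine mul_le_mul_of_nonneg_left ?_ (inv_pos.2 hΓ).le
  refine (intervalIntegral.norm_integral_le_integral_norm ht).trans_eq ?_
  refine intervalIntegral.integral_congr fun s hs => ?_
  rw [uIcc_of_le ht] at hs
  simp only [norm_smul]
  rw [Real.norm_of_nonneg (Real.rpow_nonneg (sub_nonneg.2 hs.2) _)]

/-- Dominated convergence for `∫ η g_n` with `g_n` continuous and locally bounded on `[0,T)`. -/
theorem tendsto_integral_smul {η : ℝ → ℝ} (hη : Continuous η) (hc : HasCompactSupport η)
    (hs : tsupport η ⊆ Ioo 0 T) {g : ℕ → ℝ → ℂ} {g' : ℝ → ℂ} {b : ℝ → ℝ}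
    (hg : ∀ n, ContinuousOn (g n) (Ico 0 T)) (hb : ContinuousOn b (Ico 0 T))
    (hgb : ∀ n, ∀ t ∈ Ico 0 T, ‖g n t‖ ≤ b t)
    (hlim : ∀ t ∈ Ico 0 T, Tendsto (fun n => g n t) atTop (𝓝 (g' t))) :
    Tendsto (fun n => ∫ t in Ioo 0 T, η t • g n t) atTop (𝓝 (∫ t in Ioo 0 T, η t • g' t)) := by
  refine tendsto_integral_of_dominated_convergence (fun t => ‖η t • b t‖)
    (fun n => (integrable_mul_of_tsupport hη hc hs (hg n)).integrableOn.aestronglyMeasurable)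
    (integrable_mul_of_tsupport hη hc hs hb).norm.integrableOn (fun n => ?_) ?_
  · filter_upwards [ae_restrict_mem measurableSet_Ioo] with t ht
    rw [norm_smul, norm_smul]
    exact mul_le_mul_of_nonneg_left ((hgb n t (Ioo_subset_Ico_self ht)).trans (le_abs_self _))
      (norm_nonneg _)
  · filter_upwards [ae_restrict_mem measurableSet_Ioo] with t ht
    exact (hlim t (Ioo_subset_Ico_self ht)).const_smul _

end Functional

/-! ### Passing from compactly supported test functions to the weight. -/

section Tested

variable {N : ℕ} {α β p T R ε : ℝ} {lam : ℂ} {u₀ : L2 N} {u : ℝ → L2 N}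

/-- The equation tested with `η(t) φ_n(x/R)`. -/
theorem IsDistribSolution.tested_cut (hN : 1 ≤ N) (hβ : 0 < β) (hβ2 : β < 2) (hR : 0 < R)
    (hsol : IsDistribSolution α β p lam ε u₀ T u) {A : ℝ}
    (hA : ∀ n, IsPhiBounded β A (phiCut N β n)) {η : ℝ → ℝ} (hη : ContDiff ℝ ∞ η)
    (hc : HasCompactSupport η) (hs : tsupport η ⊆ Ioo 0 T) (n : ℕ) :
    Complex.I ^ (α : ℂ) * (-∫ t in Ioo (0 : ℝ) T, deriv η t •
        pairing (memLp_weightCut hβ hR n) (rlIntegral (1 - α) (fun τ => u τ - u 0) t))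
      - ∫ t in Ioo (0 : ℝ) T, η t • pairing (memLp_scaledLap hN hβ hβ2 hR (hA n)) (u t)
      = lam * ∫ t in Ioo (0 : ℝ) T, η t •
        ((∫ x, ‖u t x‖ ^ p * weightCut N β R n x : ℝ) : ℂ) := by
  have h := hsol.eqn _ (isTest_mul_weightCut (N := N) (β := β) hR hη hc hs n)
  have e1 : ∀ t, ∫ x, (rlIntegral (1 - α) (fun τ => u τ - u 0) t) x *
      ((deriv (fun τ => η τ * weightCut N β R n x) t : ℝ) : ℂ)
      = deriv η t •
        pairing (memLp_weightCut hβ hR n) (rlIntegral (1 - α) (fun τ => u τ - u 0) t) := by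
    intro t
    rw [pairing_apply, ← integral_smul]
    congr 1
    ext x
    rw [deriv_mul_const (hη.differentiable (by simp) t), Complex.real_smul]
    push_cast
    ring
  have e2 : ∀ t, ∫ x, (u t) x *
      ((fracLap (β / 2) (fun y => η t * weightCut N β R n y) x : ℝ) : ℂ)
      = η t • pairing (memLp_scaledLap hN hβ hβ2 hR (hA n)) (u t) := by
    intro t
    rw [pairing_apply, ← integral_smul]
    congr 1
    ext x
    have := fracLap_mul_comp_smul hN hβ hβ2 (hA n) hR (η t) x
    rw [show (fun y => η t * weightCut N β R n y) = fun y => η t * phiCut N β n (R⁻¹ • y) from rfl,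
      this, Complex.real_smul, scaledLap]
    push_cast
    ring
  have e3 : ∀ t, ∫ x, ((‖(u t) x‖ ^ p * (η t * weightCut N β R n x) : ℝ) : ℂ)
      = η t • ((∫ x, ‖u t x‖ ^ p * weightCut N β R n x : ℝ) : ℂ) := by
    intro t
    rw [Complex.real_smul, ← Complex.ofReal_mul, ← integral_const_mul, ← integral_complex_ofReal]
    congr 1
    ext x
    push_cast
    ring
  simp only [e1, e2, e3] at h
  exact h

theorem norm_pairing_le_weight (hβ : 0 < β) (hR : 0 < R) {v : Sp N → ℝ} (hv : MemLp v 2) {C : ℝ}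
    (hC : 0 ≤ C) (h : ∀ x, |v x| ≤ C * weight N β R x) (f : L2 N) :
    ‖pairing hv f‖ ≤ C * (‖f‖ * ‖(memLp_weight (N := N) hβ hR).toLp (weight N β R)‖) :=
  (norm_pairing_le hv (memLp_weight hβ hR) h f).trans
    (mul_le_mul_of_nonneg_left (integral_norm_mul_le _ f) hC)

theorem MemX.integrable_rpow (hp : 1 ≤ p) (hX : MemX β p T u) :
    ∃ C : ℝ, ∀ᵐ t ∂(volume.restrict (Ioo 0 T)), Integrable (fun x => ‖u t x‖ ^ p) ∧
        ∫ x, ‖u t x‖ ^ p ≤ C := by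
  obtain ⟨M, hM⟩ := hX.bounded
  refine ⟨max M 0 ^ p, ?_⟩
  filter_upwards [hM] with t ht using integrable_norm_rpow_of_eLpNorm_le hp ht

theorem integrable_rpow_mul {f : L2 N} (hf : Integrable fun x => ‖f x‖ ^ p) {w : Sp N → ℝ}
    (hw : Continuous w) (h0 : ∀ x, 0 ≤ w x) (h1 : ∀ x, w x ≤ 1) :
    Integrable fun x => ‖f x‖ ^ p * w x :=
  hf.mul_bdd (c := 1) hw.aestronglyMeasurable (Eventually.of_forall fun x => by
    rw [Real.norm_of_nonneg (h0 x)]; exact h1 x)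

theorem tendsto_time_term (hα : 0 < α) (hα1 : α < 1) (hβ : 0 < β) (hR : 0 < R)
    (hX : MemX β p T u) {η : ℝ → ℝ} (hη : Continuous η)
    (hc : HasCompactSupport η) (hs : tsupport η ⊆ Ioo 0 T) :
    Tendsto (fun n => ∫ t in Ioo (0 : ℝ) T, η t •
        pairing (memLp_weightCut hβ hR n) (rlIntegral (1 - α) (fun τ => u τ - u 0) t)) atTop
      (𝓝 (∫ t in Ioo (0 : ℝ) T, η t •
        pairing (memLp_weight hβ hR) (rlIntegral (1 - α) (fun τ => u τ - u 0) t))) := by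
  have hσ : 0 < 1 - α := sub_pos.2 hα1
  have hσ1 : 1 - α ≤ 1 := by linarith
  refine tendsto_integral_smul hη hc hs
    (b := fun t => 1 * (rlIntegral (1 - α) (fun τ => ‖u τ - u 0‖) t *
      ‖(memLp_weight (N := N) hβ hR).toLp (weight N β R)‖))
    (fun n => continuousOn_complex_clm_rlIntegral hσ hσ1 hX.cont _) ?_ (fun n t ht => ?_)
    (fun t ht => tendsto_pairing _ _ (memLp_weight hβ hR) abs_weightCut_le
      (fun x => tendsto_phiCut _) _)
  · refine continuousOn_const.mul (ContinuousOn.mul (continuousOn_rlIntegral hσ hσ1 fun t ht =>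
      ContinuousOn.bddOn (T := T) ?_ ht) continuousOn_const)
    exact (hX.cont.sub continuousOn_const).norm
  · refine (norm_pairing_le_weight hβ hR _ zero_le_one (abs_weightCut_le n) _).trans ?_
    have := norm_rlIntegral_le (u := u) hσ ht.1
    gcongr

/-- Because `A` is the same for every `n`, the fractional Laplacians of the cutoffs share one bound
by a multiple of the weight, and this dominates both the space and the time integrals. -/
theorem tendsto_laplacian_term (hN : 1 ≤ N) (hβ : 0 < β)
    (hβ2 : β < 2) (hR : 0 < R) (hX : MemX β p T u) {A : ℝ} (hA' : IsPhiBounded β A (phi N β))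
    (hA : ∀ n, IsPhiBounded β A (phiCut N β n)) {η : ℝ → ℝ} (hη : Continuous η)
    (hc : HasCompactSupport η) (hs : tsupport η ⊆ Ioo 0 T) :
    Tendsto (fun n => ∫ t in Ioo (0 : ℝ) T, η t •
        pairing (memLp_scaledLap hN hβ hβ2 hR (hA n)) (u t)) atTop
      (𝓝 (∫ t in Ioo (0 : ℝ) T, η t • pairing (memLp_scaledLap hN hβ hβ2 hR hA') (u t))) := by
  obtain ⟨CA, hCA⟩ : ∃ C : ℝ, C = R ^ (-β) * (|fracConst N β| * (2⁻¹ * majorantMass N β * A)) :=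
    ⟨_, rfl⟩
  have hlapb : ∀ {v : Sp N → ℝ}, IsPhiBounded β A v → ∀ x,
      |scaledLap β R v x| ≤ CA * weight N β R x := fun hv x => by
    rw [hCA]
    exact abs_scaledLap_le hR (hv.abs_fracLap_le hN hβ hβ2) x
  have hCA0 : 0 ≤ CA :=
    nonneg_of_mul_nonneg_left ((abs_nonneg _).trans (hlapb hA' 0)) (weight_pos 0)
  refine tendsto_integral_smul hη hc hs
    (b := fun t => CA * (‖u t‖ * ‖(memLp_weight (N := N) hβ hR).toLp (weight N β R)‖))
    (fun n => (ContinuousLinearMap.continuous _).comp_continuousOn hX.cont)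
    (continuousOn_const.mul (hX.cont.norm.mul continuousOn_const))
    (fun n t ht => norm_pairing_le_weight hβ hR _ hCA0 (hlapb (hA n)) _)
    (fun t ht => tendsto_pairing _ _ (memLp_weight hβ hR) (fun n => hlapb (hA n)) (fun x => ?_) _)
  exact (tendsto_fracLap hN hβ hβ2 hA' hA (fun x => tendsto_phiCut x) _).const_mul _

/-- Dominated convergence in `x`, then in `t`. The bound in `L^∞(0,T; L^p)` provides the dominating
functions, valid only for almost every `t`. -/
theorem tendsto_power_term (hβ : 0 < β) (hp : 1 ≤ p) (hR : 0 < R) (hX : MemX β p T u)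
    {η : ℝ → ℝ} (hη : Continuous η) (hc : HasCompactSupport η) (hs : tsupport η ⊆ Ioo 0 T) :
    Tendsto (fun n => ∫ t in Ioo (0 : ℝ) T, η t •
        ((∫ x, ‖u t x‖ ^ p * weightCut N β R n x : ℝ) : ℂ)) atTop
      (𝓝 (∫ t in Ioo (0 : ℝ) T, η t • ((∫ x, ‖u t x‖ ^ p * weight N β R x : ℝ) : ℂ))) := by
  obtain ⟨C, hint⟩ := hX.integrable_rpow hp
  have hpn : ∀ t x, 0 ≤ ‖u t x‖ ^ p := fun t x => Real.rpow_nonneg (norm_nonneg _) _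
  have hle1 : ∀ n x, weightCut N β R n x ≤ 1 := fun n x =>
    (weightCut_le n x).trans (weight_le_one hβ x)
  have hmulint : ∀ n t, Integrable (fun x => ‖u t x‖ ^ p) →
      Integrable fun x => ‖u t x‖ ^ p * weightCut N β R n x := fun n t h =>
    integrable_rpow_mul h (contDiff_weightCut n).continuous (weightCut_nonneg n) (hle1 n)
  refine tendsto_integral_of_dominated_convergence (fun t => ‖η t • C‖)
    (fun n => ?_) (integrable_mul_of_tsupport hη hc hs
      continuousOn_const).norm.integrableOn (fun n => ?_) ?_
  · refine hη.aestronglyMeasurable.smul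
      (Complex.continuous_ofReal.comp_aestronglyMeasurable ?_)
    refine aestronglyMeasurable_integral_rpow hp (memLp_weightCut hβ hR n)
      (weightCut_nonneg n) measurableSet_Ioo (hX.cont.mono Ioo_subset_Ico_self) ?_
    filter_upwards [hint] with t ht using hmulint n t ht.1
  · filter_upwards [hint] with t ht
    rw [norm_smul, norm_smul, Complex.norm_real]
    refine mul_le_mul_of_nonneg_left ?_ (norm_nonneg _)
    rw [Real.norm_of_nonneg (integral_nonneg fun x =>
      mul_nonneg (hpn t x) (weightCut_nonneg n x))]
    refine le_trans (integral_mono (hmulint n t ht.1) ht.1 fun x => ?_)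
      (ht.2.trans (le_abs_self _))
    exact mul_le_of_le_one_right (hpn t x) (hle1 n x)
  · filter_upwards [hint] with t ht
    refine Tendsto.const_smul ((Complex.continuous_ofReal.tendsto _).comp ?_) _
    refine tendsto_integral_of_dominated_convergence _
      (fun n => (hmulint n t ht.1).aestronglyMeasurable) ht.1
      (fun n => Eventually.of_forall fun x => ?_)
      (Eventually.of_forall fun x => Tendsto.const_mul _ (tendsto_phiCut _))
    rw [Real.norm_of_nonneg (mul_nonneg (hpn t x) (weightCut_nonneg n x))]
    exact mul_le_of_le_one_right (hpn t x) (hle1 n x)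

/-- The equation tested with `η(t) φ(x/R)`. -/
theorem IsDistribSolution.tested (hN : 1 ≤ N) (hα : 0 < α) (hα1 : α < 1) (hβ : 0 < β)
    (hβ2 : β < 2) (hp : 1 < p) (hR : 0 < R) (hX : MemX β p T u)
    (hsol : IsDistribSolution α β p lam ε u₀ T u) {A : ℝ} (hA' : IsPhiBounded β A (phi N β))
    (hA : ∀ n, IsPhiBounded β A (phiCut N β n)) {η : ℝ → ℝ} (hη : ContDiff ℝ ∞ η)
    (hc : HasCompactSupport η) (hs : tsupport η ⊆ Ioo 0 T) :
    Complex.I ^ (α : ℂ) * (-∫ t in Ioo (0 : ℝ) T, deriv η t •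
        pairing (memLp_weight hβ hR) (rlIntegral (1 - α) (fun τ => u τ - u 0) t))
      - ∫ t in Ioo (0 : ℝ) T, η t • pairing (memLp_scaledLap hN hβ hβ2 hR hA') (u t)
      = lam * ∫ t in Ioo (0 : ℝ) T, η t •
        ((∫ x, ‖u t x‖ ^ p * weight N β R x : ℝ) : ℂ) := by
  have L1 := tendsto_time_term (N := N) hα hα1 hβ hR hX (hη.continuous_deriv (by simp)) hc.deriv
    (tsupport_deriv_subset'.trans hs)
  have L2' := tendsto_laplacian_term hN hβ hβ2 hR hX hA' hA hη.continuous hc hs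
  have L3 := tendsto_power_term hβ hp.le hR hX hη.continuous hc hs
  refine tendsto_nhds_unique ((L1.neg.const_mul (Complex.I ^ (α : ℂ))).sub L2')
    ((L3.const_mul lam).congr fun n => ?_)
  exact (hsol.tested_cut hN hβ hβ2 hR hA hη hc hs n).symm

end Tested

/-! ### The differential inequality for the weighted mass -/

section Mass

variable {N : ℕ} {α β p T R ε K : ℝ} {lam γ : ℂ} {u₀ : L2 N} {u : ℝ → L2 N}

/-- The functional `z ↦ Re (c z)`. -/
def reMul (c : ℂ) : ℂ →L[ℝ] ℝ := Complex.reCLM.comp (ContinuousLinearMap.mul ℝ ℂ c)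

theorem reMul_apply (c z : ℂ) : reMul c z = (c * z).re := rfl

/-- The weighted mass `Re (i^α γ ∫ f φ(x/R) dx)`, as a functional on `L²`. -/
def massFunctional (N : ℕ) (α : ℝ) (γ : ℂ) (hβ : 0 < β) (hR : 0 < R) : L2 N →L[ℝ] ℝ :=
  (reMul (Complex.I ^ (α : ℂ) * γ)).comp ((pairing (memLp_weight hβ hR)).restrictScalars ℝ)

theorem massFunctional_apply (hβ : 0 < β) (hR : 0 < R) (f : L2 N) :
    massFunctional N α γ hβ hR f = initMass α β γ f R := by
  change (Complex.I ^ (α : ℂ) * γ * pairing (memLp_weight hβ hR) f).re = _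
  rw [pairing_apply]
  rfl

/-- The right-hand side of the equation for the weighted mass. -/
def massRhs (p : ℝ) (lam γ : ℂ) (β R : ℝ) {v : Sp N → ℝ} (hv : MemLp v 2)
    (f : L2 N) : ℝ :=
  (γ * pairing hv f).re + (γ * lam).re * ∫ x, ‖f x‖ ^ p * weight N β R x

theorem integrable_rpow_mul_weight (hβ : 0 < β) {f : L2 N} (hf : Integrable fun x => ‖f x‖ ^ p) :
    Integrable fun x => ‖f x‖ ^ p * weight N β R x :=
  integrable_rpow_mul hf continuous_weight (fun x => (weight_pos x).le) (weight_le_one hβ)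

theorem MemX.bddOn_massRhs (hβ : 0 < β) (hp : 1 ≤ p) (hR : 0 < R) (hX : MemX β p T u)
    {v : Sp N → ℝ} (hv : MemLp v 2) {t : ℝ} (ht : t < T) :
    ∃ M, BddOn (fun s => massRhs p lam γ β R hv (u s)) t M := by
  have hsub : Ioc 0 t ⊆ Ioo 0 T := fun s hs => ⟨hs.1, hs.2.trans_lt ht⟩
  have hcL : ContinuousOn (fun s => (γ * pairing hv (u s)).re) (Ico 0 T) :=
    Complex.continuous_re.comp_continuousOn
      (continuousOn_const.mul ((pairing hv).continuous.comp_continuousOn hX.cont))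
  obtain ⟨M₁, h1⟩ := ContinuousOn.bddOn hcL ht
  obtain ⟨C, hint⟩ := hX.integrable_rpow hp
  have hpn : ∀ t x, 0 ≤ ‖u t x‖ ^ p := fun t x => Real.rpow_nonneg (norm_nonneg _) _
  have hmeas := aestronglyMeasurable_integral_rpow hp (memLp_weight (N := N) hβ hR)
    (fun x => (weight_pos x).le) measurableSet_Ioo (hX.cont.mono Ioo_subset_Ico_self) (by
      filter_upwards [hint] with t ht using integrable_rpow_mul_weight hβ ht.1)
  refine ⟨M₁ + |(γ * lam).re| * C, h1.meas.add ((hmeas.mono_set hsub).const_mul _), ?_⟩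
  filter_upwards [h1.bound, ae_restrict_of_ae_restrict_of_subset hsub hint] with s hs hs'
  refine (norm_add_le _ _).trans (add_le_add hs ?_)
  rw [norm_mul, Real.norm_eq_abs]
  refine mul_le_mul_of_nonneg_left ?_ (abs_nonneg _)
  rw [Real.norm_of_nonneg (integral_nonneg fun x => mul_nonneg (hpn s x) (weight_pos x).le)]
  refine (integral_mono (integrable_rpow_mul_weight hβ hs'.1) hs'.1 fun x => ?_).trans hs'.2
  exact mul_le_of_le_one_right (hpn s x) (weight_le_one hβ x)

/-- The weak equation for the weighted mass. -/
theorem IsDistribSolution.weak_mass (hN : 1 ≤ N) (hα : 0 < α) (hα1 : α < 1) (hβ : 0 < β)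
    (hβ2 : β < 2) (hp : 1 < p) (hR : 0 < R) (hX : MemX β p T u)
    (hsol : IsDistribSolution α β p lam ε u₀ T u) {A : ℝ} (hA' : IsPhiBounded β A (phi N β))
    (hA : ∀ n, IsPhiBounded β A (phiCut N β n)) {η : ℝ → ℝ} (hη : ContDiff ℝ ∞ η)
    (hc : HasCompactSupport η) (hs : tsupport η ⊆ Ioo 0 T) :
    -∫ t in Ioo 0 T, deriv η t *
        massFunctional N α γ hβ hR (rlIntegral (1 - α) (fun τ => u τ - u 0) t)
      = ∫ t in Ioo 0 T, η t *
        massRhs p lam γ β R (memLp_scaledLap hN hβ hβ2 hR hA') (u t) := by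
  have h := congrArg (fun z => (γ * z).re) (hsol.tested hN hα hα1 hβ hβ2 hp hR hX hA' hA hη hc hs)
  have hσ : 0 < 1 - α := sub_pos.2 hα1
  have hdc : Continuous (deriv η) := hη.continuous_deriv (by simp)
  have i1 := (integrable_mul_of_tsupport hdc hc.deriv (tsupport_deriv_subset'.trans hs)
    (continuousOn_complex_clm_rlIntegral hσ (by linarith) hX.cont
      (pairing (memLp_weight (N := N) hβ hR)))).integrableOn (s := Ioo 0 T)
  have hcL : ContinuousOn (fun t => pairing (memLp_scaledLap hN hβ hβ2 hR hA') (u t)) (Ico 0 T) :=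
    (ContinuousLinearMap.continuous _).comp_continuousOn hX.cont
  have i2 := (integrable_mul_of_tsupport hη.continuous hc hs hcL).integrableOn (s := Ioo 0 T)
  have e1 := (reMul (Complex.I ^ (α : ℂ) * γ)).integral_comp_comm i1
  have e2 := (reMul γ).integral_comp_comm i2
  simp only [map_smul, smul_eq_mul] at e1 e2
  have e3 : ∫ t in Ioo (0 : ℝ) T, η t • ((∫ x, ‖u t x‖ ^ p * weight N β R x : ℝ) : ℂ)
      = ((∫ t in Ioo (0 : ℝ) T, η t * ∫ x, ‖u t x‖ ^ p * weight N β R x : ℝ) : ℂ) := by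
    rw [← integral_complex_ofReal]
    congr 1
    ext t
    rw [Complex.real_smul]
    push_cast
    rfl
  rw [e3] at h
  have i3 : IntegrableOn (fun t => η t * ∫ x, ‖u t x‖ ^ p * weight N β R x) (Ioo 0 T) := by
    obtain ⟨C, hint⟩ := hX.integrable_rpow hp.le
    have hpn : ∀ t x, 0 ≤ ‖u t x‖ ^ p := fun t x => Real.rpow_nonneg (norm_nonneg _) _
    have hmeas := aestronglyMeasurable_integral_rpow hp.le (memLp_weight (N := N) hβ hR)
      (fun x => (weight_pos x).le) measurableSet_Ioo (hX.cont.mono Ioo_subset_Ico_self) (by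
        filter_upwards [hint] with t ht using integrable_rpow_mul_weight hβ ht.1)
    refine ((hη.continuous.integrable_of_hasCompactSupport hc).integrableOn).mul_bdd hmeas
      (c := C) ?_
    filter_upwards [hint] with s hs'
    rw [Real.norm_of_nonneg (integral_nonneg fun x => mul_nonneg (hpn s x) (weight_pos x).le)]
    refine (integral_mono (integrable_rpow_mul_weight hβ hs'.1) hs'.1 fun x => ?_).trans hs'.2
    exact mul_le_of_le_one_right (hpn s x) (weight_le_one hβ x)
  have i2' : IntegrableOn (fun t => η t *
      reMul γ (pairing (memLp_scaledLap hN hβ hβ2 hR hA') (u t))) (Ioo 0 T) := by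
    have := (reMul γ).integrable_comp i2
    simp only [map_smul, smul_eq_mul] at this
    exact this
  have e4 : ∫ t in Ioo 0 T, η t *
        massRhs p lam γ β R (memLp_scaledLap hN hβ hβ2 hR hA') (u t)
      = (∫ t in Ioo 0 T, η t * reMul γ (pairing (memLp_scaledLap hN hβ hβ2 hR hA') (u t)))
        + (γ * lam).re * ∫ t in Ioo 0 T, η t * ∫ x, ‖u t x‖ ^ p * weight N β R x := by
    rw [← integral_const_mul, ← integral_add i2' (i3.const_mul _)]
    congr 1
    ext t
    rw [massRhs, reMul_apply]
    ring
  have e5 : ∫ t in Ioo 0 T, deriv η t *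
        massFunctional N α γ hβ hR (rlIntegral (1 - α) (fun τ => u τ - u 0) t)
      = ∫ t in Ioo 0 T, deriv η t * reMul (Complex.I ^ (α : ℂ) * γ)
        (pairing (memLp_weight hβ hR) (rlIntegral (1 - α) (fun τ => u τ - u 0) t)) := rfl
  rw [e4, e5, e1, e2, reMul_apply, reMul_apply]
  -- The equation is multiplied by `γ`, its real part taken, and the Laplacian term moved to the
  -- right-hand side.
  have h2 : ∀ (a b c : ℂ) (r : ℝ), (γ * (a * -b - c)).re = (γ * (lam * (r : ℂ))).re →
      -(a * γ * b).re = (γ * c).re + (γ * lam).re * r := by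
    intro a b c r h
    have x1 : γ * (a * -b - c) = -(a * γ * b) - γ * c := by ring
    have x2 : γ * (lam * (r : ℂ)) = (r : ℂ) * (γ * lam) := by ring
    rw [x1, x2, Complex.sub_re, Complex.neg_re, Complex.re_ofReal_mul] at h
    linarith
  exact h2 _ _ _ _ h

theorem norm_I_cpow (α : ℝ) : ‖Complex.I ^ (α : ℂ)‖ = 1 := by
  rw [Complex.norm_cpow_of_ne_zero Complex.I_ne_zero]
  simp

theorem norm_pos_of_re_mul_pos (hγ : 0 < (γ * lam).re) : 0 < ‖γ‖ := by
  rw [norm_pos_iff]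
  rintro rfl
  simp at hγ

theorem cHalf_pos (hp : 1 < p) : 0 < cHalf p := by
  have : 0 < p - 1 := by linarith
  have := Real.rpow_pos_of_pos (show 0 < p by linarith) (-p / (p - 1))
  rw [cHalf]
  positivity

theorem cC_pos (hβ : 0 < β) (hp : 1 < p) (hγ : 0 < (γ * lam).re) (hK : 0 < K) :
    0 < cC N p β lam γ K := by
  have h1 := Real.rpow_pos_of_pos (norm_pos_of_re_mul_pos hγ) (p ^ 2 / (p - 1))
  have h2 := Real.rpow_pos_of_pos hγ (-p / (p - 1))
  have h3 := Real.rpow_pos_of_pos (A0_pos (N := N) hβ) p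
  have h4 := Real.rpow_pos_of_pos hK (p / (p - 1))
  have h5 := cHalf_pos hp
  exact Real.rpow_pos_of_pos (by positivity) _

theorem cD_pos (hβ : 0 < β) (hγ : 0 < (γ * lam).re) : 0 < cD N p β lam γ := by
  have h1 := Real.rpow_pos_of_pos (norm_pos_of_re_mul_pos hγ) (-p)
  have h3 := Real.rpow_pos_of_pos (A0_pos (N := N) hβ) (-(p - 1))
  rw [cD]
  positivity

/-- The identity that relates the constants `C` and `D` to Young's inequality. -/
theorem young_constant_eq (hβ : 0 < β) (hp : 1 < p) (hγ : 0 < (γ * lam).re) (hK : 0 < K)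
    (hR : 0 < R) :
    (p - 1) * p ^ (-p / (p - 1)) * (‖γ‖ * (R ^ (-β) * K)) ^ (p / (p - 1))
        * (2⁻¹ * (γ * lam).re) ^ (-(1 / (p - 1))) * (R ^ (N : ℝ) * A0 N β)
      = cD N p β lam γ * R ^ (-(N : ℝ) * (p - 1))
        * (cC N p β lam γ K * R ^ ((N : ℝ) - β / (p - 1))) ^ p := by
  have hp0 : 0 < p := by linarith
  have hp1 : 0 < p - 1 := by linarith
  have hA := A0_pos (N := N) hβ
  have hg := norm_pos_of_re_mul_pos hγ
  rw [cC, cD, cHalf]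
  obtain ⟨P, hP⟩ : ∃ P, P = (p - 1) * p ^ (-p / (p - 1)) := ⟨_, rfl⟩
  rw [← hP]
  have hP0 : 0 < P := by
    rw [hP]; exact mul_pos hp1 (Real.rpow_pos_of_pos hp0 _)
  -- Writing every positive factor as an exponential reduces the identity to one between exponents.
  obtain ⟨a, ha⟩ : ∃ a, A0 N β = Real.exp a := ⟨_, (Real.exp_log hA).symm⟩
  obtain ⟨g, hg'⟩ : ∃ a, ‖γ‖ = Real.exp a := ⟨_, (Real.exp_log hg).symm⟩
  obtain ⟨m, hm⟩ : ∃ a, (γ * lam).re = Real.exp a := ⟨_, (Real.exp_log hγ).symm⟩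
  obtain ⟨k, rfl⟩ : ∃ a, K = Real.exp a := ⟨_, (Real.exp_log hK).symm⟩
  obtain ⟨r, rfl⟩ : ∃ a, R = Real.exp a := ⟨_, (Real.exp_log hR).symm⟩
  obtain ⟨q, rfl⟩ : ∃ a, P = Real.exp a := ⟨_, (Real.exp_log hP0).symm⟩
  obtain ⟨w, hw⟩ : ∃ a, (2 : ℝ) = Real.exp a := ⟨_, (Real.exp_log two_pos).symm⟩
  rw [ha, hg', hm, hw]
  simp only [← Real.exp_mul, ← Real.exp_add, ← Real.exp_neg]
  congr 1
  field_simp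
  ring

/-- Half of the power term absorbs the fractional Laplacian through Young's inequality, with
remainder `Y ∫ φ(·/R)`. The other half dominates `|M|^p` through Jensen's inequality. `C` and `D`
are defined so that the remainder is exactly the term subtracted on the left. -/
theorem le_massRhs (hβ : 0 < β) (hp : 1 < p) (hγ : 0 < (γ * lam).re)
    (hR : 0 < R) (hK : IsFracLapBound N β K) (hv : MemLp (scaledLap β R (phi N β)) 2) {f : L2 N}
    (hf : Integrable fun x => ‖f x‖ ^ p) :
    cD N p β lam γ * R ^ (-(N : ℝ) * (p - 1)) * (|massFunctional N α γ hβ hR f| ^ p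
        - (cC N p β lam γ K * R ^ ((N : ℝ) - β / (p - 1))) ^ p)
      ≤ massRhs p lam γ β R hv f := by
  have hp0 : 0 < p := by linarith
  have hp1 : 0 < p - 1 := by linarith
  have hA := A0_pos (N := N) hβ
  have hg := norm_pos_of_re_mul_pos hγ
  have hRp := Real.rpow_pos_of_pos hR (-β)
  have hw := memLp_weight (N := N) hβ hR
  have hwi := integrable_weight (N := N) hβ hR
  have hW : 0 < ∫ x, weight N β R x := by
    rw [integral_weight hR]
    exact mul_pos (Real.rpow_pos_of_pos hR _) hA
  have hi1 := integrable_norm_mul hw f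
  have hip := integrable_rpow_mul_weight (R := R) hβ hf
  set I1 := ∫ x, ‖f x‖ * weight N β R x with hI1
  set Ip := ∫ x, ‖f x‖ ^ p * weight N β R x with hIp
  have hI10 : 0 ≤ I1 := integral_nonneg fun x => mul_nonneg (norm_nonneg _) (weight_pos x).le
  obtain ⟨x, hx⟩ : ∃ x, x = ‖γ‖ * (R ^ (-β) * K) := ⟨_, rfl⟩
  -- This split into equal halves is the source of the `2` in `C_{1/2}` and of the `1/2` in `D`.
  obtain ⟨y, hy⟩ : ∃ y, y = 2⁻¹ * (γ * lam).re := ⟨_, rfl⟩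
  have hx0 : 0 ≤ x := by rw [hx]; have := hK.1; positivity
  have hy0 : 0 < y := by rw [hy]; positivity
  obtain ⟨Y, hY⟩ : ∃ Y, Y = (p - 1) * p ^ (-p / (p - 1)) * x ^ (p / (p - 1))
    * y ^ (-(1 / (p - 1))) := ⟨_, rfl⟩
  have h1 : -(x * I1) ≤ (γ * pairing hv f).re := by
    have := Complex.abs_re_le_norm (γ * pairing hv f)
    have h2 := norm_pairing_le hv hw (abs_scaledLap_le hR hK.2) f
    rw [norm_mul] at this
    have h3 := mul_le_mul_of_nonneg_left h2 hg.le
    have h4 := neg_abs_le (γ * pairing hv f).re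
    rw [hx, mul_assoc]
    linarith
  have h2 : x * I1 ≤ y * Ip + Y * ∫ x, weight N β R x := by
    rw [hI1, hIp, ← integral_const_mul, ← integral_const_mul, ← integral_const_mul,
      ← integral_add (hip.const_mul y) (hwi.const_mul Y)]
    refine integral_mono (hi1.const_mul x) ((hip.const_mul y).add (hwi.const_mul Y)) fun z => ?_
    have := mul_le_mul_of_nonneg_right (young_absorb hp hx0 hy0 (norm_nonneg (f z)))
      (weight_pos (β := β) (R := R) z).le
    rw [← hY] at this
    simp only
    linarith
  have h3 : |massFunctional N α γ hβ hR f| ≤ ‖γ‖ * I1 := by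
    have h4 := norm_pairing_le hw hw (C := 1)
      (fun x => by rw [one_mul, abs_of_pos (weight_pos x)]) f
    refine (Complex.abs_re_le_norm (Complex.I ^ (α : ℂ) * γ * pairing hw f)).trans ?_
    rw [norm_mul, norm_mul, norm_I_cpow, one_mul]
    rw [one_mul] at h4
    exact mul_le_mul_of_nonneg_left h4 hg.le
  have h4 := rpow_integral_mul_le hp (fun x => (weight_pos x).le) (fun x => norm_nonneg (f x))
    hwi hW hi1 hip
  rw [← hI1, ← hIp] at h4
  have h5 : cD N p β lam γ * R ^ (-(N : ℝ) * (p - 1)) * |massFunctional N α γ hβ hR f| ^ p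
      ≤ y * Ip := by
    have hB : 0 < cD N p β lam γ * R ^ (-(N : ℝ) * (p - 1)) :=
      mul_pos (cD_pos hβ hγ) (Real.rpow_pos_of_pos hR _)
    have h6 := Real.rpow_le_rpow (abs_nonneg _) h3 hp0.le
    rw [Real.mul_rpow hg.le hI10] at h6
    have hgp := Real.rpow_pos_of_pos hg p
    calc _ ≤ cD N p β lam γ * R ^ (-(N : ℝ) * (p - 1)) * (‖γ‖ ^ p *
          ((∫ x, weight N β R x) ^ (p - 1) * Ip)) := by
          refine mul_le_mul_of_nonneg_left (h6.trans ?_) hB.le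
          exact mul_le_mul_of_nonneg_left h4 hgp.le
      _ = y * Ip := by
          have hRN := Real.rpow_pos_of_pos hR (N : ℝ)
          have hRNp := Real.rpow_pos_of_pos hRN (p - 1)
          have hAp := Real.rpow_pos_of_pos hA (p - 1)
          rw [integral_weight hR, Real.mul_rpow hRN.le hA.le, cD, hy, Real.rpow_neg hg.le,
            Real.rpow_neg hA.le, neg_mul, Real.rpow_neg hR.le, Real.rpow_mul hR.le]
          field_simp
  have h6 := young_constant_eq (N := N) (lam := lam) hβ hp hγ hK.1 hR
  rw [← hx, ← hy, ← hY, ← integral_weight hR] at h6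
  rw [mul_sub, ← h6, massRhs]
  have h7 : (γ * lam).re * Ip = y * Ip + y * Ip := by rw [hy]; ring
  rw [← hIp, h7]
  linarith

/-- The weighted mass of a distributional solution gives a supersolution of the fractional
differential equation. -/
theorem IsDistribSolution.isSupersolution (hN : 1 ≤ N) (hα : 0 < α) (hα1 : α < 1) (hβ : 0 < β)
    (hβ2 : β < 2) (hp : 1 < p) (hγ : 0 < (γ * lam).re) (hR : 0 < R) (hK : IsFracLapBound N β K)
    (hX : MemX β p T u) (hsol : IsDistribSolution α β p lam ε u₀ T u)
    (h0 : cC N p β lam γ K * R ^ ((N : ℝ) - β / (p - 1)) < initMass α β γ ((ε : ℂ) • u₀) R) :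
    IsSupersolution α p (cD N p β lam γ * R ^ (-(N : ℝ) * (p - 1)))
      (initMass α β γ ((ε : ℂ) • u₀) R - cC N p β lam γ K * R ^ ((N : ℝ) - β / (p - 1))) T
      fun t => massFunctional N α γ hβ hR (u t)
        - cC N p β lam γ K * R ^ ((N : ℝ) - β / (p - 1)) := by
  obtain ⟨A, hA', hA⟩ := exists_isPhiBounded (N := N) hβ
  have hσ : 0 < 1 - α := sub_pos.2 hα1
  have hσ1 : 1 - α ≤ 1 := by linarith
  have hv := memLp_scaledLap hN hβ hβ2 hR hA'
  set ℓ := massFunctional N α γ hβ hR with hℓ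
  have hinit : initMass α β γ ((ε : ℂ) • u₀) R = ℓ (u 0) := by
    rw [hℓ, massFunctional_apply, hsol.initial]
  have hB : 0 < cD N p β lam γ * R ^ (-(N : ℝ) * (p - 1)) :=
    mul_pos (cD_pos hβ hγ) (Real.rpow_pos_of_pos hR _)
  have hc : 0 ≤ cC N p β lam γ K * R ^ ((N : ℝ) - β / (p - 1)) :=
    (mul_pos (cC_pos hβ hp hγ hK.1) (Real.rpow_pos_of_pos hR _)).le
  rw [hinit] at h0 ⊢
  have hMc : ContinuousOn (fun t => ℓ (u t)) (Ico 0 T) := ℓ.continuous.comp_continuousOn hX.cont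
  have hFb : ∀ t < T, ∃ M, BddOn (fun s => massRhs p lam γ β R hv (u s)) t M :=
    fun t ht => hX.bddOn_massRhs hβ hp.le hR hv ht
  -- The distributional equation becomes an identity for every `t`: `I^(1-α) (M - M(0))` is the
  -- primitive of the bounded right-hand side.
  have hprim := eq_primitive_of_weak_deriv
    (continuousOn_clm_rlIntegral hσ hσ1 hX.cont ℓ) (by simp [rlIntegral_zero_right]) hFb
    (fun η hη hc hs => hsol.weak_mass hN hα hα1 hβ hβ2 hp hR hX hA' hA hη hc hs)
  refine isSupersolution_sub_const (M := fun t => ℓ (u t)) hα hp hB hc hMc h0 fun t ht => ?_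
  have := rlIntegral_le_of_primitive hα hα1 (h := fun t => ℓ (u t) - ℓ (u 0))
    (f := fun s => cD N p β lam γ * R ^ (-(N : ℝ) * (p - 1)) * (|ℓ (u s)| ^ p
        - (cC N p β lam γ K * R ^ ((N : ℝ) - β / (p - 1))) ^ p))
    (hMc.sub continuousOn_const) hFb
    (continuousOn_const.mul ((hMc.abs.rpow_const fun _ _ => Or.inr (by linarith)).sub
      continuousOn_const)) (fun r hr => ?_) (fun r hr => ?_) t ht
  · linarith
  · obtain ⟨C, hint⟩ := hX.integrable_rpow hp.le
    filter_upwards [ae_restrict_of_ae_restrict_of_subset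
      (show Ioc 0 r ⊆ Ioo 0 T from fun s hs => ⟨hs.1, hs.2.trans_lt hr⟩) hint] with s hs
    exact le_massRhs hβ hp hγ hR hK hv hs.1
  · rw [← hprim r hr, clm_rlIntegral hσ hX.cont ℓ hr]

end Mass

/-! ### Large initial data with a singularity at the origin -/

section Initial

variable {N : ℕ} {α β p R ε k : ℝ} {lam γ : ℂ} {u₀ : L2 N}

theorem omega_pos (hN : 1 ≤ N) : 0 < omega N := by
  have h1 : (0 : ℝ) < N := by exact_mod_cast hN
  refine mul_pos h1 (ENNReal.toReal_pos ?_ ?_)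
  · exact (Metric.measure_ball_pos volume _ one_pos).ne'
  · exact measure_ball_lt_top.ne

theorem I2_pos (hN : 1 ≤ N) (hkN : k < N) : 0 < I2 N β k := by
  have := omega_pos hN
  have : 0 < (N : ℝ) - k := sub_pos.2 hkN
  rw [I2]
  positivity

theorem weight_ge (hβ : 0 < β) (hR : 0 < R) {x : Sp N} (hx : ‖x‖ ≤ R) :
    (2 : ℝ) ^ (-((N : ℝ) + β) / 2) ≤ weight N β R x := by
  have hN0 : (0 : ℝ) ≤ N := N.cast_nonneg
  refine Real.rpow_le_rpow_of_nonpos (one_add_norm_sq_pos _) ?_ (by linarith)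
  have : ‖R⁻¹ • x‖ ≤ 1 := by
    rw [norm_smul, Real.norm_of_nonneg (inv_pos.2 hR).le, inv_mul_le_iff₀ hR, mul_one]
    exact hx
  nlinarith [norm_nonneg (R⁻¹ • x)]

theorem initMass_smul (hβ : 0 < β) (hR : 0 < R) (ε : ℝ) (f : L2 N) :
    initMass α β γ ((ε : ℂ) • f) R = ε * initMass α β γ f R := by
  rw [← massFunctional_apply hβ hR, ← massFunctional_apply hβ hR]
  change (Complex.I ^ (α : ℂ) * γ * pairing (memLp_weight hβ hR) ((ε : ℂ) • f)).re
    = ε * (Complex.I ^ (α : ℂ) * γ * pairing (memLp_weight hβ hR) f).re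
  rw [map_smul, smul_eq_mul, mul_left_comm, Complex.re_ofReal_mul]

/-- Keep only the ball of radius `R ≤ 1`, where the lower bound `|x|^(-k)` is available and the
weight is at least `2^(-(N+β)/2)`. The inequality is strict because `I₂` uses the smaller factor
`2^(-N-β)`. -/
theorem initMass_ge (hN : 1 ≤ N) (hβ : 0 < β) (hR : 0 < R) (hR1 : R ≤ 1) (hkN : k < N)
    (hlow : ∀ᵐ x : Sp N,
      (if ‖x‖ ≤ 1 then ‖x‖ ^ (-k) else 0) ≤ (Complex.I ^ (α : ℂ) * γ * u₀ x).re) :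
    I2 N β k * R ^ ((N : ℝ) - k) < initMass α β γ u₀ R := by
  have hw := memLp_weight (N := N) hβ hR
  have hi := integrable_mul_weight hw u₀
  have hNk : 0 < (N : ℝ) + -k := by linarith
  have e1 : initMass α β γ u₀ R = ∫ x, (Complex.I ^ (α : ℂ) * γ * u₀ x).re * weight N β R x := by
    have h1 := (reMul (Complex.I ^ (α : ℂ) * γ)).integral_comp_comm hi
    change reMul (Complex.I ^ (α : ℂ) * γ) (∫ x, u₀ x * ((weight N β R x : ℝ) : ℂ)) = _
    rw [← h1]
    congr 1
    ext x
    rw [reMul_apply, ← mul_assoc, Complex.re_mul_ofReal]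
  have hi' : Integrable fun x => (Complex.I ^ (α : ℂ) * γ * u₀ x).re * weight N β R x := by
    refine ((reMul (Complex.I ^ (α : ℂ) * γ)).integrable_comp hi).congr
      (Eventually.of_forall fun x => ?_)
    simp only
    rw [reMul_apply, ← mul_assoc, Complex.re_mul_ofReal]
  set m : ℝ := (2 : ℝ) ^ (-((N : ℝ) + β) / 2) with hm
  have hm0 : 0 < m := by positivity
  have hball : MeasurableSet (Metric.closedBall (0 : Sp N) R) :=
    Metric.isClosed_closedBall.measurableSet
  have hint := (integrableOn_norm_rpow (N := N) hN hNk hR.le).const_mul m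
  have h2 : ∫ x in Metric.closedBall (0 : Sp N) R, m * ‖x‖ ^ (-k)
      ≤ ∫ x, (Complex.I ^ (α : ℂ) * γ * u₀ x).re * weight N β R x := by
    rw [← integral_indicator hball]
    refine integral_mono_ae ((integrable_indicator_iff hball).2 hint) hi' ?_
    filter_upwards [hlow] with x hx
    have hwx := weight_pos (β := β) (R := R) x
    by_cases h : x ∈ Metric.closedBall (0 : Sp N) R
    · rw [indicator_of_mem h]
      rw [mem_closedBall_zero_iff] at h
      rw [if_pos (h.trans hR1)] at hx
      rw [mul_comm]
      have := Real.rpow_nonneg (norm_nonneg x) (-k)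
      exact mul_le_mul hx (weight_ge hβ hR h) hm0.le (this.trans hx)
    · rw [indicator_of_notMem h]
      refine mul_nonneg (le_trans ?_ hx) hwx.le
      split_ifs
      · exact Real.rpow_nonneg (norm_nonneg x) _
      · exact le_rfl
  rw [integral_const_mul, integral_norm_rpow hN hNk hR.le] at h2
  rw [e1]
  refine lt_of_lt_of_le ?_ h2
  have hRp := Real.rpow_pos_of_pos hR ((N : ℝ) - k)
  have hω := omega_pos hN
  have hlt : (2 : ℝ) ^ (-(N : ℝ) - β) < m := by
    have : (0 : ℝ) < N := by exact_mod_cast hN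
    exact Real.rpow_lt_rpow_of_exponent_lt one_lt_two (by linarith)
  have hk' : 0 < (N : ℝ) - k := by linarith
  rw [I2, ← sub_eq_add_neg]
  calc _ = (2 : ℝ) ^ (-(N : ℝ) - β) * (omega N * (R ^ ((N : ℝ) - k) / ((N : ℝ) - k))) := by
        field_simp
    _ < _ := by gcongr

/-- The choice of the scale balances the mass against the constant `C`. -/
theorem scale_balance {C I b c : ℝ} (hC : 0 < C) (hI : 0 < I) (hε : 0 < ε) (hbc : 0 < b - c) :
    ε * (I * ((2 * C / (ε * I)) ^ (1 / (b - c))) ^ ((N : ℝ) - c))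
      = 2 * (C * ((2 * C / (ε * I)) ^ (1 / (b - c))) ^ ((N : ℝ) - b)) := by
  set R := (2 * C / (ε * I)) ^ (1 / (b - c)) with hR
  have hq : 0 < 2 * C / (ε * I) := by positivity
  have hR0 : 0 < R := Real.rpow_pos_of_pos hq _
  have h1 : R ^ (b - c) = 2 * C / (ε * I) := by
    rw [hR, ← Real.rpow_mul hq.le, one_div_mul_cancel hbc.ne', Real.rpow_one]
  have h2 : (N : ℝ) - c = (N - b) + (b - c) := by ring
  rw [h2, Real.rpow_add hR0, h1]
  field_simp

/-- The upper bound of the blow-up time at the balancing scale. -/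
theorem time_bound_eq {C D I G : ℝ} (hα : 0 < α) (hβ : 0 < β) (hp : 1 < p) (hε : 0 < ε)
    (hC : 0 < C) (hD : 0 < D) (hI : 0 < I) (hG : 0 < G) (hκ : 0 < kappa0 p β k) :
    (((2 * C / (ε * I)) ^ (1 / (β / (p - 1) - k))) ^ ((N : ℝ) * (p - 1)) * G /
        ((p - 1) * D * (C * ((2 * C / (ε * I)) ^ (1 / (β / (p - 1) - k))) ^
          ((N : ℝ) - β / (p - 1))) ^ (p - 1))) ^ (1 / α)
      = (p - 1) ^ (-1 / α) * D ^ (-1 / α) * G ^ (1 / α) * (2 : ℝ) ^ (1 / (α * kappa0 p β k))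
        * C ^ (k * (p - 1) / (α * β * kappa0 p β k)) * I ^ (-1 / (α * kappa0 p β k))
        * ε ^ (-1 / (α * kappa0 p β k)) := by
  have hp1 : 0 < p - 1 := by linarith
  obtain ⟨κ, hκd⟩ : ∃ κ, κ = kappa0 p β k := ⟨_, rfl⟩
  rw [← hκd] at hκ ⊢
  have hk : k = β * (1 / (p - 1) - κ) := by
    rw [hκd, kappa0]; field_simp; ring
  have hb : β / (p - 1) - k = β * κ := by rw [hk]; field_simp; ring
  rw [hb]
  obtain ⟨P, hP⟩ : ∃ a, p - 1 = Real.exp a := ⟨_, (Real.exp_log hp1).symm⟩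
  obtain ⟨c, rfl⟩ : ∃ a, C = Real.exp a := ⟨_, (Real.exp_log hC).symm⟩
  obtain ⟨d, rfl⟩ : ∃ a, D = Real.exp a := ⟨_, (Real.exp_log hD).symm⟩
  obtain ⟨i, rfl⟩ : ∃ a, I = Real.exp a := ⟨_, (Real.exp_log hI).symm⟩
  obtain ⟨g, rfl⟩ : ∃ a, G = Real.exp a := ⟨_, (Real.exp_log hG).symm⟩
  obtain ⟨e, rfl⟩ : ∃ a, ε = Real.exp a := ⟨_, (Real.exp_log hε).symm⟩
  obtain ⟨w, hw⟩ : ∃ a, (2 : ℝ) = Real.exp a := ⟨_, (Real.exp_log two_pos).symm⟩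
  obtain ⟨q, hq⟩ : ∃ q, q = p - 1 := ⟨_, rfl⟩
  have hq0 : q ≠ 0 := by rw [hq]; exact hp1.ne'
  have hmul : ∀ x : ℝ, (p - 1) * x = Real.exp P * x := fun x => by rw [hP]
  rw [hmul, show (p - 1) ^ (-1 / α) = Real.exp P ^ (-1 / α) by rw [hP], hw]
  simp only [← Real.exp_mul, ← Real.exp_add, ← Real.exp_sub]
  congr 1
  rw [hk, ← hq]
  field_simp
  ring

end Initial

end FracNLS

end

/-! ### Choice of the scale and conclusion. -/

theorem corollary3 (N : ℕ) (hN : 1 ≤ N) (α β p : ℝ) (hα : 0 < α) (hα1 : α < 1)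
    (hβ : 0 < β) (hβ2 : β < 2) (hp : 1 < p) (lam γ : ℂ) (s k : ℝ) (hs : 0 ≤ s)
    (u₀ : L2 N) (hu₀ : TemperedDistribution.MemSobolev s 2 (u₀ : 𝓢'(Sp N, ℂ)))
    (hγ : 0 < (γ * lam).re)
    (hlow : ∀ᵐ x : Sp N,
      (if ‖x‖ ≤ 1 then ‖x‖ ^ (-k) else 0) ≤ (Complex.I ^ (α : ℂ) * γ * u₀ x).re)
    (hk : k < min ((N : ℝ) / 2 - s) (β / (p - 1))) :
    0 < kappa0 p β k ∧
    (∃ K : ℝ, IsFracLapBound N β K) ∧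
    ∀ K : ℝ, IsFracLapBound N β K →
      ∃ ε₃ : ℝ, 0 < ε₃ ∧ ∀ ε : ℝ, ε₃ ≤ ε →
        ∃ R : ℝ, 0 < R ∧
          cC N p β lam γ K * R ^ ((N : ℝ) - β / (p - 1)) <
            initMass α β γ ((ε : ℂ) • u₀) R ∧
        ∃ Tb : ℝ,
          IsBlowupTime α p (cD N p β lam γ * R ^ (-(N : ℝ) * (p - 1)))
            (initMass α β γ ((ε : ℂ) • u₀) R
              - cC N p β lam γ K * R ^ ((N : ℝ) - β / (p - 1))) Tb ∧
          (R ^ ((N : ℝ) * (p - 1)) * Real.Gamma (1 + α) /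
            (gG p * cD N p β lam γ * (initMass α β γ ((ε : ℂ) • u₀) R
              - cC N p β lam γ K * R ^ ((N : ℝ) - β / (p - 1))) ^ (p - 1))) ^ (1 / α) ≤ Tb ∧
          Tb ≤ (R ^ ((N : ℝ) * (p - 1)) * Real.Gamma (1 + α) /
            ((p - 1) * cD N p β lam γ * (initMass α β γ ((ε : ℂ) • u₀) R
              - cC N p β lam γ K * R ^ ((N : ℝ) - β / (p - 1))) ^ (p - 1))) ^ (1 / α) ∧
          Tb ≤ B2 N α p β lam γ k K * ε ^ (-1 / (α * kappa0 p β k)) ∧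
          ∀ T : ℝ, Tb < T →
            ¬ ∃ u : ℝ → L2 N, MemX β p T u ∧ IsDistribSolution α β p lam ε u₀ T u := by
  have hp1 : 0 < p - 1 := by linarith
  have hkβ : k < β / (p - 1) := hk.trans_le (min_le_right _ _)
  have hN0 : (0 : ℝ) < N := by exact_mod_cast hN
  have hkN : k < N := by
    have := hk.trans_le (min_le_left _ _)
    linarith
  have hκ : 0 < kappa0 p β k := by
    have e : kappa0 p β k = (β / (p - 1) - k) / β := by
      rw [kappa0]; field_simp
    rw [e]
    exact div_pos (sub_pos.2 hkβ) hβ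
  refine ⟨hκ, exists_isFracLapBound hN hβ hβ2, fun K hK => ?_⟩
  have hC := cC_pos (N := N) hβ hp hγ hK.1
  have hD := cD_pos (N := N) (p := p) hβ hγ
  have hI := I2_pos (β := β) hN hkN
  have hΓ := Real.Gamma_pos_of_pos (show 0 < 1 + α by linarith)
  have hε₃ : 0 < 2 * cC N p β lam γ K / I2 N β k := by positivity
  -- This threshold is the value of `ε` at which the balancing scale equals `1`; larger `ε` keeps it
  -- in the unit ball, where the lower bound on the data is singular.
  refine ⟨2 * cC N p β lam γ K / I2 N β k, hε₃, fun ε hε => ?_⟩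
  have hε0 : 0 < ε := hε₃.trans_le hε
  have hq : 0 < 2 * cC N p β lam γ K / (ε * I2 N β k) := by positivity
  have hbal := scale_balance (N := N) hC hI hε0 (sub_pos.2 hkβ)
  have htime := time_bound_eq (N := N) (k := k) hα hβ hp hε0 hC hD hI hΓ hκ
  set R := (2 * cC N p β lam γ K / (ε * I2 N β k)) ^ (1 / (β / (p - 1) - k)) with hRdef
  have hR : 0 < R := Real.rpow_pos_of_pos hq _
  have hR1 : R ≤ 1 := by
    refine Real.rpow_le_one hq.le ?_ (one_div_pos.2 (sub_pos.2 hkβ)).le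
    rw [div_le_iff₀ hI] at hε
    rw [div_le_one (by positivity)]
    exact hε
  have hCR : 0 < cC N p β lam γ K * R ^ ((N : ℝ) - β / (p - 1)) :=
    mul_pos hC (Real.rpow_pos_of_pos hR _)
  -- The factor `2` in the balance leaves `g_R > C R^(N-β/(p-1))`, which bounds `T_b` by a quantity
  -- free of the initial mass.
  have hmass : 2 * (cC N p β lam γ K * R ^ ((N : ℝ) - β / (p - 1)))
      < initMass α β γ ((ε : ℂ) • u₀) R := by
    rw [initMass_smul hβ hR, ← hbal]
    exact mul_lt_mul_of_pos_left (initMass_ge hN hβ hR hR1 hkN hlow) hε0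
  have hg : 0 < initMass α β γ ((ε : ℂ) • u₀) R
      - cC N p β lam γ K * R ^ ((N : ℝ) - β / (p - 1)) := by linarith
  refine ⟨R, hR, sub_pos.1 hg, ?_⟩
  obtain ⟨Tb, hTb, hlo, hup, hnone⟩ := exists_blowupTime (p := p) hα hα1 hp
    (mul_pos hD (Real.rpow_pos_of_pos hR (-(N : ℝ) * (p - 1)))) hg
  have hshape : ∀ G : ℝ, Real.Gamma (1 + α) / (G * (cD N p β lam γ * R ^ (-(N : ℝ) * (p - 1)))
        * (initMass α β γ ((ε : ℂ) • u₀) R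
          - cC N p β lam γ K * R ^ ((N : ℝ) - β / (p - 1))) ^ (p - 1))
      = R ^ ((N : ℝ) * (p - 1)) * Real.Gamma (1 + α) /
        (G * cD N p β lam γ * (initMass α β γ ((ε : ℂ) • u₀) R
          - cC N p β lam γ K * R ^ ((N : ℝ) - β / (p - 1))) ^ (p - 1)) := by
    intro G
    have := Real.rpow_pos_of_pos hR ((N : ℝ) * (p - 1))
    rw [neg_mul, Real.rpow_neg hR.le, ← mul_assoc G, mul_assoc _ _⁻¹, mul_comm _⁻¹, ← mul_assoc,
      ← div_eq_mul_inv, div_div_eq_mul_div, mul_comm (Real.Gamma (1 + α))]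
  rw [hshape] at hlo hup
  refine ⟨Tb, hTb, hlo, hup, hup.trans ?_, fun T hT => ?_⟩
  · rw [B2, ← htime]
    refine Real.rpow_le_rpow (by positivity) ?_ (by positivity)
    have hle := Real.rpow_le_rpow hCR.le (show _ ≤ initMass α β γ ((ε : ℂ) • u₀) R
      - cC N p β lam γ K * R ^ ((N : ℝ) - β / (p - 1)) by linarith) hp1.le
    have := Real.rpow_pos_of_pos hCR (p - 1)
    have := Real.rpow_pos_of_pos hR ((N : ℝ) * (p - 1))
    gcongr
  · rintro ⟨u, hX, hsol⟩
    -- A solution on `[0,T)` would make its shifted mass a supersolution living beyond `T_b`.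
    exact hnone T _ hT (hsol.isSupersolution hN hα hα1 hβ hβ2 hp hγ hR hK hX (sub_pos.1 hg))
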